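/- Throughout, a system $(\mathcal X,f,\mu)$ consists of a Borel set $\mathcal X\subset\mathbb R$, a Borel map $f:\mathcal X\to\mathcal X$ and an ergodic $f$-invariant Borel probability measure $\mu$ on $\mathcal X$ that is absolutely continuous with respect to Lebesgue measure. Write $\rho\ge 0$ for its density and $d(x,y)=|x-y|$. For $\varphi:\mathcal X\to\mathbb R$ let $\|\varphi\|_{\mathrm{BV}}=\mathrm{var}(\varphi)+\sup|\varphi|$, and let $\mathrm{BV}$ be the set of $\varphi$ for which this is finite. Call $(\mathcal X,f,\mu)$ hyperbolic recurrent if the following hold. (A1) There are $C,\kappa>0$ such that for all $\varphi_1\in\mathrm{BV}$, $\varphi_2\in L^1(\mu)$ and $j\ge 0$, $$\Bigl|\int\varphi_1\cdot\varphi_2\circ f^j\,d\mu-\int\varphi_1\,d\mu\int\varphi_2\,d\mu\Bigr|\le Ce^{-\kappa j}\|\varphi_1\|_{\mathrm{BV}}\|\varphi_2\|_{L^1(\mu)}.$$ (A2) Whenever $a>0$ and $(r_n)$ is a sequence such that, for some $c>1$, $r_n/n^{-a}\in[c^{-1},c]$ for all large $n$, there are $\beta_0\in(0,1)$ and $C>0$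 such that, for all large $n$ and all integers $1\le j\le(\log n)^2$, $\mu\{x\in\mathcal X: d(x,f^jx)\le r_n\}\le C r_n^{\beta_0}$. (A3) $\mu$ has a density belonging to $\mathrm{BV}$. Call $(\mathcal X,f,\mu)$ asymptotically hyperbolic if for every $\varepsilon>0$ there is a countable union $U_\varepsilon\subset\mathcal X$ of connected sets with $\mu(U_\varepsilon)\le\varepsilon$ such that, with $Y_\varepsilon=\mathcal X\setminus U_\varepsilon$ and $F_\varepsilon$ the first return map of $f$ to $Y_\varepsilon$, the system $(Y_\varepsilon,F_\varepsilon,\mu|_{Y_\varepsilon}/\mu(Y_\varepsilon))$ is hyperbolic recurrent. Theorem. Suppose that $(\mathcal X,f,\mu)$ is asymptotically hyperbolic. Then the following hold. (1) For all $\tau>0$ and all integers $k\ge 1$, with $r_n=\tau/(2n)$ and $R_n(r,x)=\#\{1\le j\le n: d(f^jx,x)\le r\}$, $$\lim_{n\to\infty}\mu\{x\in\mathcal X: R_n(r_n,x)=k\}=\int_{\mathcal X}\frac{\tau^k\rho(x)^{k+1}}{k!}e^{-\rho(x)\tau}\,dx.$$ (2)(a) (Almost sure upper bound.) Let $(r_n)$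 be a real sequence, and suppose that one of the following holds: (i) $\rho>0$ on $\mathcal X$ and, for some $c$ with $2c\,\inf_{x\in\mathcal X}\rho(x)>1$, $r_n>\frac{c\log\log n}{n}$ for all large $n$; (ii) $\rho$ is uniformly Hölder continuous on $\mathcal X$ (there are $\eta\in(0,1]$ and $L,\delta>0$ with $|\rho(x)-\rho(y)|\le L|x-y|^{\eta}$ whenever $x,y\in\mathcal X$ and $|x-y|<\delta$) and, for some $\gamma>\gamma_0$, $r_n>\frac{(\log n)^{\gamma}}{2n}$ for all large $n$, where $\gamma_0$ is such that $$\sum_{k\ge 1}\int_{\mathcal X}\rho(x)e^{-\epsilon k^{\gamma_0}\rho(x)}\,dx<\infty\quad\text{for all }\epsilon>0.$$ Then $\mu\{x\in\mathcal X:\min_{1\le k\le n}d(f^kx,x)<r_n\text{ for all sufficiently large }n\}=1$. (2)(b) (Almost sure lower bound.) If $(r_n)_{n\ge1}$ is a non-increasing real sequence with $\sum_{n\ge1}\int_{\mathcal X}\mu(B(x,r_n))\,d\mu(x)<\infty$, where $B(x,r)$ is the open ball, then $\mu\{x\in\mathcal X:\min_{1\le k\le n}d(f^kx,x)>r_n\text{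 for all sufficiently large }n\}=1$. -/

import Mathlib

open MeasureTheory Set Filter Topology

noncomputable section

namespace Recurrence

/-- `X` is a Borel subset of the line, `f` maps `X` to itself, and `μ` is an ergodic `f`-invariant
Borel probability measure carried by `X` and absolutely continuous with respect to Lebesgue
measure (an ergodic acip). Only the values of `f` on `X` matter. -/
structure IsErgodicAcip (X : Set ℝ) (f : ℝ → ℝ) (μ : Measure ℝ) : Prop where
  measurableSet : MeasurableSet X
  mapsTo : MapsTo f X X
  isProbabilityMeasure : IsProbabilityMeasure μ
  measure_compl : μ Xᶜ = 0
  ergodic : Ergodic f μ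
  absolutelyContinuous : μ ≪ volume

/-- `ρ` is a (version of the) density of `μ` with respect to Lebesgue measure on `X`. -/
structure IsDensity (X : Set ℝ) (μ : Measure ℝ) (ρ : ℝ → ℝ) : Prop where
  aemeasurable : AEMeasurable ρ (volume.restrict X)
  nonneg : ∀ x ∈ X, 0 ≤ ρ x
  eq_withDensity : μ = (volume.restrict X).withDensity (fun x => ENNReal.ofReal (ρ x))

/-- The norm `var(φ) + sup |φ|` of a function of bounded variation on `X`. -/
def bvNorm (X : Set ℝ) (φ : ℝ → ℝ) : ℝ :=
  (eVariationOn φ X).toReal + ⨆ x : X, |φ x|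

/-- Exponential decay of correlations for `BV` functions versus `L¹(μ)` functions. -/
def ExpDecayBVL1 (X : Set ℝ) (f : ℝ → ℝ) (μ : Measure ℝ) : Prop :=
  ∃ C κ : ℝ, 0 < C ∧ 0 < κ ∧ ∀ φ₁ φ₂ : ℝ → ℝ, BoundedVariationOn φ₁ X → Integrable φ₂ μ →
    ∀ j : ℕ, |∫ x, φ₁ x * φ₂ (f^[j] x) ∂μ - (∫ x, φ₁ x ∂μ) * ∫ x, φ₂ x ∂μ| ≤
      C * Real.exp (-κ * j) * bvNorm X φ₁ * ∫ x, |φ₂ x| ∂μ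

/-- The set of points of `X` that are `r`-close to their `j`-th iterate. -/
def returnSet (X : Set ℝ) (f : ℝ → ℝ) (j : ℕ) (r : ℝ) : Set ℝ :=
  {x ∈ X | dist x (f^[j] x) ≤ r}

/-- Short return times: whenever `r n ≈ n ^ (-a)` with `a > 0`, the sets of points that are
`r n`-close to their `j`-th iterate have measure at most `C * (r n) ^ β₀`, uniformly in
`1 ≤ j ≤ (log n)²`. -/
def ShortReturns (X : Set ℝ) (f : ℝ → ℝ) (μ : Measure ℝ) : Prop :=
  ∀ (a : ℝ) (r : ℕ → ℝ), 0 < a →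
    (∃ c : ℝ, 1 < c ∧ ∀ᶠ n : ℕ in atTop, r n / (n : ℝ) ^ (-a) ∈ Icc c⁻¹ c) →
    ∃ β₀ ∈ Ioo (0 : ℝ) 1, ∃ C : ℝ, 0 < C ∧ ∀ᶠ n : ℕ in atTop, ∀ j : ℕ, 1 ≤ j →
      (j : ℝ) ≤ Real.log n ^ 2 → μ.real (returnSet X f j (r n)) ≤ C * r n ^ β₀

/-- Hyperbolic recurrent systems. -/
structure HyperbolicRecurrent (X : Set ℝ) (f : ℝ → ℝ) (μ : Measure ℝ) : Prop where
  isErgodicAcip : IsErgodicAcip X f μ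
  expDecay : ExpDecayBVL1 X f μ
  shortReturns : ShortReturns X f μ
  density_bv : ∃ ρ : ℝ → ℝ, IsDensity X μ ρ ∧ BoundedVariationOn ρ X

/-- The first return time to `Y` (with value `0` at points that never return). -/
def firstReturn (f : ℝ → ℝ) (Y : Set ℝ) (x : ℝ) : ℕ :=
  sInf {n : ℕ | 1 ≤ n ∧ f^[n] x ∈ Y}

/-- The first return map to `Y`; the points of `Y` that never return, which form a null set for
an invariant probability measure, are left fixed. -/
def returnMap (f : ℝ → ℝ) (Y : Set ℝ) (x : ℝ) : ℝ :=
  f^[firstReturn f Y x] x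

/-- Asymptotically hyperbolic systems: for each `ε > 0` one may remove a countable union of
connected sets, of measure at most `ε`, such that the first return map to the rest, with the
normalised restriction of `μ`, is hyperbolic recurrent. -/
def AsymptoticallyHyperbolic (X : Set ℝ) (f : ℝ → ℝ) (μ : Measure ℝ) : Prop :=
  ∀ ε : ℝ, 0 < ε → ∃ (ι : Type) (_ : Countable ι) (U : ι → Set ℝ),
    (∀ i, IsConnected (U i) ∧ U i ⊆ X) ∧
    μ (⋃ i, U i) ≤ ENNReal.ofReal ε ∧
    HyperbolicRecurrent (X \ ⋃ i, U i) (returnMap f (X \ ⋃ i, U i))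
      (ProbabilityTheory.cond μ (X \ ⋃ i, U i))

/-- The number of `1 ≤ j ≤ n` with `d(f^j x, x) ≤ r`. -/
def recCount (f : ℝ → ℝ) (n : ℕ) (r x : ℝ) : ℕ :=
  {j ∈ Finset.Icc 1 n | dist (f^[j] x) x ≤ r}.card

/-- `min_{1 ≤ k ≤ n} d(f^k x, x)`, for `n ≥ 1`. -/
def recMin (f : ℝ → ℝ) (n : ℕ) (x : ℝ) : ℝ :=
  sInf ((fun k : ℕ => dist (f^[k] x) x) '' Icc 1 n)

/-- `ρ` is uniformly Hölder continuous on `X`. -/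
def UniformlyHolderOn (X : Set ℝ) (ρ : ℝ → ℝ) : Prop :=
  ∃ η L δ : ℝ, η ∈ Ioc (0 : ℝ) 1 ∧ 0 < L ∧ 0 < δ ∧
    ∀ x ∈ X, ∀ y ∈ X, |x - y| < δ → |ρ x - ρ y| ≤ L * |x - y| ^ η

end Recurrence

end

/-!
The events are discretised: `f^[j] x` is `r`-close to `x` when both points lie in a common union
of a few cells of a grid, up to an error of one mesh. For a fixed cell, decay of correlations of
its indicator turns the chance that the orbit avoids the cell, or more generally the expectation
of `(1 - u) ^ R` with `R` its number of visits, into an approximate product, hence into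
`exp (-u * N * μ(cell))`. The errors are the early returns, which are polynomially rare, and the
mixing error across a gap of `(log n) ^ 2` steps, so they survive summation over all cells and,
along geometric subsequences, the Borel-Cantelli lemma. Lebesgue differentiation replaces
`μ(cell)` by `ρ x` times the length of the cell.

This applies to an induced system on `Y`. Its clock is related to that of `f` by ergodicity (about
`n * μ Y` visits to `Y` up to time `n`), and the close returns to a point of `Y` happen inside `Y`
with high probability because almost every point of `Y` is a density point of `Y`. As `μ Y` can be
taken arbitrarily close to `1`, everything passes to `f`. In the limit law this yields the
convergence of `∫ (1 - u) ^ R_n dμ` to `∫ exp (-u * τ * ρ) dμ` for all `u`, and the generating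
functions determine the distribution of `R_n`.
-/

noncomputable section

namespace Recurrence

/-- The union of the `2 * q + 1` consecutive cells of the grid of mesh `ℓ` centred at the `i`-th
one, `[i * ℓ, (i + 1) * ℓ)`. Closeness of two points is discretised as membership in a common
such interval. -/
def cell (ℓ : ℝ) (q : ℕ) (i : ℤ) : Set ℝ := Ico ((i - q) * ℓ) ((i + q + 1) * ℓ)

section cell

variable {ℓ : ℝ} {q : ℕ} {i : ℤ} {x y : ℝ}

lemma measurableSet_cell (ℓ : ℝ) (q : ℕ) (i : ℤ) : MeasurableSet (cell ℓ q i) :=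
  measurableSet_Ico

lemma volume_cell (ℓ : ℝ) (q : ℕ) (i : ℤ) :
    volume (cell ℓ q i) = ENNReal.ofReal ((2 * q + 1) * ℓ) := by
  rw [cell, Real.volume_Ico]; congr 1; ring

lemma measurable_comp_floor_div {β : Type*} [MeasurableSpace β] (ℓ : ℝ) (g : ℤ → β) :
    Measurable fun x : ℝ => g ⌊x / ℓ⌋ :=
  (measurable_of_countable g).comp (Int.measurable_floor.comp (measurable_id.div_const ℓ))

lemma mem_cell_iff (hℓ : 0 < ℓ) : y ∈ cell ℓ q i ↔ i - q ≤ ⌊y / ℓ⌋ ∧ ⌊y / ℓ⌋ ≤ i + q := by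
  have left_iff : (i - q : ℤ) ≤ ⌊y / ℓ⌋ ↔ ((i : ℝ) - q) * ℓ ≤ y := by
    rw [Int.le_floor, le_div_iff₀ hℓ]; push_cast; rfl
  have right_iff : ⌊y / ℓ⌋ ≤ i + q ↔ y < ((i : ℝ) + q + 1) * ℓ := by
    rw [← Int.lt_add_one_iff, Int.floor_lt, div_lt_iff₀ hℓ]; push_cast; rfl
  rw [left_iff, right_iff]; rfl

lemma mem_cell_zero_iff (hℓ : 0 < ℓ) : y ∈ cell ℓ 0 i ↔ ⌊y / ℓ⌋ = i := by
  rw [mem_cell_iff hℓ]; simp only [Nat.cast_zero, sub_zero, add_zero]; omega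

lemma mem_cell_floor (hℓ : 0 < ℓ) (q : ℕ) (y : ℝ) : y ∈ cell ℓ q ⌊y / ℓ⌋ := by
  rw [mem_cell_iff hℓ]; omega

lemma pairwise_disjoint_cell_zero (hℓ : 0 < ℓ) :
    Pairwise (Function.onFun Disjoint (cell ℓ 0)) := by
  intro i j hij
  rw [Function.onFun, Set.disjoint_left]
  intro x hi hj
  rw [mem_cell_zero_iff hℓ] at hi hj
  exact hij (hi.symm.trans hj)

lemma dist_lt_of_mem_cell (hℓ : 0 < ℓ) (hy : y ∈ cell ℓ q ⌊x / ℓ⌋) :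
    dist y x < (q + 1) * ℓ := by
  obtain ⟨hy_left, hy_right⟩ := hy
  obtain ⟨hx_left, hx_right⟩ := mem_cell_floor hℓ 0 x
  simp only [Nat.cast_zero, sub_zero, add_zero] at hx_left hx_right
  rw [Real.dist_eq, abs_lt]
  constructor <;> nlinarith

lemma mem_cell_of_dist_le (hℓ : 0 < ℓ) (h : dist y x ≤ q * ℓ) : y ∈ cell ℓ q ⌊x / ℓ⌋ := by
  rw [mem_cell_iff hℓ]
  rw [Real.dist_eq, abs_le] at h
  have upper : y / ℓ ≤ x / ℓ + (q : ℤ) := by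
    rw [div_add' _ _ _ hℓ.ne']; push_cast; gcongr; linarith
  have lower : x / ℓ + ((-q : ℤ) : ℝ) ≤ y / ℓ := by
    rw [div_add' _ _ _ hℓ.ne']; push_cast; gcongr; linarith
  have floor_upper := Int.floor_mono upper
  have floor_lower := Int.floor_mono lower
  rw [Int.floor_add_intCast] at floor_upper floor_lower
  omega

lemma dist_le_of_mem_cell_of_mem_cell (hx : x ∈ cell ℓ q i) (hy : y ∈ cell ℓ q i) :
    dist x y ≤ (2 * q + 1) * ℓ := by
  obtain ⟨hx_left, hx_right⟩ := hx
  obtain ⟨hy_left, hy_right⟩ := hy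
  rw [Real.dist_eq, abs_le]
  constructor <;> nlinarith

lemma card_filter_mem_cell_le (hℓ : 0 < ℓ) (q : ℕ) (s : Finset ℤ) (y : ℝ)
    [DecidablePred fun i => y ∈ cell ℓ q i] :
    (s.filter fun i => y ∈ cell ℓ q i).card ≤ 2 * q + 1 := by
  calc (s.filter fun i => y ∈ cell ℓ q i).card
      ≤ (Finset.Icc (⌊y / ℓ⌋ - q) (⌊y / ℓ⌋ + q)).card := by
        refine Finset.card_le_card fun i hi => ?_
        rw [Finset.mem_filter, mem_cell_iff hℓ] at hi
        rw [Finset.mem_Icc]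
        omega
    _ ≤ 2 * q + 1 := by rw [Int.card_Icc]; omega

lemma sum_measureReal_le_mul_of_card_le {α ι : Type*} [MeasurableSpace α] {ν : Measure α}
    [IsFiniteMeasure ν] {s : Finset ι} {E : ι → Set α} {B : Set α} {K : ℕ}
    [∀ x, DecidablePred fun i => x ∈ E i]
    (hE : ∀ i, MeasurableSet (E i)) (hB : MeasurableSet B) (hEB : ∀ i, E i ⊆ B)
    (hcard : ∀ x ∈ B, (s.filter fun i => x ∈ E i).card ≤ K) :
    ∑ i ∈ s, ν.real (E i) ≤ K * ν.real B := by
  have integrable_ind : ∀ {A : Set α}, MeasurableSet A → Integrable (A.indicator (1 : α → ℝ)) ν :=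
    fun hA => (integrable_const (1 : ℝ)).indicator hA
  calc ∑ i ∈ s, ν.real (E i) = ∫ x, ∑ i ∈ s, (E i).indicator (1 : α → ℝ) x ∂ν := by
        rw [integral_finsetSum _ fun i _ => integrable_ind (hE i)]
        simp_rw [integral_indicator_one (hE _)]
    _ ≤ ∫ x, K * B.indicator (1 : α → ℝ) x ∂ν := by
        refine integral_mono (integrable_finsetSum _ fun i _ => integrable_ind (hE i))
          ((integrable_ind hB).const_mul _) fun x => ?_
        by_cases hx : x ∈ B
        · simpa [indicator_apply, hx, Finset.sum_boole] using hcard x hx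
        · have hxE : ∀ i, x ∉ E i := fun i h => hx (hEB i h)
          simp [hx, hxE]
    _ = K * ν.real B := by rw [integral_const_mul, integral_indicator_one hB]

lemma sum_measureReal_le_of_subset_cell {ν : Measure ℝ} [IsFiniteMeasure ν] (hℓ : 0 < ℓ)
    (s : Finset ℤ) {E : ℤ → Set ℝ} {B : Set ℝ} (hE : ∀ i, MeasurableSet (E i))
    (hB : MeasurableSet B) (hEB : ∀ i, E i ⊆ B) (hE_cell : ∀ i, E i ⊆ cell ℓ q i) :
    ∑ i ∈ s, ν.real (E i) ≤ (2 * q + 1) * ν.real B := by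
  classical
  have := sum_measureReal_le_mul_of_card_le (ν := ν) (s := s) hE hB hEB fun x _ =>
    (Finset.card_le_card (Finset.monotone_filter_right s fun i _ h => hE_cell i h)).trans
      (card_filter_mem_cell_le hℓ q s x)
  exact_mod_cast this

lemma sum_measureReal_cell_zero_le {ν : Measure ℝ} [IsProbabilityMeasure ν] (hℓ : 0 < ℓ)
    (s : Finset ℤ) : ∑ i ∈ s, ν.real (cell ℓ 0 i) ≤ 1 := by
  simpa using sum_measureReal_le_of_subset_cell (ν := ν) hℓ s (measurableSet_cell ℓ 0)
    MeasurableSet.univ (fun _ => subset_univ _) fun _ => Subset.rfl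

end cell

lemma eVariationOn_le_of_edist_le {α E : Type*} [LinearOrder α] [PseudoEMetricSpace E] {φ : α → E}
    {G : α → ℝ} {s : Set α} {M : ℝ} (hG : ∀ x y, x ≤ y → G y - G x ≤ M)
    (hφ : ∀ x y, x ≤ y → edist (φ y) (φ x) ≤ ENNReal.ofReal (G y - G x)) (hmono : Monotone G) :
    eVariationOn φ s ≤ ENNReal.ofReal M := by
  refine iSup_le fun ⟨n, u, hu, _⟩ => ?_
  calc ∑ i ∈ Finset.range n, edist (φ (u (i + 1))) (φ (u i))
      ≤ ∑ i ∈ Finset.range n, ENNReal.ofReal (G (u (i + 1)) - G (u i)) :=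
        Finset.sum_le_sum fun i _ => hφ _ _ (hu i.le_succ)
    _ = ENNReal.ofReal (G (u n) - G (u 0)) := by
        rw [← ENNReal.ofReal_sum_of_nonneg, Finset.sum_range_sub (fun i => G (u i))]
        exact fun i _ => sub_nonneg.2 (hmono (hu i.le_succ))
    _ ≤ ENNReal.ofReal M := ENNReal.ofReal_le_ofReal (hG _ _ (hu n.zero_le))

lemma eVariationOn_indicator_Ico_le (a b : ℝ) (X : Set ℝ) :
    eVariationOn ((Ico a b).indicator (1 : ℝ → ℝ)) X ≤ 2 := by
  rcases le_or_gt b a with hba | hab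
  · rw [Ico_eq_empty (not_lt.2 hba), indicator_empty, eVariationOn.constant_on]
    · exact zero_le
    · rintro _ ⟨x, _, rfl⟩ _ ⟨y, _, rfl⟩; rfl
  -- `G` jumps up by one at both endpoints, so it dominates the increments of the indicator.
  set G : ℝ → ℝ := fun x => (if a ≤ x then 1 else 0) + (if b ≤ x then 1 else 0) with hG
  have increment_le : ∀ x y, x ≤ y →
      |(Ico a b).indicator (1 : ℝ → ℝ) y - (Ico a b).indicator (1 : ℝ → ℝ) x| ≤ G y - G x := by
    intro x y hxy
    simp only [hG, indicator, mem_Ico, Pi.one_apply]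
    split_ifs <;> first | (exfalso; grind) | norm_num
  have G_le : ∀ x y, x ≤ y → G y - G x ≤ 2 := by
    intro x y _
    simp only [hG]
    split_ifs <;> norm_num
  refine (eVariationOn_le_of_edist_le G_le (fun x y hxy => ?_) fun x y hxy => ?_).trans_eq
    (by norm_num)
  · rw [edist_dist, Real.dist_eq]
    exact ENNReal.ofReal_le_ofReal (increment_le x y hxy)
  · exact sub_nonneg.1 ((abs_nonneg _).trans (increment_le x y hxy))

lemma bvNorm_indicator_Ico_le (a b : ℝ) (X : Set ℝ) :
    bvNorm X ((Ico a b).indicator (1 : ℝ → ℝ)) ≤ 3 := by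
  have variation_le : (eVariationOn ((Ico a b).indicator (1 : ℝ → ℝ)) X).toReal ≤ 2 :=
    ENNReal.toReal_le_of_le_ofReal (by norm_num)
      ((eVariationOn_indicator_Ico_le a b X).trans (by norm_num))
  have sup_le : ⨆ x : X, |(Ico a b).indicator (1 : ℝ → ℝ) x| ≤ 1 := by
    refine Real.iSup_le (fun x => ?_) zero_le_one
    by_cases hx : (x : ℝ) ∈ Ico a b <;> simp [hx]
  unfold bvNorm
  linarith

/-- Exponential decay of correlations of indicators of grid intervals against `L¹`, with the
correlation written as a set integral. -/
def CellDecay (F : ℝ → ℝ) (ν : Measure ℝ) (C κ : ℝ) : Prop :=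
  ∀ (ℓ : ℝ) (q : ℕ) (i : ℤ) (φ : ℝ → ℝ), Integrable φ ν → ∀ j : ℕ,
    |∫ x in cell ℓ q i, φ (F^[j] x) ∂ν - ν.real (cell ℓ q i) * ∫ x, φ x ∂ν| ≤
      C * Real.exp (-κ * j) * ∫ x, |φ x| ∂ν

lemma indicator_one_mul_eq {α : Type*} (A : Set α) (g : α → ℝ) :
    (fun x => A.indicator 1 x * g x) = A.indicator g := by
  ext x
  by_cases hx : x ∈ A <;> simp [hx]

lemma ExpDecayBVL1.exists_cellDecay {Y : Set ℝ} {F : ℝ → ℝ} {ν : Measure ℝ}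
    (h : ExpDecayBVL1 Y F ν) : ∃ C κ : ℝ, 0 < C ∧ 0 < κ ∧ CellDecay F ν C κ := by
  obtain ⟨C, κ, hC, hκ, hdecay⟩ := h
  refine ⟨3 * C, κ, by positivity, hκ, fun ℓ q i φ hφ j => ?_⟩
  have hbv : BoundedVariationOn ((cell ℓ q i).indicator (1 : ℝ → ℝ)) Y :=
    ((eVariationOn_indicator_Ico_le _ _ Y).trans_lt (by norm_num)).ne
  have hcorr := hdecay _ φ hbv hφ j
  rw [integral_indicator_one (measurableSet_cell ℓ q i),
    indicator_one_mul_eq (cell ℓ q i) (fun x => φ (F^[j] x)),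
    integral_indicator (measurableSet_cell ℓ q i)] at hcorr
  have bvNorm_le : bvNorm Y ((cell ℓ q i).indicator 1) ≤ 3 := bvNorm_indicator_Ico_le _ _ Y
  have : 0 ≤ ∫ x, |φ x| ∂ν := integral_nonneg fun x => abs_nonneg _
  calc |∫ x in cell ℓ q i, φ (F^[j] x) ∂ν - ν.real (cell ℓ q i) * ∫ x, φ x ∂ν|
      ≤ C * Real.exp (-κ * j) * bvNorm Y ((cell ℓ q i).indicator 1) * ∫ x, |φ x| ∂ν := hcorr
    _ ≤ C * Real.exp (-κ * j) * 3 * ∫ x, |φ x| ∂ν := by gcongr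
    _ = 3 * C * Real.exp (-κ * j) * ∫ x, |φ x| ∂ν := by ring

lemma integral_comp_of_measurePreserving {α E : Type*} [MeasurableSpace α] [NormedAddCommGroup E]
    [NormedSpace ℝ E] {ν : Measure α} {F : α → α} (hF : MeasurePreserving F ν ν) {g : α → E}
    (hg : AEStronglyMeasurable g ν) : ∫ x, g (F x) ∂ν = ∫ x, g x ∂ν := by
  conv_rhs => rw [← hF.map_eq]
  rw [integral_map hF.measurable.aemeasurable (by rwa [hF.map_eq])]

lemma one_sub_sum_le_prod_one_sub {ι : Type*} (s : Finset ι) {b : ι → ℝ}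
    (hb : ∀ i ∈ s, b i ∈ Icc (0 : ℝ) 1) : 1 - ∑ i ∈ s, b i ≤ ∏ i ∈ s, (1 - b i) := by
  classical
  induction s using Finset.induction_on with
  | empty => simp
  | insert a s ha ih =>
    rw [Finset.forall_mem_insert] at hb
    rw [Finset.sum_insert ha, Finset.prod_insert ha]
    have prod_le_one : ∏ i ∈ s, (1 - b i) ≤ 1 :=
      Finset.prod_le_one (fun i hi => sub_nonneg.2 (hb.2 i hi).2)
        fun i hi => sub_le_self _ (hb.2 i hi).1
    nlinarith [hb.1.1, hb.1.2, ih hb.2]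

lemma abs_sub_pow_le_of_abs_succ_sub_mul_le {a : ℕ → ℝ} {r η : ℝ} (h0 : a 0 = 1) (hr : |r| ≤ 1)
    (ha : ∀ N, |a (N + 1) - r * a N| ≤ η) (N : ℕ) : |a N - r ^ N| ≤ N * η := by
  induction N with
  | zero => simp [h0]
  | succ N ih =>
    calc |a (N + 1) - r ^ (N + 1)| = |(a (N + 1) - r * a N) + r * (a N - r ^ N)| := by
          congr 1; ring
      _ ≤ η + 1 * (N * η) := by
          refine (abs_add_le _ _).trans (add_le_add (ha N) ?_)
          rw [abs_mul]
          exact mul_le_mul hr ih (abs_nonneg _) zero_le_one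
      _ = (N + 1 : ℕ) * η := by push_cast; ring

lemma setIntegral_indicator_one_comp {α : Type*} [MeasurableSpace α] {ν : Measure α} {g : α → α}
    (hg : Measurable g) {J : Set α} (hJ : MeasurableSet J) (A : Set α) :
    ∫ x in A, J.indicator (1 : α → ℝ) (g x) ∂ν = ν.real (A ∩ g ⁻¹' J) := by
  have : (fun x => J.indicator (1 : α → ℝ) (g x)) = (g ⁻¹' J).indicator 1 := rfl
  rw [this, integral_indicator_one (hg hJ), measureReal_restrict_apply (hg hJ), inter_comm]

lemma integrable_of_mem_Icc {α : Type*} [MeasurableSpace α] {ν : Measure α} [IsFiniteMeasure ν]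
    {g : α → ℝ} (hg : AEStronglyMeasurable g ν) (h : ∀ x, g x ∈ Icc (0 : ℝ) 1) :
    Integrable g ν :=
  Integrable.of_bound hg 1 <| Eventually.of_forall fun x => by
    rw [Real.norm_of_nonneg (h x).1]; exact (h x).2

/-- The probability of surviving the times `0 ≤ m < N` for a particle that follows the orbit of `y`
and is killed with probability `u` at each visit to `J`. It is `(1 - u) ^ R`, with `R` the number
of visits, so `u = 1` detects the absence of visits and general `u` gives the generating function
of their number. -/
def survivalWeight {α : Type*} (F : α → α) (J : Set α) (u : ℝ) (N : ℕ) (y : α) : ℝ :=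
  ∏ m ∈ Finset.range N, (1 - u * J.indicator 1 (F^[m] y))

section survivalWeight

variable {α : Type*} {F : α → α} {J : Set α} {u : ℝ}

lemma mul_indicator_mem_Icc (hu : u ∈ Icc (0 : ℝ) 1) (J : Set α) (y : α) :
    u * J.indicator 1 y ∈ Icc (0 : ℝ) 1 := by
  by_cases hy : y ∈ J
  · simpa [hy] using hu
  · simp [hy]

lemma survivalWeight_zero (y : α) : survivalWeight F J u 0 y = 1 := Finset.prod_range_zero _

lemma survivalWeight_nonneg (hu : u ∈ Icc (0 : ℝ) 1) (N : ℕ) (y : α) :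
    0 ≤ survivalWeight F J u N y :=
  Finset.prod_nonneg fun _ _ => sub_nonneg.2 (mul_indicator_mem_Icc hu J _).2

lemma survivalWeight_le_one (hu : u ∈ Icc (0 : ℝ) 1) (N : ℕ) (y : α) :
    survivalWeight F J u N y ≤ 1 :=
  Finset.prod_le_one (fun _ _ => sub_nonneg.2 (mul_indicator_mem_Icc hu J _).2)
    fun _ _ => sub_le_self _ (mul_indicator_mem_Icc hu J _).1

lemma survivalWeight_succ (N : ℕ) (y : α) : survivalWeight F J u (N + 1) y =
    survivalWeight F J u N (F y) - u * J.indicator (fun y => survivalWeight F J u N (F y)) y := by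
  have factor : survivalWeight F J u (N + 1) y =
      (1 - u * J.indicator 1 y) * survivalWeight F J u N (F y) := by
    simp only [survivalWeight, Finset.prod_range_succ', Function.iterate_succ_apply,
      Function.iterate_zero_apply]
    ring
  rw [factor, ← congr_fun (indicator_one_mul_eq J fun y => survivalWeight F J u N (F y)) y]
  ring

lemma survivalWeight_add (M N : ℕ) (y : α) : survivalWeight F J u (M + N) y =
    survivalWeight F J u M y * survivalWeight F J u N (F^[M] y) := by
  simp only [survivalWeight, Finset.prod_range_add, ← Function.iterate_add_apply]
  congr 1
  exact Finset.prod_congr rfl fun m _ => by rw [add_comm M m]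

lemma one_sub_sum_le_survivalWeight (hu : u ∈ Icc (0 : ℝ) 1) (M : ℕ) (y : α) :
    1 - ∑ m ∈ Finset.range M, J.indicator 1 (F^[m] y) ≤ survivalWeight F J u M y := by
  refine le_trans ?_ (one_sub_sum_le_prod_one_sub (Finset.range M)
    fun m _ => mul_indicator_mem_Icc hu J (F^[m] y))
  gcongr with m
  exact mul_le_of_le_one_left (indicator_nonneg (fun _ _ => zero_le_one) _) hu.2

lemma survivalWeight_comp_le_comp_iterate (hu : u ∈ Icc (0 : ℝ) 1) (N : ℕ) {p : ℕ} (hp : 1 ≤ p)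
    (y : α) : survivalWeight F J u N (F y) ≤ survivalWeight F J u (N + 1 - p) (F^[p] y) := by
  obtain ⟨k, rfl⟩ : ∃ k, p = k + 1 := ⟨p - 1, by omega⟩
  rcases Nat.lt_or_ge N k with hNk | hkN
  · rw [show N + 1 - (k + 1) = 0 by omega, survivalWeight_zero]
    exact survivalWeight_le_one hu _ _
  · obtain ⟨M, rfl⟩ := Nat.exists_eq_add_of_le hkN
    rw [show k + M + 1 - (k + 1) = M by omega, survivalWeight_add, Function.iterate_succ_apply]
    exact mul_le_of_le_one_left (survivalWeight_nonneg hu _ _) (survivalWeight_le_one hu _ _)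

lemma survivalWeight_comp_iterate_le_add (hu : u ∈ Icc (0 : ℝ) 1) (N : ℕ) {p : ℕ} (hp : 1 ≤ p)
    (y : α) : survivalWeight F J u (N + 1 - p) (F^[p] y) ≤
      survivalWeight F J u N (F y) + ∑ j ∈ Finset.Ico 1 p, J.indicator 1 (F^[j] y) := by
  have one_sub_le : ∀ M ≤ p - 1, 1 - ∑ j ∈ Finset.Ico 1 p, J.indicator 1 (F^[j] y) ≤
      survivalWeight F J u M (F y) := by
    intro M hM
    refine le_trans (sub_le_sub_left ?_ 1) (one_sub_sum_le_survivalWeight hu M (F y))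
    rw [Finset.sum_Ico_eq_sum_range]
    calc ∑ m ∈ Finset.range M, J.indicator (1 : α → ℝ) (F^[m] (F y))
        ≤ ∑ m ∈ Finset.range (p - 1), J.indicator (1 : α → ℝ) (F^[m] (F y)) :=
          Finset.sum_le_sum_of_subset_of_nonneg (Finset.range_subset_range.2 hM)
            fun _ _ _ => indicator_nonneg (fun _ _ => zero_le_one) _
      _ = ∑ m ∈ Finset.range (p - 1), J.indicator (1 : α → ℝ) (F^[1 + m] y) := by
          simp only [add_comm 1, Function.iterate_succ_apply]
  obtain ⟨k, rfl⟩ : ∃ k, p = k + 1 := ⟨p - 1, by omega⟩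
  rcases Nat.lt_or_ge N k with hNk | hkN
  · rw [show N + 1 - (k + 1) = 0 by omega, survivalWeight_zero]
    linarith [one_sub_le N (by omega)]
  · obtain ⟨M, rfl⟩ := Nat.exists_eq_add_of_le hkN
    rw [show k + M + 1 - (k + 1) = M by omega, survivalWeight_add, Function.iterate_succ_apply]
    have first_le := one_sub_le k le_rfl
    have first_le_one := survivalWeight_le_one (F := F) (J := J) hu k (F y)
    have second_le_one := survivalWeight_le_one (F := F) (J := J) hu M (F^[k] (F y))
    nlinarith [mul_nonneg (sub_nonneg.2 first_le_one) (sub_nonneg.2 second_le_one)]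

variable [MeasurableSpace α] {ν : Measure α}

lemma measurable_survivalWeight (hF : Measurable F) (hJ : MeasurableSet J) (u : ℝ) (N : ℕ) :
    Measurable (survivalWeight F J u N) :=
  Finset.measurable_fun_prod _ fun m _ => measurable_const.sub <| measurable_const.mul <|
    (measurable_one.indicator hJ).comp (hF.iterate m)

lemma integrable_survivalWeight_comp [IsFiniteMeasure ν] (hF : Measurable F) (hJ : MeasurableSet J)
    (hu : u ∈ Icc (0 : ℝ) 1) (N p : ℕ) :
    Integrable (fun x => survivalWeight F J u N (F^[p] x)) ν :=
  integrable_of_mem_Icc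
    ((measurable_survivalWeight hF hJ u N).comp (hF.iterate p)).aestronglyMeasurable
    fun _ => ⟨survivalWeight_nonneg hu _ _, survivalWeight_le_one hu _ _⟩

lemma integrable_survivalWeight [IsFiniteMeasure ν] (hF : Measurable F) (hJ : MeasurableSet J)
    (hu : u ∈ Icc (0 : ℝ) 1) (N : ℕ) : Integrable (survivalWeight F J u N) ν :=
  integrable_survivalWeight_comp hF hJ hu N 0

lemma integral_abs_survivalWeight_le [IsProbabilityMeasure ν] (hF : Measurable F)
    (hJ : MeasurableSet J) (hu : u ∈ Icc (0 : ℝ) 1) (N : ℕ) :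
    ∫ x, |survivalWeight F J u N x| ∂ν ≤ 1 := by
  calc ∫ x, |survivalWeight F J u N x| ∂ν ≤ ∫ _, (1 : ℝ) ∂ν :=
        integral_mono (integrable_survivalWeight hF hJ hu N).abs (integrable_const _) fun x => by
          dsimp only
          rw [abs_of_nonneg (survivalWeight_nonneg hu N x)]
          exact survivalWeight_le_one hu N x
    _ = 1 := by simp

lemma integral_survivalWeight_succ [IsFiniteMeasure ν] (hF : MeasurePreserving F ν ν)
    (hJ : MeasurableSet J) (hu : u ∈ Icc (0 : ℝ) 1) (N : ℕ) :
    ∫ x, survivalWeight F J u (N + 1) x ∂ν =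
      ∫ x, survivalWeight F J u N x ∂ν - u * ∫ x in J, survivalWeight F J u N (F x) ∂ν := by
  have integrable_comp : Integrable (fun x => survivalWeight F J u N (F x)) ν :=
    integrable_survivalWeight_comp hF.measurable hJ hu N 1
  simp_rw [survivalWeight_succ]
  rw [integral_sub integrable_comp ((integrable_comp.indicator hJ).const_mul u),
    integral_const_mul, integral_indicator hJ, integral_comp_of_measurePreserving hF
      (integrable_survivalWeight hF.measurable hJ hu N).aestronglyMeasurable]

lemma setIntegral_survivalWeight_comp_le [IsFiniteMeasure ν] (hF : Measurable F)
    (hJ : MeasurableSet J) (hu : u ∈ Icc (0 : ℝ) 1) (N : ℕ) {p : ℕ} (hp : 1 ≤ p) (A : Set α) :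
    ∫ x in A, survivalWeight F J u N (F x) ∂ν ≤
      ∫ x in A, survivalWeight F J u (N + 1 - p) (F^[p] x) ∂ν :=
  integral_mono (integrable_survivalWeight_comp hF hJ hu N 1)
    (integrable_survivalWeight_comp hF hJ hu _ p)
    fun x => survivalWeight_comp_le_comp_iterate hu N hp x

lemma setIntegral_survivalWeight_comp_iterate_le_add [IsFiniteMeasure ν] (hF : Measurable F)
    (hJ : MeasurableSet J) (hu : u ∈ Icc (0 : ℝ) 1) (N : ℕ) {p : ℕ} (hp : 1 ≤ p) (A : Set α) :
    ∫ x in A, survivalWeight F J u (N + 1 - p) (F^[p] x) ∂ν ≤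
      ∫ x in A, survivalWeight F J u N (F x) ∂ν +
        ∑ j ∈ Finset.Ico 1 p, ν.real (A ∩ F^[j] ⁻¹' J) := by
  have integrable_visit : ∀ j ∈ Finset.Ico 1 p,
      Integrable (fun x => J.indicator (1 : α → ℝ) (F^[j] x)) (ν.restrict A) := fun j _ =>
    integrable_of_mem_Icc
      ((measurable_one.indicator hJ).comp (hF.iterate j)).aestronglyMeasurable
      fun x => by simpa using mul_indicator_mem_Icc (u := 1) (by simp) J (F^[j] x)
  have integrable_comp : Integrable (fun x => survivalWeight F J u N (F x)) (ν.restrict A) :=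
    integrable_survivalWeight_comp hF hJ hu N 1
  calc ∫ x in A, survivalWeight F J u (N + 1 - p) (F^[p] x) ∂ν
      ≤ ∫ x in A, (survivalWeight F J u N (F x) +
          ∑ j ∈ Finset.Ico 1 p, J.indicator 1 (F^[j] x)) ∂ν :=
        integral_mono (integrable_survivalWeight_comp hF hJ hu _ p)
          (integrable_comp.add (integrable_finsetSum _ integrable_visit))
          fun x => survivalWeight_comp_iterate_le_add hu N hp x
    _ = ∫ x in A, survivalWeight F J u N (F x) ∂ν +
          ∑ j ∈ Finset.Ico 1 p, ν.real (A ∩ F^[j] ⁻¹' J) := by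
        rw [integral_add integrable_comp (integrable_finsetSum _ integrable_visit),
          integral_finsetSum _ integrable_visit]
        simp_rw [setIntegral_indicator_one_comp (hF.iterate _) hJ]

/-- Up to the probability of an early return, the weight that ignores the times before `p` equals
the original one, and it decorrelates from the starting set. -/
lemma abs_setIntegral_survivalWeight_comp_sub_le [IsProbabilityMeasure ν]
    (hF : MeasurePreserving F ν ν) (hJ : MeasurableSet J) (hu : u ∈ Icc (0 : ℝ) 1) {p : ℕ}
    (hp : 1 ≤ p) {δ : ℝ} (hδ : 0 ≤ δ)
    (hdecay : ∀ φ : α → ℝ, Integrable φ ν →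
      |∫ x in J, φ (F^[p] x) ∂ν - ν.real J * ∫ x, φ x ∂ν| ≤ δ * ∫ x, |φ x| ∂ν) (N : ℕ) :
    |∫ x in J, survivalWeight F J u N (F x) ∂ν - ν.real J * ∫ x, survivalWeight F J u N x ∂ν| ≤
      ∑ j ∈ Finset.Ico 1 p, ν.real (J ∩ F^[j] ⁻¹' J) + p * ν.real J ^ 2 + δ := by
  set w := fun M => ∫ x, survivalWeight F J u M x ∂ν
  have integral_comp (M j : ℕ) : ∫ x in univ, survivalWeight F J u M (F^[j] x) ∂ν = w M := by
    rw [setIntegral_univ]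
    exact integral_comp_of_measurePreserving (hF.iterate j)
      (integrable_survivalWeight hF.measurable hJ hu M).aestronglyMeasurable
  have visits_le : ∑ j ∈ Finset.Ico 1 p, ν.real (univ ∩ F^[j] ⁻¹' J) ≤ p * ν.real J := by
    simp_rw [univ_inter, (hF.iterate _).measureReal_preimage hJ.nullMeasurableSet]
    rw [Finset.sum_const, nsmul_eq_mul, Nat.card_Ico]
    gcongr
    omega
  have shift_le : w N ≤ w (N + 1 - p) := by
    have := setIntegral_survivalWeight_comp_le (ν := ν) hF.measurable hJ hu N hp univ
    rw [integral_comp] at this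
    exact (integral_comp N 1).symm.trans_le this
  have le_shift : w (N + 1 - p) ≤ w N + p * ν.real J := by
    have := setIntegral_survivalWeight_comp_iterate_le_add (ν := ν) hF.measurable hJ hu N hp univ
    rw [integral_comp] at this
    exact this.trans (add_le_add (integral_comp N 1).le visits_le)
  have decorrelation :
      |∫ x in J, survivalWeight F J u (N + 1 - p) (F^[p] x) ∂ν - ν.real J * w (N + 1 - p)| ≤ δ :=
    (hdecay _ (integrable_survivalWeight hF.measurable hJ hu _)).trans
      (mul_le_of_le_one_right hδ (integral_abs_survivalWeight_le hF.measurable hJ hu _))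
  have comp_le := setIntegral_survivalWeight_comp_le (ν := ν) hF.measurable hJ hu N hp J
  have le_comp := setIntegral_survivalWeight_comp_iterate_le_add (ν := ν) hF.measurable hJ hu N hp J
  have early_nonneg : 0 ≤ ∑ j ∈ Finset.Ico 1 p, ν.real (J ∩ F^[j] ⁻¹' J) :=
    Finset.sum_nonneg fun _ _ => measureReal_nonneg
  have hJ_nonneg : 0 ≤ ν.real J := measureReal_nonneg
  rw [abs_le] at decorrelation ⊢
  constructor <;> nlinarith

lemma abs_integral_survivalWeight_sub_pow_le [IsProbabilityMeasure ν]
    (hF : MeasurePreserving F ν ν) (hJ : MeasurableSet J) (hu : u ∈ Icc (0 : ℝ) 1) {p : ℕ}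
    (hp : 1 ≤ p) {δ : ℝ} (hδ : 0 ≤ δ)
    (hdecay : ∀ φ : α → ℝ, Integrable φ ν →
      |∫ x in J, φ (F^[p] x) ∂ν - ν.real J * ∫ x, φ x ∂ν| ≤ δ * ∫ x, |φ x| ∂ν) (N : ℕ) :
    |∫ x, survivalWeight F J u N x ∂ν - (1 - u * ν.real J) ^ N| ≤
      N * (∑ j ∈ Finset.Ico 1 p, ν.real (J ∩ F^[j] ⁻¹' J) + p * ν.real J ^ 2 + δ) := by
  have hJ_nonneg : 0 ≤ ν.real J := measureReal_nonneg
  have hJ_le_one : ν.real J ≤ 1 := measureReal_le_one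
  refine abs_sub_pow_le_of_abs_succ_sub_mul_le (a := fun N => ∫ x, survivalWeight F J u N x ∂ν)
    (by simp [survivalWeight_zero]) ?_ (fun M => ?_) N
  · rw [abs_le]
    constructor <;> nlinarith [hu.1, hu.2, mul_nonneg hu.1 hJ_nonneg]
  · have memory_loss := abs_setIntegral_survivalWeight_comp_sub_le hF hJ hu hp hδ hdecay M
    rw [integral_survivalWeight_succ hF hJ hu]
    set w := ∫ x, survivalWeight F J u M x ∂ν
    set wJ := ∫ x in J, survivalWeight F J u M (F x) ∂ν
    calc |w - u * wJ - (1 - u * ν.real J) * w| = u * |wJ - ν.real J * w| := by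
          rw [show w - u * wJ - (1 - u * ν.real J) * w = -(u * (wJ - ν.real J * w)) by ring,
            abs_neg, abs_mul, abs_of_nonneg hu.1]
      _ ≤ |wJ - ν.real J * w| := mul_le_of_le_one_left (abs_nonneg _) hu.2
      _ ≤ _ := memory_loss

end survivalWeight

lemma exists_pos_forall_le_of_boundedVariationOn {α : Type*} [LinearOrder α] {φ : α → ℝ}
    {Y : Set α} (hφ : BoundedVariationOn φ Y) : ∃ S : ℝ, 0 < S ∧ ∀ x ∈ Y, φ x ≤ S := by
  rcases Y.eq_empty_or_nonempty with rfl | ⟨x₀, hx₀⟩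
  · exact ⟨1, one_pos, by simp⟩
  · refine ⟨|φ x₀| + (eVariationOn φ Y).toReal + 1, by positivity, fun x hx => ?_⟩
    linarith [hφ.sub_le hx hx₀, le_abs_self (φ x₀)]

lemma IsDensity.measure_le_mul_volume {Y : Set ℝ} {ν : Measure ℝ} {ρ : ℝ → ℝ}
    (hρ : IsDensity Y ν ρ) {S : ℝ} (hS : ∀ x ∈ Y, ρ x ≤ S) {A : Set ℝ} (hA : MeasurableSet A) :
    ν A ≤ ENNReal.ofReal S * volume A := by
  rw [hρ.eq_withDensity, withDensity_apply _ hA, Measure.restrict_restrict hA]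
  calc ∫⁻ x in A ∩ Y, ENNReal.ofReal (ρ x)
      ≤ ∫⁻ _ in A ∩ Y, ENNReal.ofReal S :=
        setLIntegral_mono measurable_const fun x hx => ENNReal.ofReal_le_ofReal (hS x hx.2)
    _ ≤ ENNReal.ofReal S * volume A := by
        rw [setLIntegral_const]
        gcongr
        exact inter_subset_left

lemma IsErgodicAcip.measureReal_returnSet {Y : Set ℝ} {F : ℝ → ℝ} {ν : Measure ℝ}
    (h : IsErgodicAcip Y F ν) (j : ℕ) (r : ℝ) :
    ν.real (returnSet Y F j r) = ν.real {x | dist x (F^[j] x) ≤ r} := by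
  have ae_mem : ∀ᵐ x ∂ν, x ∈ Y := h.measure_compl
  refine measureReal_congr ?_
  filter_upwards [ae_mem] with x hx
  exact propext ⟨fun hr => hr.2, fun hr => ⟨hx, hr⟩⟩

/-- The quantitative consequences of hyperbolic recurrence on which all estimates rest: decay of
correlations with constant `C` and rate `κ`, density at most `S`, and short returns at scale
`n ^ (-1 / 2)` of measure at most `C * n ^ (-β)`. Sharing one constant `C` is harmless. -/
structure RecurrenceEstimates (F : ℝ → ℝ) (ν : Measure ℝ) (C κ S β : ℝ) : Prop where
  measurePreserving : MeasurePreserving F ν ν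
  C_pos : 0 < C
  κ_pos : 0 < κ
  S_pos : 0 < S
  β_pos : 0 < β
  decay : CellDecay F ν C κ
  measureReal_cell_le : ∀ ℓ : ℝ, 0 < ℓ → ∀ (q : ℕ) (i : ℤ),
    ν.real (cell ℓ q i) ≤ S * ((2 * q + 1) * ℓ)
  short_returns : ∀ᶠ n : ℕ in atTop, ∀ j : ℕ, 1 ≤ j → (j : ℝ) ≤ Real.log n ^ 2 →
    ν.real {x | dist x (F^[j] x) ≤ (n : ℝ) ^ (-(1 / 2) : ℝ)} ≤ C * (n : ℝ) ^ (-β)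

lemma HyperbolicRecurrent.exists_recurrenceEstimates {Y : Set ℝ} {F : ℝ → ℝ} {ν : Measure ℝ}
    (h : HyperbolicRecurrent Y F ν) : ∃ C κ S β : ℝ, RecurrenceEstimates F ν C κ S β := by
  obtain ⟨C₁, κ, hC₁, hκ, hdecay⟩ := h.expDecay.exists_cellDecay
  obtain ⟨ρ, hρ, hbv⟩ := h.density_bv
  obtain ⟨S, hS, hρS⟩ := exists_pos_forall_le_of_boundedVariationOn hbv
  obtain ⟨β₀, hβ₀, C₂, _, hshort⟩ := h.shortReturns (1 / 2) (fun n => (n : ℝ) ^ (-(1 / 2) : ℝ))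
    (by norm_num) ⟨2, by norm_num, by
      filter_upwards [eventually_gt_atTop 0] with n hn
      rw [div_self (by positivity)]
      constructor <;> norm_num⟩
  refine ⟨max C₁ C₂, κ, S, β₀ / 2,
    { measurePreserving := h.isErgodicAcip.ergodic.toMeasurePreserving
      C_pos := lt_max_of_lt_left hC₁
      κ_pos := hκ
      S_pos := hS
      β_pos := half_pos hβ₀.1
      decay := fun ℓ q i φ hφ j => ?_
      measureReal_cell_le := fun ℓ hℓ q i => ?_
      short_returns := ?_ }⟩
  · refine (hdecay ℓ q i φ hφ j).trans ?_
    have : 0 ≤ ∫ x, |φ x| ∂ν := integral_nonneg fun x => abs_nonneg _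
    gcongr
    exact le_max_left _ _
  · have measure_le := hρ.measure_le_mul_volume hρS (measurableSet_cell ℓ q i)
    rw [volume_cell, ← ENNReal.ofReal_mul hS.le] at measure_le
    exact ENNReal.toReal_le_of_le_ofReal (by positivity) measure_le
  · filter_upwards [hshort] with n hn j hj_pos hj_le
    rw [← h.isErgodicAcip.measureReal_returnSet]
    refine (hn j hj_pos hj_le).trans ?_
    rw [← Real.rpow_mul (Nat.cast_nonneg n), show -(1 / 2) * β₀ = -(β₀ / 2) by ring]
    gcongr
    exact le_max_right _ _

section RecurrenceEstimates

variable {F : ℝ → ℝ} {ν : Measure ℝ} {C κ S β : ℝ}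

lemma sum_measureReal_cell_inter_preimage_le [IsFiniteMeasure ν] {G : ℝ → ℝ} (hG : Measurable G)
    {ℓ : ℝ} (hℓ : 0 < ℓ) (q : ℕ) (s : Finset ℤ) :
    ∑ i ∈ s, ν.real (cell ℓ q i ∩ G ⁻¹' cell ℓ q i) ≤
      (2 * q + 1) * ν.real {x | dist x (G x) ≤ (2 * q + 1) * ℓ} :=
  sum_measureReal_le_of_subset_cell hℓ s
    (fun i => (measurableSet_cell ℓ q i).inter (hG (measurableSet_cell ℓ q i)))
    (measurableSet_le (measurable_id.dist hG) measurable_const)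
    (fun _ _ hx => dist_le_of_mem_cell_of_mem_cell hx.1 hx.2) fun _ => inter_subset_left

lemma RecurrenceEstimates.abs_setIntegral_survivalWeight_sub_le [IsProbabilityMeasure ν]
    (h : RecurrenceEstimates F ν C κ S β) {u : ℝ} (hu : u ∈ Icc (0 : ℝ) 1) (q : ℕ) {ℓ : ℝ}
    (hℓ : 0 < ℓ) {p : ℕ} (hp : 1 ≤ p) (N : ℕ) (i : ℤ) :
    |∫ x in cell ℓ 0 i, survivalWeight F (cell ℓ q i) u N (F^[p] x) ∂ν -
        ν.real (cell ℓ 0 i) * (1 - u * ν.real (cell ℓ q i)) ^ N| ≤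
      C * Real.exp (-κ * p) +
        (N * (S * ℓ) * ∑ j ∈ Finset.Ico 1 p, ν.real (cell ℓ q i ∩ F^[j] ⁻¹' cell ℓ q i) +
          ν.real (cell ℓ 0 i) *
            (N * (p * (S * ((2 * q + 1) * ℓ)) ^ 2 + C * Real.exp (-κ * p)))) := by
  have hC := h.C_pos
  have hF := h.measurePreserving.measurable
  have hcell := measurableSet_cell ℓ q i
  set ε := C * Real.exp (-κ * p)
  set early := ∑ j ∈ Finset.Ico 1 p, ν.real (cell ℓ q i ∩ F^[j] ⁻¹' cell ℓ q i)
  set w := ∫ x, survivalWeight F (cell ℓ q i) u N x ∂ν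
  set z := (1 - u * ν.real (cell ℓ q i)) ^ N
  have hε : 0 ≤ ε := by positivity
  have : 0 ≤ early := Finset.sum_nonneg fun _ _ => measureReal_nonneg
  have decorrelation : |∫ x in cell ℓ 0 i, survivalWeight F (cell ℓ q i) u N (F^[p] x) ∂ν -
      ν.real (cell ℓ 0 i) * w| ≤ ε :=
    (h.decay ℓ 0 i _ (integrable_survivalWeight hF hcell hu N) p).trans
      (mul_le_of_le_one_right hε (integral_abs_survivalWeight_le hF hcell hu N))
  have product_form : |w - z| ≤ N * (early + p * (S * ((2 * q + 1) * ℓ)) ^ 2 + ε) := by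
    refine (abs_integral_survivalWeight_sub_pow_le h.measurePreserving hcell hu hp hε
      (fun φ hφ => h.decay ℓ q i φ hφ p) N).trans ?_
    gcongr
    exact h.measureReal_cell_le ℓ hℓ q i
  have cell_le : ν.real (cell ℓ 0 i) ≤ S * ℓ := by
    simpa using h.measureReal_cell_le ℓ hℓ 0 i
  have cell_nonneg : 0 ≤ ν.real (cell ℓ 0 i) := measureReal_nonneg
  calc |∫ x in cell ℓ 0 i, survivalWeight F (cell ℓ q i) u N (F^[p] x) ∂ν - ν.real (cell ℓ 0 i) * z|
      ≤ |∫ x in cell ℓ 0 i, survivalWeight F (cell ℓ q i) u N (F^[p] x) ∂ν -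
          ν.real (cell ℓ 0 i) * w| + |ν.real (cell ℓ 0 i) * (w - z)| := by
        rw [mul_sub]; exact abs_sub_le _ _ _
    _ ≤ ε + ν.real (cell ℓ 0 i) * (N * (early + p * (S * ((2 * q + 1) * ℓ)) ^ 2 + ε)) := by
        rw [abs_mul, abs_of_nonneg cell_nonneg]
        gcongr
    _ = ε + (ν.real (cell ℓ 0 i) * (N * early) +
          ν.real (cell ℓ 0 i) * (N * (p * (S * ((2 * q + 1) * ℓ)) ^ 2 + ε))) := by ring
    _ ≤ ε + (S * ℓ * (N * early) +
          ν.real (cell ℓ 0 i) * (N * (p * (S * ((2 * q + 1) * ℓ)) ^ 2 + ε))) := by gcongr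
    _ = _ := by ring

lemma RecurrenceEstimates.sum_abs_setIntegral_survivalWeight_sub_le [IsProbabilityMeasure ν]
    (h : RecurrenceEstimates F ν C κ S β) {u : ℝ} (hu : u ∈ Icc (0 : ℝ) 1) (q : ℕ) {ℓ : ℝ}
    (hℓ : 0 < ℓ) {p : ℕ} (hp : 1 ≤ p) (N : ℕ) (s : Finset ℤ) :
    ∑ i ∈ s, |∫ x in cell ℓ 0 i, survivalWeight F (cell ℓ q i) u N (F^[p] x) ∂ν -
        ν.real (cell ℓ 0 i) * (1 - u * ν.real (cell ℓ q i)) ^ N| ≤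
      s.card * (C * Real.exp (-κ * p)) +
        N * (S * ℓ * ((2 * q + 1) * ∑ j ∈ Finset.Ico 1 p,
          ν.real {x | dist x (F^[j] x) ≤ (2 * q + 1) * ℓ}) +
          p * (S * ((2 * q + 1) * ℓ)) ^ 2 + C * Real.exp (-κ * p)) := by
  have hC := h.C_pos
  have hS := h.S_pos
  have early_le : ∑ i ∈ s, ∑ j ∈ Finset.Ico 1 p, ν.real (cell ℓ q i ∩ F^[j] ⁻¹' cell ℓ q i) ≤
      (2 * q + 1) * ∑ j ∈ Finset.Ico 1 p, ν.real {x | dist x (F^[j] x) ≤ (2 * q + 1) * ℓ} := by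
    rw [Finset.sum_comm, Finset.mul_sum]
    exact Finset.sum_le_sum fun j _ => sum_measureReal_cell_inter_preimage_le
      (h.measurePreserving.measurable.iterate j) hℓ q s
  have cells_le_one := sum_measureReal_cell_zero_le (ν := ν) hℓ s
  refine (Finset.sum_le_sum fun i _ =>
    h.abs_setIntegral_survivalWeight_sub_le hu q hℓ hp N i).trans ?_
  rw [Finset.sum_add_distrib, Finset.sum_add_distrib, Finset.sum_const, nsmul_eq_mul,
    ← Finset.mul_sum, ← Finset.sum_mul]
  calc _ ≤ s.card * (C * Real.exp (-κ * p)) + (N * (S * ℓ) * ((2 * q + 1) *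
          ∑ j ∈ Finset.Ico 1 p, ν.real {x | dist x (F^[j] x) ≤ (2 * q + 1) * ℓ}) +
          1 * (N * (p * (S * ((2 * q + 1) * ℓ)) ^ 2 + C * Real.exp (-κ * p)))) := by gcongr
    _ = _ := by ring

end RecurrenceEstimates

open Asymptotics

/-- A sequence is polynomially small if it is `O(n ^ (-b))` for some `b > 0`. This class absorbs
powers of `log n`, and its members are summable along geometric subsequences. -/
def PolynomiallySmall (a : ℕ → ℝ) : Prop :=
  ∃ b : ℝ, 0 < b ∧ a =O[atTop] fun n : ℕ => (n : ℝ) ^ (-b)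

lemma rpow_neg_isBigO_rpow_neg {b c : ℝ} (hbc : b ≤ c) :
    (fun n : ℕ => (n : ℝ) ^ (-c)) =O[atTop] fun n : ℕ => (n : ℝ) ^ (-b) := by
  refine IsBigO.of_bound' ?_
  filter_upwards [eventually_ge_atTop 1] with n hn
  rw [Real.norm_of_nonneg (by positivity), Real.norm_of_nonneg (by positivity)]
  exact Real.rpow_le_rpow_of_exponent_le (by exact_mod_cast hn) (neg_le_neg hbc)

lemma PolynomiallySmall.of_isBigO {a a' : ℕ → ℝ} (ha : PolynomiallySmall a)
    (h : a' =O[atTop] a) : PolynomiallySmall a' := by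
  obtain ⟨b, hb, hab⟩ := ha
  exact ⟨b, hb, h.trans hab⟩

lemma PolynomiallySmall.of_le {a a' : ℕ → ℝ} (ha : PolynomiallySmall a) (h_nonneg : ∀ n, 0 ≤ a' n)
    (h_le : ∀ᶠ n in atTop, a' n ≤ a n) : PolynomiallySmall a' := by
  refine ha.of_isBigO (IsBigO.of_bound' (h_le.mono fun n hn => ?_))
  rw [Real.norm_of_nonneg (h_nonneg n)]
  exact hn.trans (le_abs_self _)

lemma PolynomiallySmall.add {a a' : ℕ → ℝ} (ha : PolynomiallySmall a)
    (ha' : PolynomiallySmall a') : PolynomiallySmall fun n => a n + a' n := by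
  obtain ⟨b, hb, hab⟩ := ha
  obtain ⟨b', hb', hab'⟩ := ha'
  exact ⟨min b b', lt_min hb hb', (hab.trans (rpow_neg_isBigO_rpow_neg (min_le_left b b'))).add
    (hab'.trans (rpow_neg_isBigO_rpow_neg (min_le_right b b')))⟩

lemma PolynomiallySmall.tendsto_zero {a : ℕ → ℝ} (ha : PolynomiallySmall a) :
    Tendsto a atTop (𝓝 0) := by
  obtain ⟨b, hb, hab⟩ := ha
  exact hab.trans_tendsto ((tendsto_rpow_neg_atTop hb).comp tendsto_natCast_atTop_atTop)

lemma log_rpow_isLittleO_rpow (D : ℝ) {b : ℝ} (hb : 0 < b) :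
    (fun n : ℕ => Real.log n ^ D) =o[atTop] fun n : ℕ => (n : ℝ) ^ b :=
  (isLittleO_log_rpow_rpow_atTop D hb).comp_tendsto tendsto_natCast_atTop_atTop

lemma polynomiallySmall_log_rpow_mul (D : ℝ) {b : ℝ} (hb : 0 < b) :
    PolynomiallySmall fun n : ℕ => Real.log n ^ D * (n : ℝ) ^ (-b) := by
  refine ⟨b / 2, half_pos hb, ((log_rpow_isLittleO_rpow D (half_pos hb)).isBigO.mul
    (isBigO_refl _ _)).trans_eventuallyEq ?_⟩
  filter_upwards [eventually_gt_atTop 0] with n hn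
  rw [← Real.rpow_add (by exact_mod_cast hn)]
  ring_nf

lemma tendsto_log_natCast : Tendsto (fun n : ℕ => Real.log n) atTop atTop :=
  Real.tendsto_log_atTop.comp tendsto_natCast_atTop_atTop

lemma PolynomiallySmall.of_isBigO_log_rpow_mul {a : ℕ → ℝ} {D b : ℝ} (hb : 0 < b)
    (h : a =O[atTop] fun n : ℕ => Real.log n ^ D * (n : ℝ) ^ (-b)) : PolynomiallySmall a :=
  (polynomiallySmall_log_rpow_mul D hb).of_isBigO h

/-- Mixing is exploited across a time gap of length `⌊(log n)²⌋`: long enough to make `exp (-κ p)`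
smaller than any power of `n`, and short enough for the short return estimates to apply. -/
def gap (n : ℕ) : ℕ := ⌊Real.log n ^ 2⌋₊

lemma eventually_one_le_gap : ∀ᶠ n : ℕ in atTop, 1 ≤ gap n := by
  filter_upwards [tendsto_log_natCast.eventually_ge_atTop 1] with n hn
  exact Nat.one_le_floor_iff _ |>.2 (one_le_pow₀ hn)

lemma gap_le (n : ℕ) : (gap n : ℝ) ≤ Real.log n ^ 2 := Nat.floor_le (sq_nonneg _)

lemma gap_isBigO : (fun n : ℕ => (gap n : ℝ)) =O[atTop] fun n : ℕ => Real.log n ^ (2 : ℝ) :=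
  IsBigO.of_bound' (Eventually.of_forall fun n => by
    rw [Real.norm_of_nonneg (Nat.cast_nonneg _), Real.rpow_two, Real.norm_of_nonneg (sq_nonneg _)]
    exact gap_le n)

lemma exp_neg_mul_gap_isBigO {κ : ℝ} (hκ : 0 < κ) (c : ℝ) :
    (fun n : ℕ => Real.exp (-κ * gap n)) =O[atTop] fun n : ℕ => (n : ℝ) ^ (-c) := by
  refine IsBigO.of_bound (Real.exp κ) ?_
  filter_upwards [tendsto_log_natCast.eventually_ge_atTop (c / κ),
    tendsto_log_natCast.eventually_ge_atTop 0, eventually_gt_atTop 0] with n hlog _ hn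
  have gap_gt : Real.log n ^ 2 < gap n + 1 := Nat.lt_floor_add_one _
  have exponent_le : c * Real.log n ≤ κ * Real.log n ^ 2 := by
    calc c * Real.log n ≤ Real.log n * κ * Real.log n := by
          gcongr
          exact (div_le_iff₀ hκ).1 hlog
      _ = _ := by ring
  rw [Real.norm_of_nonneg (Real.exp_pos _).le, Real.norm_of_nonneg (by positivity),
    Real.rpow_def_of_pos (by exact_mod_cast hn), ← Real.exp_add, Real.exp_le_exp]
  nlinarith [mul_lt_mul_of_pos_left gap_gt hκ]

/-- The meshes used for the grids: `ℓ n` is, up to powers of `log n`, at most `1 / n`, and it is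
not smaller than `n ^ (-3)`. -/
def AdmissibleMesh (ℓ : ℕ → ℝ) : Prop :=
  ∃ D : ℝ, ∀ᶠ n : ℕ in atTop, ((n : ℝ) ^ 3)⁻¹ ≤ ℓ n ∧ n * ℓ n ≤ Real.log n ^ D

lemma AdmissibleMesh.eventually_pos {ℓ : ℕ → ℝ} (hℓ : AdmissibleMesh ℓ) :
    ∀ᶠ n : ℕ in atTop, 0 < ℓ n := by
  obtain ⟨D, hD⟩ := hℓ
  filter_upwards [hD, eventually_gt_atTop 0] with n hn hn_pos
  exact lt_of_lt_of_le (by positivity) hn.1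

lemma AdmissibleMesh.exists_isBigO {ℓ : ℕ → ℝ} (hℓ : AdmissibleMesh ℓ) :
    ∃ D : ℝ, ℓ =O[atTop] fun n : ℕ => Real.log n ^ D * (n : ℝ) ^ (-1 : ℝ) := by
  have hpos := hℓ.eventually_pos
  obtain ⟨D, hD⟩ := hℓ
  refine ⟨D, IsBigO.of_bound' ?_⟩
  filter_upwards [hD, hpos, eventually_gt_atTop 0] with n hn hn_pos hn₀
  have hn' : (0 : ℝ) < n := by exact_mod_cast hn₀
  rw [Real.norm_of_nonneg hn_pos.le, Real.rpow_neg_one, ← div_eq_mul_inv]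
  exact ((le_div_iff₀' hn').2 hn.2).trans (le_abs_self _)

lemma AdmissibleMesh.eventually_mul_le {ℓ : ℕ → ℝ} (hℓ : AdmissibleMesh ℓ) {c : ℝ}
    (hc : 0 < c) : ∀ᶠ n : ℕ in atTop, c * ℓ n ≤ (n : ℝ) ^ (-(1 / 2) : ℝ) := by
  obtain ⟨D, hD⟩ := hℓ.exists_isBigO
  have hlittle : ℓ =o[atTop] fun n : ℕ => (n : ℝ) ^ (-(1 / 2) : ℝ) := by
    refine (hD.trans_isLittleO (((log_rpow_isLittleO_rpow D one_half_pos).mul_isBigO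
      (isBigO_refl _ _)).trans_eventuallyEq ?_))
    filter_upwards [eventually_gt_atTop 0] with n hn
    rw [← Real.rpow_add (by exact_mod_cast hn)]
    norm_num
  filter_upwards [hlittle.bound (inv_pos.2 hc), hℓ.eventually_pos] with n hn hn_pos
  rwa [Real.norm_of_nonneg hn_pos.le, Real.norm_of_nonneg (by positivity),
    le_inv_mul_iff₀ hc] at hn

lemma AdmissibleMesh.tendsto_zero {ℓ : ℕ → ℝ} (hℓ : AdmissibleMesh ℓ) :
    Tendsto ℓ atTop (𝓝[>] 0) := by
  obtain ⟨D, hD⟩ := hℓ.exists_isBigO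
  exact tendsto_nhdsWithin_iff.2
    ⟨(PolynomiallySmall.of_isBigO_log_rpow_mul one_pos hD).tendsto_zero, hℓ.eventually_pos⟩

/-- The indices of the cells of mesh `ℓ` that meet `[-n, n]`. -/
def gridRange (ℓ : ℝ) (n : ℕ) : Finset ℤ := Finset.Icc (-⌈n / ℓ⌉) ⌈n / ℓ⌉

lemma card_gridRange_le {ℓ : ℝ} {n : ℕ} (hn : 0 < n) (hℓ : ((n : ℝ) ^ 3)⁻¹ ≤ ℓ) :
    ((gridRange ℓ n).card : ℝ) ≤ 5 * (n : ℝ) ^ 4 := by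
  have hℓ_pos : 0 < ℓ := lt_of_lt_of_le (by positivity) hℓ
  have hceil : 0 ≤ ⌈n / ℓ⌉ := Int.ceil_nonneg (by positivity)
  have card_eq : ((gridRange ℓ n).card : ℤ) = 2 * ⌈n / ℓ⌉ + 1 := by
    rw [gridRange, Int.card_Icc]; omega
  have div_le : (n : ℝ) / ℓ ≤ (n : ℝ) ^ 4 := by
    rw [div_le_iff₀ hℓ_pos]
    calc (n : ℝ) = (n : ℝ) ^ 4 * ((n : ℝ) ^ 3)⁻¹ := by field_simp
      _ ≤ _ := by gcongr
  have one_le : (1 : ℝ) ≤ (n : ℝ) ^ 4 := one_le_pow₀ (by exact_mod_cast hn)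
  calc ((gridRange ℓ n).card : ℝ) = 2 * ⌈n / ℓ⌉ + 1 := by exact_mod_cast card_eq
    _ ≤ 5 * (n : ℝ) ^ 4 := by linarith [(Int.ceil_lt_add_one ((n : ℝ) / ℓ)).le]

lemma AdmissibleMesh.card_gridRange_isBigO {ℓ : ℕ → ℝ} (hℓ : AdmissibleMesh ℓ) :
    (fun n => ((gridRange (ℓ n) n).card : ℝ)) =O[atTop] fun n : ℕ => (n : ℝ) ^ (4 : ℝ) := by
  obtain ⟨D, hD⟩ := hℓ
  refine IsBigO.of_bound 5 ?_
  filter_upwards [hD, eventually_gt_atTop 0] with n hn hn_pos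
  rw [Real.norm_of_nonneg (Nat.cast_nonneg _), Real.norm_of_nonneg (by positivity)]
  exact_mod_cast card_gridRange_le hn_pos hn.1

section RecurrenceEstimates

variable {F : ℝ → ℝ} {ν : Measure ℝ} {C κ S β : ℝ} {ℓ : ℕ → ℝ}

lemma RecurrenceEstimates.sum_shortReturns_isBigO [IsProbabilityMeasure ν]
    (h : RecurrenceEstimates F ν C κ S β) (hℓ : AdmissibleMesh ℓ) {c : ℝ} (hc : 0 < c) :
    (fun n => ∑ j ∈ Finset.Ico 1 (gap n), ν.real {x | dist x (F^[j] x) ≤ c * ℓ n}) =O[atTop]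
      fun n : ℕ => Real.log n ^ (2 : ℝ) * (n : ℝ) ^ (-β) := by
  have hC := h.C_pos
  refine IsBigO.of_bound C ?_
  filter_upwards [h.short_returns, hℓ.eventually_mul_le hc] with n hshort hmesh
  rw [Real.norm_of_nonneg (Finset.sum_nonneg fun _ _ => measureReal_nonneg),
    Real.norm_of_nonneg (mul_nonneg (by rw [Real.rpow_two]; positivity) (by positivity)),
    Real.rpow_two]
  calc ∑ j ∈ Finset.Ico 1 (gap n), ν.real {x | dist x (F^[j] x) ≤ c * ℓ n}
      ≤ ∑ _j ∈ Finset.Ico 1 (gap n), C * (n : ℝ) ^ (-β) := by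
        refine Finset.sum_le_sum fun j hj => ?_
        obtain ⟨hj_pos, hj_lt⟩ := Finset.mem_Ico.1 hj
        have hj_le : (j : ℝ) ≤ Real.log n ^ 2 :=
          le_trans (by exact_mod_cast hj_lt.le) (gap_le n)
        exact (measureReal_mono fun x hx => le_trans hx hmesh).trans (hshort j hj_pos hj_le)
    _ ≤ Real.log n ^ 2 * (C * (n : ℝ) ^ (-β)) := by
        rw [Finset.sum_const, nsmul_eq_mul, Nat.card_Ico]
        gcongr
        exact le_trans (by exact_mod_cast Nat.sub_le _ _) (gap_le n)
    _ = C * (Real.log n ^ 2 * (n : ℝ) ^ (-β)) := by ring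

lemma polynomiallySmall_mul_exp_gap (hκ : 0 < κ) {a : ℕ → ℝ} {c : ℝ}
    (ha : a =O[atTop] fun n : ℕ => (n : ℝ) ^ c) :
    PolynomiallySmall fun n => a n * (C * Real.exp (-κ * gap n)) := by
  refine ⟨1, one_pos, (ha.mul ((exp_neg_mul_gap_isBigO hκ (c + 1)).const_mul_left
    C)).trans_eventuallyEq ?_⟩
  filter_upwards [eventually_gt_atTop 0] with n hn
  rw [← Real.rpow_add (by exact_mod_cast hn)]
  ring_nf

lemma RecurrenceEstimates.polynomiallySmall_shortReturns_term [IsProbabilityMeasure ν]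
    (h : RecurrenceEstimates F ν C κ S β) (hℓ : AdmissibleMesh ℓ) {c : ℝ} (hc : 0 < c)
    {N : ℕ → ℕ} (hN : (fun n => (N n : ℝ)) =O[atTop] fun n : ℕ => (n : ℝ)) :
    PolynomiallySmall fun n => N n * (S * ℓ n * (c * ∑ j ∈ Finset.Ico 1 (gap n),
      ν.real {x | dist x (F^[j] x) ≤ c * ℓ n})) := by
  obtain ⟨D, hD⟩ := hℓ.exists_isBigO
  refine PolynomiallySmall.of_isBigO_log_rpow_mul (D := D + 2) h.β_pos
    ((hN.mul ((hD.const_mul_left S).mul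
      ((h.sum_shortReturns_isBigO hℓ hc).const_mul_left c))).trans_eventuallyEq ?_)
  filter_upwards [eventually_gt_atTop 0, tendsto_log_natCast.eventually_gt_atTop 0] with n hn hlog
  rw [Real.rpow_add hlog, Real.rpow_neg_one]
  field_simp

lemma polynomiallySmall_gap_mul_sq (hℓ : AdmissibleMesh ℓ) (c : ℝ) {N : ℕ → ℕ}
    (hN : (fun n => (N n : ℝ)) =O[atTop] fun n : ℕ => (n : ℝ)) :
    PolynomiallySmall fun n => N n * (gap n * (c * ℓ n) ^ 2) := by
  obtain ⟨D, hD⟩ := hℓ.exists_isBigO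
  refine PolynomiallySmall.of_isBigO_log_rpow_mul (D := 2 + (D + D)) one_pos
    ((hN.mul (gap_isBigO.mul ((hD.const_mul_left c).pow 2))).trans_eventuallyEq ?_)
  filter_upwards [eventually_gt_atTop 0, tendsto_log_natCast.eventually_gt_atTop 0] with n hn hlog
  rw [Real.rpow_add hlog, Real.rpow_add hlog, Real.rpow_neg_one]
  field_simp

lemma RecurrenceEstimates.polynomiallySmall_sum_abs_setIntegral_survivalWeight_sub
    [IsProbabilityMeasure ν] (h : RecurrenceEstimates F ν C κ S β) {u : ℝ}
    (hu : u ∈ Icc (0 : ℝ) 1) (q : ℕ) (hℓ : AdmissibleMesh ℓ) {N : ℕ → ℕ}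
    (hN : (fun n => (N n : ℝ)) =O[atTop] fun n : ℕ => (n : ℝ)) :
    PolynomiallySmall fun n => ∑ i ∈ gridRange (ℓ n) n,
      |∫ x in cell (ℓ n) 0 i, survivalWeight F (cell (ℓ n) q i) u (N n) (F^[gap n] x) ∂ν -
        ν.real (cell (ℓ n) 0 i) * (1 - u * ν.real (cell (ℓ n) q i)) ^ N n| := by
  have hN_rpow : (fun n => (N n : ℝ)) =O[atTop] fun n : ℕ => (n : ℝ) ^ (1 : ℝ) := by
    simpa only [Real.rpow_one] using hN
  refine (((polynomiallySmall_mul_exp_gap (C := C) h.κ_pos hℓ.card_gridRange_isBigO).add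
    (polynomiallySmall_mul_exp_gap (C := C) h.κ_pos hN_rpow)).add
    ((h.polynomiallySmall_shortReturns_term hℓ (c := 2 * q + 1) (by positivity) hN).add
      (polynomiallySmall_gap_mul_sq hℓ (S * (2 * q + 1)) hN))).of_le
    (fun n => Finset.sum_nonneg fun _ _ => abs_nonneg _) ?_
  filter_upwards [hℓ.eventually_pos, eventually_one_le_gap] with n hpos hgap
  refine (h.sum_abs_setIntegral_survivalWeight_sub_le hu q hpos hgap (N n) _).trans_eq ?_
  ring

end RecurrenceEstimates

section IsDensity

variable {X : Set ℝ} {μ : Measure ℝ} {ρ : ℝ → ℝ}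

lemma IsDensity.ae_nonneg (hX : MeasurableSet X) (h : IsDensity X μ ρ) :
    0 ≤ᵐ[volume.restrict X] ρ :=
  (ae_restrict_iff' hX).2 (Eventually.of_forall h.nonneg)

lemma IsDensity.integrableOn [IsFiniteMeasure μ] (hX : MeasurableSet X) (h : IsDensity X μ ρ) :
    IntegrableOn ρ X := by
  refine ⟨h.aemeasurable.aestronglyMeasurable, ?_⟩
  rw [hasFiniteIntegral_iff_ofReal (h.ae_nonneg hX)]
  simpa only [h.eq_withDensity, withDensity_apply _ MeasurableSet.univ, Measure.restrict_univ]
    using measure_lt_top μ univ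

lemma IsDensity.integral_eq (hX : MeasurableSet X) (h : IsDensity X μ ρ) (g : ℝ → ℝ) :
    ∫ x, g x ∂μ = ∫ x in X, ρ x * g x := by
  conv_lhs => rw [h.eq_withDensity]
  rw [integral_withDensity_eq_integral_toReal_smul₀ h.aemeasurable.ennreal_ofReal
    (Eventually.of_forall fun x => ENNReal.ofReal_lt_top)]
  refine integral_congr_ae ?_
  filter_upwards [h.ae_nonneg hX] with x hx
  rw [ENNReal.toReal_ofReal hx, smul_eq_mul]

lemma IsDensity.measureReal_eq (hX : MeasurableSet X) (h : IsDensity X μ ρ) {E : Set ℝ}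
    (hE : MeasurableSet E) : μ.real E = ∫ x in E ∩ X, ρ x := by
  rw [← integral_indicator_one hE, h.integral_eq hX, inter_comm, ← setIntegral_indicator hE]
  refine integral_congr_ae (Eventually.of_forall fun x => ?_)
  by_cases hx : x ∈ E <;> simp [hx]

lemma closedBall_ae_eq_cell (ℓ : ℝ) (q : ℕ) (i : ℤ) :
    Metric.closedBall ((i + 1 / 2) * ℓ) ((q + 1 / 2) * ℓ) =ᵐ[volume] cell ℓ q i := by
  have closedBall_eq : Metric.closedBall ((i + 1 / 2) * ℓ) ((q + 1 / 2) * ℓ) =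
      Icc ((i - q) * ℓ) ((i + q + 1) * ℓ) := by
    rw [Real.closedBall_eq_Icc]
    congr 1 <;> ring
  rw [closedBall_eq]
  exact Ico_ae_eq_Icc.symm

lemma IsDensity.ae_tendsto_cell [IsFiniteMeasure μ] (hX : MeasurableSet X)
    (h : IsDensity X μ ρ) {B : Set ℝ} (hB : MeasurableSet B) :
    ∀ᵐ x, ∀ (q : ℕ) (ℓ : ℕ → ℝ), Tendsto ℓ atTop (𝓝[>] 0) →
      Tendsto (fun n => μ.real (B ∩ cell (ℓ n) q ⌊x / ℓ n⌋) / ((2 * q + 1) * ℓ n)) atTop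
        (𝓝 ((B ∩ X).indicator ρ x)) := by
  have integrable_density : Integrable ((B ∩ X).indicator ρ) :=
    ((h.integrableOn hX).mono_set inter_subset_right).integrable_indicator (hB.inter hX)
  filter_upwards [IsUnifLocDoublingMeasure.ae_tendsto_average (μ := volume)
    integrable_density.locallyIntegrable 1] with x hx q ℓ hℓ
  obtain ⟨hℓ_zero, hℓ_pos⟩ := tendsto_nhdsWithin_iff.1 hℓ
  simp only [mem_Ioi] at hℓ_pos
  have radius_tendsto : Tendsto (fun n => ((q : ℝ) + 1 / 2) * ℓ n) atTop (𝓝[>] 0) := by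
    refine tendsto_nhdsWithin_iff.2 ⟨?_, hℓ_pos.mono fun n hn => by rw [mem_Ioi]; positivity⟩
    simpa only [mul_zero] using hℓ_zero.const_mul ((q : ℝ) + 1 / 2)
  have mem_closedBall : ∀ᶠ n in atTop,
      x ∈ Metric.closedBall ((⌊x / ℓ n⌋ + 1 / 2) * ℓ n) (1 * ((q + 1 / 2) * ℓ n)) := by
    filter_upwards [hℓ_pos] with n hn
    obtain ⟨lower, upper⟩ := (mem_cell_zero_iff hn (y := x)).2 rfl
    have : 0 ≤ (q : ℝ) * ℓ n := by positivity
    simp only [Nat.cast_zero, sub_zero, add_zero] at lower upper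
    rw [Metric.mem_closedBall, Real.dist_eq, abs_le]
    constructor <;> linarith
  refine (hx _ _ radius_tendsto mem_closedBall).congr' ?_
  filter_upwards [hℓ_pos] with n hn
  rw [setAverage_congr (closedBall_ae_eq_cell _ _ _), setAverage_eq, measureReal_def, volume_cell,
    ENNReal.toReal_ofReal (by positivity), smul_eq_mul, inv_mul_eq_div,
    setIntegral_indicator (hB.inter hX), h.measureReal_eq hX (hB.inter (measurableSet_cell _ _ _)),
    ← inter_assoc, inter_comm _ B]

lemma IsDensity.ae_pos (h : IsDensity X μ ρ) : ∀ᵐ x ∂μ, 0 < ρ x := by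
  rw [h.eq_withDensity, ae_withDensity_iff' h.aemeasurable.ennreal_ofReal]
  exact Eventually.of_forall fun x hx => by simpa using hx

end IsDensity

section visitSum

variable {α : Type*} {f : α → α} {B : Set α}

/-- The number of visits of the orbit of `x` to `B` at times `0 ≤ j < n`. -/
def visitSum (f : α → α) (B : Set α) (n : ℕ) (x : α) : ℝ :=
  ∑ j ∈ Finset.range n, B.indicator 1 (f^[j] x)

lemma indicator_one_mem_Icc (B : Set α) (x : α) : B.indicator (1 : α → ℝ) x ∈ Icc (0 : ℝ) 1 := by
  by_cases hx : x ∈ B <;> simp [hx]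

lemma visitSum_mem_Icc (f : α → α) (B : Set α) (n : ℕ) (x : α) :
    visitSum f B n x ∈ Icc (0 : ℝ) n := by
  refine ⟨Finset.sum_nonneg fun j _ => (indicator_one_mem_Icc B (f^[j] x)).1, ?_⟩
  refine (Finset.sum_le_card_nsmul _ _ 1 fun j _ => (indicator_one_mem_Icc B (f^[j] x)).2).trans ?_
  simp

lemma visitSum_compl (n : ℕ) (x : α) : visitSum f Bᶜ n x = n - visitSum f B n x := by
  have indicator_compl_apply (y : α) : Bᶜ.indicator (1 : α → ℝ) y = 1 - B.indicator 1 y := by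
    by_cases hy : y ∈ B <;> simp [hy]
  simp only [visitSum, indicator_compl_apply, Finset.sum_sub_distrib,
    Finset.sum_const, Finset.card_range, nsmul_eq_mul, mul_one]

lemma abs_visitSum_map_sub_le (n : ℕ) (x : α) :
    |visitSum f B n (f x) - visitSum f B n x| ≤ 1 := by
  have telescope : visitSum f B n (f x) - visitSum f B n x =
      B.indicator 1 (f^[n] x) - B.indicator 1 x :=
    birkhoffSum_apply_sub_birkhoffSum f (B.indicator (1 : α → ℝ)) n x
  rw [telescope, abs_sub_le_iff]
  obtain ⟨h_nonneg, h_le⟩ := indicator_one_mem_Icc B x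
  obtain ⟨h_nonneg', h_le'⟩ := indicator_one_mem_Icc B (f^[n] x)
  constructor <;> linarith

/-- The covering argument of the ergodic theorem: outside `D` the orbit can be cut into blocks of
length at most `M` along which it visits `B` with frequency at least `a`, while each time spent in
`D` is counted in full. -/
lemma mul_sub_le_visitSum {a : ℝ} (ha : a ∈ Icc (0 : ℝ) 1) {D : Set α} {M : ℕ}
    (hD : ∀ x, x ∉ D → ∃ n, 1 ≤ n ∧ n ≤ M ∧ a * n ≤ visitSum f B n x) (L : ℕ) :
    ∀ x, a * ((L : ℝ) - M) ≤ visitSum f (B ∪ D) L x := by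
  induction L using Nat.strong_induction_on with
  | _ L ih =>
    intro x
    rcases le_or_gt L M with hL | hL
    · exact (mul_nonpos_of_nonneg_of_nonpos ha.1 (sub_nonpos.2 (by exact_mod_cast hL))).trans
        (visitSum_mem_Icc f (B ∪ D) L x).1
    · obtain ⟨n, hn_pos, hnL, hn⟩ : ∃ n, 1 ≤ n ∧ n ≤ L ∧ a * n ≤ visitSum f (B ∪ D) n x := by
        by_cases hx : x ∈ D
        · refine ⟨1, le_rfl, by omega, ?_⟩
          simpa [visitSum, hx] using ha.2
        · obtain ⟨n, hn_pos, hnM, hn⟩ := hD x hx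
          exact ⟨n, hn_pos, by omega, hn.trans <| Finset.sum_le_sum fun j _ =>
            indicator_le_indicator_of_subset subset_union_left (fun _ => zero_le_one) _⟩
      obtain ⟨K, rfl⟩ := Nat.exists_eq_add_of_le hnL
      have tail := ih K (by omega) (f^[n] x)
      have split : visitSum f (B ∪ D) (n + K) x =
          visitSum f (B ∪ D) n x + visitSum f (B ∪ D) K (f^[n] x) :=
        birkhoffSum_add f ((B ∪ D).indicator (1 : α → ℝ)) n K x
      rw [split]
      push_cast
      linarith

/-- The points whose upper frequency of visits to `B` is at least `c`. -/
def upperFrequencyGe (f : α → α) (B : Set α) (c : ℝ) : Set α :=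
  {x | ∀ a : ℚ, (a : ℝ) < c → ∃ᶠ n : ℕ in atTop, a * n ≤ visitSum f B n x}

lemma mem_upperFrequencyGe_of_abs_sub_le {c : ℝ} {x y : α}
    (hxy : ∀ n, |visitSum f B n x - visitSum f B n y| ≤ 1) (hx : x ∈ upperFrequencyGe f B c) :
    y ∈ upperFrequencyGe f B c := by
  intro a ha
  obtain ⟨a', haa', ha'⟩ := exists_rat_btwn ha
  refine ((hx a' ha').and_eventually (tendsto_natCast_atTop_atTop.eventually_ge_atTop
    (1 / ((a' : ℝ) - a)))).mono fun n hn => ?_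
  have gain : 1 ≤ n * ((a' : ℝ) - a) := (div_le_iff₀ (sub_pos.2 haa')).1 hn.2
  linarith [hn.1, (abs_le.1 (hxy n)).2]

lemma preimage_upperFrequencyGe (f : α → α) (B : Set α) (c : ℝ) :
    f ⁻¹' upperFrequencyGe f B c = upperFrequencyGe f B c := by
  ext x
  refine ⟨mem_upperFrequencyGe_of_abs_sub_le fun n => abs_visitSum_map_sub_le n x,
    mem_upperFrequencyGe_of_abs_sub_le fun n => ?_⟩
  rw [abs_sub_comm]
  exact abs_visitSum_map_sub_le n x

variable [MeasurableSpace α] {μ : Measure α}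

lemma measurable_visitSum (hf : Measurable f) (hB : MeasurableSet B) (n : ℕ) :
    Measurable (visitSum f B n) :=
  Finset.measurable_fun_sum _ fun j _ => (measurable_one.indicator hB).comp (hf.iterate j)

lemma integrable_visitSum [IsFiniteMeasure μ] (hf : Measurable f) (hB : MeasurableSet B) (n : ℕ) :
    Integrable (visitSum f B n) μ :=
  Integrable.of_bound (measurable_visitSum hf hB n).aestronglyMeasurable n <|
    Eventually.of_forall fun x => by
      rw [Real.norm_of_nonneg (visitSum_mem_Icc f B n x).1]
      exact (visitSum_mem_Icc f B n x).2

lemma integral_visitSum [IsFiniteMeasure μ] (hf : MeasurePreserving f μ μ)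
    (hB : MeasurableSet B) (n : ℕ) : ∫ x, visitSum f B n x ∂μ = n * μ.real B := by
  have hind : AEStronglyMeasurable (B.indicator (1 : α → ℝ)) μ :=
    (measurable_one.indicator hB).aestronglyMeasurable
  have integral_term (j : ℕ) : ∫ x, B.indicator (1 : α → ℝ) (f^[j] x) ∂μ = μ.real B := by
    rw [integral_comp_of_measurePreserving (hf.iterate j) hind, integral_indicator_one hB]
  have integrable_term (j : ℕ) : Integrable (fun x => B.indicator (1 : α → ℝ) (f^[j] x)) μ :=
    integrable_of_mem_Icc (hind.comp_measurePreserving (hf.iterate j))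
      fun x => indicator_one_mem_Icc B (f^[j] x)
  simp only [visitSum]
  rw [integral_finsetSum _ fun j _ => integrable_term j]
  simp only [integral_term, Finset.sum_const, Finset.card_range, nsmul_eq_mul]

lemma le_measureReal_union_of_mul_le_visitSum [IsProbabilityMeasure μ]
    (hf : MeasurePreserving f μ μ) (hB : MeasurableSet B) {a : ℝ} (ha : a ∈ Icc (0 : ℝ) 1)
    {D : Set α} (hD : MeasurableSet D) {M : ℕ}
    (h : ∀ x, x ∉ D → ∃ n, 1 ≤ n ∧ n ≤ M ∧ a * n ≤ visitSum f B n x) :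
    a ≤ μ.real (B ∪ D) := by
  have average_le (L : ℕ) : a * ((L : ℝ) - M) ≤ L * μ.real (B ∪ D) := by
    rw [← integral_visitSum hf (hB.union hD)]
    calc a * ((L : ℝ) - M) = ∫ _, a * ((L : ℝ) - M) ∂μ := by simp
      _ ≤ _ := integral_mono (integrable_const _)
          (integrable_visitSum hf.measurable (hB.union hD) L) (mul_sub_le_visitSum ha h L)
  by_contra! hlt
  obtain ⟨L, hL⟩ := exists_nat_gt (a * M / (a - μ.real (B ∪ D)))
  rw [div_lt_iff₀ (sub_pos.2 hlt)] at hL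
  linarith [average_le L]

lemma le_measureReal_of_ae_exists_mul_le_visitSum [IsProbabilityMeasure μ]
    (hf : MeasurePreserving f μ μ) (hB : MeasurableSet B) {a : ℝ} (ha : 0 ≤ a)
    (h : ∀ᵐ x ∂μ, ∃ n, 1 ≤ n ∧ a * n ≤ visitSum f B n x) : a ≤ μ.real B := by
  have ha_le : a ≤ 1 := by
    obtain ⟨x, n, hn_pos, hn⟩ := h.exists
    exact le_of_mul_le_mul_right (by linarith [(visitSum_mem_Icc f B n x).2])
      (show (0 : ℝ) < n by exact_mod_cast hn_pos)
  set D : ℕ → Set α := fun M => ⋂ n ∈ Icc 1 M, {x | visitSum f B n x < a * n} with hD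
  have mem_D {M : ℕ} {x : α} : x ∈ D M ↔ ∀ n, 1 ≤ n → n ≤ M → visitSum f B n x < a * n := by
    simp [hD]
  have D_measurable (M : ℕ) : MeasurableSet (D M) :=
    MeasurableSet.biInter (to_countable _) fun n _ =>
      measurableSet_lt (measurable_visitSum hf.measurable hB n) measurable_const
  have D_antitone : Antitone D := fun M M' hMM' x hx =>
    mem_D.2 fun n hn_pos hnM => mem_D.1 hx n hn_pos (hnM.trans hMM')
  have D_null : μ (⋂ M, D M) = 0 := by
    refine measure_mono_null (t := {x | ¬ ∃ n, 1 ≤ n ∧ a * n ≤ visitSum f B n x}) ?_ h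
    rintro x hx ⟨n, hn_pos, hn⟩
    exact hn.not_gt (mem_D.1 (mem_iInter.1 hx n) n hn_pos le_rfl)
  have D_tendsto : Tendsto (fun M => μ.real B + μ.real (D M)) atTop (𝓝 (μ.real B + 0)) := by
    refine tendsto_const_nhds.add ((ENNReal.tendsto_toReal ENNReal.zero_ne_top).comp ?_)
    rw [← D_null]
    exact tendsto_measure_iInter_atTop (fun M => (D_measurable M).nullMeasurableSet) D_antitone
      ⟨0, measure_ne_top _ _⟩
  rw [add_zero] at D_tendsto
  refine ge_of_tendsto' D_tendsto fun M => (le_measureReal_union_of_mul_le_visitSum (M := M) hf hB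
    ⟨ha, ha_le⟩ (D_measurable M) fun x hx => ?_).trans (measureReal_union_le B (D M))
  simpa only [mem_D, not_forall, not_lt, exists_prop] using hx

lemma measurableSet_upperFrequencyGe (hf : Measurable f) (hB : MeasurableSet B) (c : ℝ) :
    MeasurableSet (upperFrequencyGe f B c) := by
  have eq_iInter : upperFrequencyGe f B c = ⋂ a : ℚ, ⋂ (_ : (a : ℝ) < c), ⋂ M : ℕ,
      ⋃ n, ⋃ (_ : M ≤ n), {x | a * n ≤ visitSum f B n x} := by
    ext x; simp [upperFrequencyGe, frequently_atTop]
  rw [eq_iInter]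
  exact MeasurableSet.iInter fun a => MeasurableSet.iInter fun _ => MeasurableSet.iInter fun M =>
    MeasurableSet.iUnion fun n => MeasurableSet.iUnion fun _ =>
      measurableSet_le measurable_const (measurable_visitSum hf hB n)

lemma ae_eventually_visitSum_lt [IsProbabilityMeasure μ] (hf : Ergodic f μ)
    (hB : MeasurableSet B) {c : ℝ} (hc : μ.real B < c) :
    ∀ᵐ x ∂μ, ∀ᶠ n : ℕ in atTop, visitSum f B n x < c * n := by
  rcases hf.toPreErgodic.ae_mem_or_ae_notMem (measurableSet_upperFrequencyGe hf.measurable hB c)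
    (preimage_upperFrequencyGe f B c) with h_full | h_null
  · obtain ⟨a, ha_gt, ha_lt⟩ := exists_rat_btwn hc
    refine absurd (le_measureReal_of_ae_exists_mul_le_visitSum hf.toMeasurePreserving hB
      (measureReal_nonneg.trans ha_gt.le) ?_) (not_le.2 ha_gt)
    filter_upwards [h_full] with x hx
    exact frequently_atTop.1 (hx a ha_lt) 1
  · filter_upwards [h_null] with x hx
    simp only [upperFrequencyGe, mem_ofPred_eq, not_forall, not_frequently, not_le] at hx
    obtain ⟨a, ha, hx⟩ := hx
    filter_upwards [hx] with n hn
    exact hn.trans_le (by gcongr)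

theorem ae_tendsto_visitSum_div [IsProbabilityMeasure μ] (hf : Ergodic f μ)
    (hB : MeasurableSet B) :
    ∀ᵐ x ∂μ, Tendsto (fun n : ℕ => visitSum f B n x / n) atTop (𝓝 (μ.real B)) := by
  have upper (A : Set α) (hA : MeasurableSet A) :
      ∀ᵐ x ∂μ, ∀ k : ℕ, ∀ᶠ n : ℕ in atTop, visitSum f A n x < (μ.real A + 1 / ((k : ℝ) + 1)) * n :=
    ae_all_iff.2 fun _ => ae_eventually_visitSum_lt hf hA
      (lt_add_of_pos_right _ Nat.one_div_pos_of_nat)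
  filter_upwards [upper B hB, upper Bᶜ hB.compl] with x hx hx_compl
  refine Metric.tendsto_nhds.2 fun ε hε => ?_
  obtain ⟨k, hk⟩ := exists_nat_one_div_lt hε
  filter_upwards [hx k, hx_compl k, eventually_gt_atTop 0] with n hn hn_compl hn_pos
  have hn' : (0 : ℝ) < n := by exact_mod_cast hn_pos
  rw [visitSum_compl, probReal_compl_eq_one_sub hB] at hn_compl
  rw [Real.dist_eq, abs_lt, lt_sub_iff_add_lt, lt_div_iff₀ hn', sub_lt_iff_lt_add,
    div_lt_iff₀ hn']
  constructor <;> nlinarith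

end visitSum

section excursion

variable {α : Type*} {f : α → α} {Y B : Set α}

/-- The number of visits to `Y` at times `1 ≤ j ≤ n`. -/
def visits (f : α → α) (Y : Set α) (n : ℕ) (x : α) : ℕ :=
  ∑ j ∈ Finset.range n, Y.indicator 1 (f^[j + 1] x)

lemma visits_zero (x : α) : visits f Y 0 x = 0 := rfl

lemma visits_succ_of_mem {n : ℕ} {x : α} (h : f^[n + 1] x ∈ Y) :
    visits f Y (n + 1) x = visits f Y n x + 1 := by
  rw [visits, Finset.sum_range_succ, indicator_of_mem h]; rfl

lemma visits_succ_of_notMem {n : ℕ} {x : α} (h : f^[n + 1] x ∉ Y) :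
    visits f Y (n + 1) x = visits f Y n x := by
  rw [visits, Finset.sum_range_succ, indicator_of_notMem h]; rfl

lemma visits_le (n : ℕ) (x : α) : visits f Y n x ≤ n := by
  induction n with
  | zero => rfl
  | succ n ih =>
    by_cases h : f^[n + 1] x ∈ Y
    · rw [visits_succ_of_mem h]; omega
    · rw [visits_succ_of_notMem h]; omega

lemma natCast_visits (n : ℕ) (x : α) : (visits f Y n x : ℝ) = visitSum f Y n (f x) := by
  rw [visits, visitSum, Nat.cast_sum]
  refine Finset.sum_congr rfl fun j _ => ?_
  rw [Function.iterate_succ_apply]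
  by_cases h : f^[j] (f x) ∈ Y <;> simp [h]

/-- The points of `Y` that do not return to `Y` by time `i`. -/
def excursionDomain (f : α → α) (Y : Set α) (i : ℕ) : Set α :=
  {y ∈ Y | ∀ j, 1 ≤ j → j ≤ i → f^[j] y ∉ Y}

lemma mem_excursionDomain_zero {x : α} (hx : x ∈ Y) : x ∈ excursionDomain f Y 0 :=
  ⟨hx, fun j hj_pos hj => by omega⟩

/-- The points of `Y` whose excursion, up to but excluding the next visit to `Y`, meets `B`. -/
def hull (f : α → α) (Y B : Set α) : Set α :=
  ⋃ i, excursionDomain f Y i ∩ f^[i] ⁻¹' B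

/-- At a fixed time `N` an orbit is in at most one excursion, so at most one time `N - i` can be
the start of an excursion of length more than `i`. -/
lemma pairwiseDisjoint_preimage_excursionDomain (f : α → α) (Y : Set α) (N : ℕ) :
    (Finset.range N : Set ℕ).PairwiseDisjoint fun i => f^[N - i] ⁻¹' excursionDomain f Y i := by
  have disjoint_of_lt {i k : ℕ} (hik : i < k) (hk : k < N) :
      Disjoint (f^[N - i] ⁻¹' excursionDomain f Y i) (f^[N - k] ⁻¹' excursionDomain f Y k) := by
    rw [Set.disjoint_left]
    intro x hx_i hx_k
    have notMem : f^[k - i] (f^[N - k] x) ∉ Y := hx_k.2 (k - i) (by omega) (by omega)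
    rw [← Function.iterate_add_apply, show k - i + (N - k) = N - i by omega] at notMem
    exact notMem hx_i.1
  intro i hi k hk hik
  rcases lt_or_gt_of_ne hik with h | h
  · exact disjoint_of_lt h (Finset.mem_range.1 hk)
  · exact (disjoint_of_lt h (Finset.mem_range.1 hi)).symm

variable [MeasurableSpace α] {μ : Measure α}

lemma measurable_visits (hf : Measurable f) (hY : MeasurableSet Y) (n : ℕ) :
    Measurable (visits f Y n) :=
  Finset.measurable_fun_sum _ fun j _ => (measurable_one.indicator hY).comp (hf.iterate (j + 1))

lemma ae_tendsto_visits_div [IsProbabilityMeasure μ] (hf : Ergodic f μ) (hY : MeasurableSet Y) :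
    ∀ᵐ x ∂μ, Tendsto (fun n : ℕ => (visits f Y n x : ℝ) / n) atTop (𝓝 (μ.real Y)) := by
  filter_upwards [hf.toMeasurePreserving.quasiMeasurePreserving.ae
    (ae_tendsto_visitSum_div hf hY)] with x hx
  simpa only [natCast_visits] using hx

lemma measurableSet_excursionDomain (hf : Measurable f) (hY : MeasurableSet Y) (i : ℕ) :
    MeasurableSet (excursionDomain f Y i) := by
  have eq_inter : excursionDomain f Y i =
      Y ∩ ⋂ j, ⋂ (_ : 1 ≤ j), ⋂ (_ : j ≤ i), f^[j] ⁻¹' Yᶜ := by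
    ext y; simp [excursionDomain]
  rw [eq_inter]
  exact hY.inter <| MeasurableSet.iInter fun j => MeasurableSet.iInter fun _ =>
    MeasurableSet.iInter fun _ => hf.iterate j hY.compl

lemma measurableSet_hull (hf : Measurable f) (hY : MeasurableSet Y) (hB : MeasurableSet B) :
    MeasurableSet (hull f Y B) :=
  MeasurableSet.iUnion fun i => (measurableSet_excursionDomain hf hY i).inter (hf.iterate i hB)

lemma measure_hull_le (hf : MeasurePreserving f μ μ) (hY : MeasurableSet Y)
    (hB : MeasurableSet B) : μ (hull f Y B) ≤ μ B := by
  set P : ℕ → Set α := fun i => excursionDomain f Y i ∩ f^[i] ⁻¹' B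
  have P_measurable (i : ℕ) : MeasurableSet (P i) :=
    (measurableSet_excursionDomain hf.measurable hY i).inter (hf.measurable.iterate i hB)
  refine (measure_iUnion_le P).trans (ENNReal.tsum_le_of_sum_range_le fun N => ?_)
  have measure_P (i : ℕ) : μ (P i) = μ (f^[N - i] ⁻¹' P i) :=
    ((hf.iterate (N - i)).measure_preimage (P_measurable i).nullMeasurableSet).symm
  have P_disjoint : (Finset.range N : Set ℕ).PairwiseDisjoint fun i => f^[N - i] ⁻¹' P i :=
    (pairwiseDisjoint_preimage_excursionDomain f Y N).mono fun i =>
      preimage_mono inter_subset_left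
  rw [Finset.sum_congr rfl fun i _ => measure_P i, ← measure_biUnion_finset P_disjoint
    fun i _ => hf.measurable.iterate (N - i) (P_measurable i),
    ← (hf.iterate N).measure_preimage hB.nullMeasurableSet]
  refine measure_mono (iUnion₂_subset fun i hi x hx => ?_)
  have mem_B : f^[i] (f^[N - i] x) ∈ B := hx.2
  rwa [← Function.iterate_add_apply, Nat.add_sub_cancel' (Finset.mem_range.1 hi).le] at mem_B

end excursion

section returnMap

variable {f : ℝ → ℝ} {Y : Set ℝ}

lemma firstReturn_eq_succ {y : ℝ} {i : ℕ} (hy : y ∈ excursionDomain f Y i)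
    (h : f^[i + 1] y ∈ Y) : firstReturn f Y y = i + 1 := by
  refine le_antisymm (Nat.sInf_le ⟨by omega, h⟩) ?_
  have firstReturn_mem : firstReturn f Y y ∈ {n : ℕ | 1 ≤ n ∧ f^[n] y ∈ Y} :=
    Nat.sInf_mem ⟨i + 1, by omega, h⟩
  by_contra! hlt
  exact hy.2 _ firstReturn_mem.1 (by omega) firstReturn_mem.2

lemma exists_mem_excursionDomain_iterate_eq {x : ℝ} (hx : x ∈ Y) (n : ℕ) :
    ∃ i, (returnMap f Y)^[visits f Y n x] x ∈ excursionDomain f Y i ∧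
      f^[n] x = f^[i] ((returnMap f Y)^[visits f Y n x] x) := by
  induction n with
  | zero => exact ⟨0, mem_excursionDomain_zero hx, rfl⟩
  | succ n ih =>
    obtain ⟨i, hy, hi⟩ := ih
    set y := (returnMap f Y)^[visits f Y n x] x with hy_def
    have iterate_succ_eq : f^[n + 1] x = f^[i + 1] y := by
      rw [Function.iterate_succ_apply', hi, Function.iterate_succ_apply']
    by_cases h : f^[n + 1] x ∈ Y
    · have returnMap_iterate : (returnMap f Y)^[visits f Y (n + 1) x] x = f^[n + 1] x := by
        rw [visits_succ_of_mem h, Function.iterate_succ_apply', ← hy_def, returnMap,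
          firstReturn_eq_succ hy (iterate_succ_eq ▸ h), iterate_succ_eq]
      rw [returnMap_iterate]
      exact ⟨0, mem_excursionDomain_zero h, rfl⟩
    · rw [visits_succ_of_notMem h, ← hy_def]
      refine ⟨i + 1, ⟨hy.1, fun j hj_pos hj => ?_⟩, iterate_succ_eq⟩
      rcases Nat.le_or_eq_of_le_succ hj with hj_le | rfl
      · exact hy.2 j hj_pos hj_le
      · exact iterate_succ_eq ▸ h

lemma iterate_eq_iterate_returnMap {x : ℝ} (hx : x ∈ Y) {n : ℕ} (h : f^[n] x ∈ Y) :
    f^[n] x = (returnMap f Y)^[visits f Y n x] x := by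
  obtain ⟨i, hy, hi⟩ := exists_mem_excursionDomain_iterate_eq hx n (f := f)
  rcases Nat.eq_zero_or_pos i with rfl | hi_pos
  · exact hi
  · exact absurd (hi ▸ h) (hy.2 i hi_pos le_rfl)

lemma iterate_returnMap_mem_hull {x : ℝ} (hx : x ∈ Y) {n : ℕ} {B : Set ℝ} (h : f^[n] x ∈ B) :
    (returnMap f Y)^[visits f Y n x] x ∈ hull f Y B := by
  obtain ⟨i, hy, hi⟩ := exists_mem_excursionDomain_iterate_eq hx n (f := f)
  exact mem_iUnion.2 ⟨i, hy, by rwa [mem_preimage, ← hi]⟩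

lemma exists_iterate_eq_iterate_returnMap {x : ℝ} (hx : x ∈ Y) {n m : ℕ} (hm_pos : 1 ≤ m)
    (hm : m ≤ visits f Y n x) : ∃ j ∈ Icc 1 n, f^[j] x = (returnMap f Y)^[m] x := by
  induction n with
  | zero => rw [visits_zero] at hm; omega
  | succ n ih =>
    rcases Nat.lt_or_ge (visits f Y n x) m with h | h
    · by_cases hY : f^[n + 1] x ∈ Y
      · have iterate_eq := iterate_eq_iterate_returnMap hx hY
        have visits_succ := visits_succ_of_mem hY
        rw [show visits f Y (n + 1) x = m by omega] at iterate_eq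
        exact ⟨n + 1, ⟨by omega, le_rfl⟩, iterate_eq⟩
      · rw [visits_succ_of_notMem hY] at hm; omega
    · obtain ⟨j, hj, iterate_eq⟩ := ih h
      exact ⟨j, ⟨hj.1, hj.2.trans n.le_succ⟩, iterate_eq⟩

lemma recCount_succ (f : ℝ → ℝ) (n : ℕ) (r x : ℝ) :
    recCount f (n + 1) r x = recCount f n r x + if dist (f^[n + 1] x) x ≤ r then 1 else 0 := by
  unfold recCount
  rw [← Finset.insert_Icc_right_eq_Icc_add_one (by omega), Finset.filter_insert]
  split_ifs with h
  · rw [Finset.card_insert_of_notMem (by simp)]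
  · rfl

lemma recCount_eq_recCount_returnMap {x r : ℝ} (hx : x ∈ Y) {n : ℕ}
    (h : ∀ j, 1 ≤ j → j ≤ n → dist (f^[j] x) x ≤ r → f^[j] x ∈ Y) :
    recCount f n r x = recCount (returnMap f Y) (visits f Y n x) r x := by
  induction n with
  | zero => rw [visits_zero]; rfl
  | succ n ih =>
    rw [recCount_succ, ih fun j hj_pos hj => h j hj_pos (by omega)]
    by_cases hY : f^[n + 1] x ∈ Y
    · have iterate_eq := iterate_eq_iterate_returnMap hx hY
      rw [visits_succ_of_mem hY] at iterate_eq ⊢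
      rw [recCount_succ, iterate_eq]
    · rw [visits_succ_of_notMem hY, if_neg fun hd => hY (h (n + 1) (by omega) le_rfl hd), add_zero]

end returnMap

section induced

variable {α : Type*} [MeasurableSpace α] {μ : Measure α} {Y : Set α}

lemma cond_real_eq_div (hY : MeasurableSet Y) (E : Set α) :
    (ProbabilityTheory.cond μ Y).real E = μ.real (Y ∩ E) / μ.real Y := by
  rw [measureReal_def, ProbabilityTheory.cond_apply hY, ENNReal.toReal_mul, ENNReal.toReal_inv,
    inv_mul_eq_div]
  rfl

lemma cond_real_le_div [IsFiniteMeasure μ] (hY : MeasurableSet Y) (E : Set α) :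
    (ProbabilityTheory.cond μ Y).real E ≤ μ.real E / μ.real Y := by
  rw [cond_real_eq_div hY]
  exact div_le_div_of_nonneg_right (measureReal_mono inter_subset_right) measureReal_nonneg

lemma ae_mem_imp_of_ae_cond [IsFiniteMeasure μ] (hY : MeasurableSet Y) {P : α → Prop}
    (h : ∀ᵐ x ∂(ProbabilityTheory.cond μ Y), P x) : ∀ᵐ x ∂μ, x ∈ Y → P x := by
  rw [ProbabilityTheory.cond,
    Measure.ae_ennreal_smul_measure_iff (ENNReal.inv_ne_zero.2 (measure_ne_top μ Y))] at h
  exact (ae_restrict_iff' hY).1 h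

lemma measureReal_pos_of_isProbabilityMeasure_cond
    [IsProbabilityMeasure (ProbabilityTheory.cond μ Y)] : 0 < μ.real Y := by
  have cond_ne_zero := IsProbabilityMeasure.ne_zero (ProbabilityTheory.cond μ Y)
  rw [Ne, ProbabilityTheory.cond_eq_zero, not_or] at cond_ne_zero
  exact ENNReal.toReal_pos cond_ne_zero.2 cond_ne_zero.1

lemma ae_of_forall_exists_measure_compl_le {P : α → Prop}
    (h : ∀ ε : ℝ, 0 < ε → ∃ Y : Set α, μ Yᶜ ≤ ENNReal.ofReal ε ∧ ∀ᵐ x ∂μ, x ∈ Y → P x) :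
    ∀ᵐ x ∂μ, P x := by
  rw [ae_iff]
  refine le_antisymm (ENNReal.le_of_forall_pos_le_add fun ε hε _ => ?_) zero_le
  obtain ⟨Y, hY, hP⟩ := h ε (by exact_mod_cast hε)
  rw [zero_add]
  calc μ {x | ¬P x} ≤ μ (Yᶜ ∪ {x | ¬(x ∈ Y → P x)}) :=
        measure_mono fun x hx => by
          by_cases hxY : x ∈ Y
          · exact Or.inr fun h => hx (h hxY)
          · exact Or.inl hxY
    _ ≤ μ Yᶜ + μ {x | ¬(x ∈ Y → P x)} := measure_union_le _ _
    _ ≤ ε := by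
        rw [ae_iff.1 hP, add_zero]
        simpa using hY

lemma cond_real_cell_inter_preimage_hull_le {f F : ℝ → ℝ} {μ : Measure ℝ} {Y B : Set ℝ}
    {C κ : ℝ} [IsFiniteMeasure μ] [IsFiniteMeasure (ProbabilityTheory.cond μ Y)]
    (hf : MeasurePreserving f μ μ) (hY : MeasurableSet Y) (hF : Measurable F) (hC : 0 ≤ C)
    (hdecay : CellDecay F (ProbabilityTheory.cond μ Y) C κ) (hB : MeasurableSet B)
    (ℓ : ℝ) (i : ℤ) (m : ℕ) :
    (ProbabilityTheory.cond μ Y).real (cell ℓ 0 i ∩ F^[m] ⁻¹' hull f Y B) ≤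
      ((ProbabilityTheory.cond μ Y).real (cell ℓ 0 i) + C * Real.exp (-κ * m)) *
        (μ.real B / μ.real Y) := by
  set ν := ProbabilityTheory.cond μ Y
  set H := hull f Y B
  have H_measurable : MeasurableSet H := measurableSet_hull hf.measurable hY hB
  have hull_le : ν.real H ≤ μ.real B / μ.real Y := by
    refine (cond_real_le_div hY _).trans (div_le_div_of_nonneg_right ?_ measureReal_nonneg)
    exact ENNReal.toReal_mono (measure_ne_top _ _) (measure_hull_le hf hY hB)
  have indicator_integrable : Integrable (H.indicator (1 : ℝ → ℝ)) ν :=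
    integrable_of_mem_Icc (measurable_one.indicator H_measurable).aestronglyMeasurable
      (indicator_one_mem_Icc H)
  have abs_indicator (x : ℝ) : |H.indicator (1 : ℝ → ℝ) x| = H.indicator 1 x :=
    abs_of_nonneg (indicator_one_mem_Icc H x).1
  have correlation := hdecay ℓ 0 i (H.indicator 1) indicator_integrable m
  simp only [abs_indicator] at correlation
  rw [setIntegral_indicator_one_comp (hF.iterate m) H_measurable,
    integral_indicator_one H_measurable] at correlation
  have factor_nonneg : 0 ≤ ν.real (cell ℓ 0 i) + C * Real.exp (-κ * m) :=
    add_nonneg measureReal_nonneg (by positivity)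
  calc ν.real (cell ℓ 0 i ∩ F^[m] ⁻¹' H)
      ≤ (ν.real (cell ℓ 0 i) + C * Real.exp (-κ * m)) * ν.real H := by
        linarith [(abs_le.1 correlation).2]
    _ ≤ _ := mul_le_mul_of_nonneg_left hull_le factor_nonneg

lemma AsymptoticallyHyperbolic.exists_recurrenceEstimates {X : Set ℝ} {f : ℝ → ℝ}
    {μ : Measure ℝ} (hsys : IsErgodicAcip X f μ) (hasym : AsymptoticallyHyperbolic X f μ) {ε : ℝ}
    (hε : 0 < ε) :
    ∃ (Y : Set ℝ) (C κ S β : ℝ), MeasurableSet Y ∧ Y ⊆ X ∧ μ Yᶜ ≤ ENNReal.ofReal ε ∧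
      IsProbabilityMeasure (ProbabilityTheory.cond μ Y) ∧
      RecurrenceEstimates (returnMap f Y) (ProbabilityTheory.cond μ Y) C κ S β := by
  obtain ⟨ι, _, U, _, hU, hyp⟩ := hasym ε hε
  obtain ⟨C, κ, S, β, estimates⟩ := hyp.exists_recurrenceEstimates
  refine ⟨_, C, κ, S, β, hyp.isErgodicAcip.measurableSet, sdiff_subset, ?_,
    hyp.isErgodicAcip.isProbabilityMeasure, estimates⟩
  calc μ (X \ ⋃ i, U i)ᶜ ≤ μ (Xᶜ ∪ ⋃ i, U i) := measure_mono fun x hx => by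
        by_cases hxX : x ∈ X
        · exact Or.inr (by_contra fun h => hx ⟨hxX, h⟩)
        · exact Or.inl hxX
    _ ≤ μ Xᶜ + μ (⋃ i, U i) := measure_union_le _ _
    _ ≤ _ := by rw [hsys.measure_compl, zero_add]; exact hU

end induced

section recMin

variable {f : ℝ → ℝ}

lemma recMin_le {n k : ℕ} (hk : k ∈ Icc 1 n) (x : ℝ) : recMin f n x ≤ dist (f^[k] x) x :=
  csInf_le ⟨0, by rintro _ ⟨j, _, rfl⟩; exact dist_nonneg⟩ (mem_image_of_mem _ hk)

lemma exists_recMin_eq {n : ℕ} (hn : 1 ≤ n) (x : ℝ) :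
    ∃ k ∈ Icc 1 n, recMin f n x = dist (f^[k] x) x := by
  obtain ⟨k, hk, h⟩ := Set.Nonempty.csInf_mem (s := (fun k : ℕ => dist (f^[k] x) x) '' Icc 1 n)
    ((nonempty_Icc.2 hn).image _) ((finite_Icc 1 n).image _)
  exact ⟨k, hk, h.symm⟩

end recMin

section cellSums

variable {μ : Measure ℝ} {ℓ : ℝ}

lemma tsum_setLIntegral_cell_zero (hℓ : 0 < ℓ) (g : ℝ → ENNReal) :
    ∑' i : ℤ, ∫⁻ x in cell ℓ 0 i, g x ∂μ = ∫⁻ x, g x ∂μ := by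
  have cells_cover : ⋃ i, cell ℓ 0 i = univ :=
    eq_univ_of_forall fun x => mem_iUnion.2 ⟨_, mem_cell_floor hℓ 0 x⟩
  rw [← lintegral_iUnion (measurableSet_cell ℓ 0) (pairwise_disjoint_cell_zero hℓ), cells_cover,
    Measure.restrict_univ]

lemma tsum_measure_cell_zero (hℓ : 0 < ℓ) : ∑' i : ℤ, μ (cell ℓ 0 i) = μ univ := by
  simpa using tsum_setLIntegral_cell_zero (μ := μ) hℓ 1

lemma measure_cell_one_le (hℓ : 0 < ℓ) (i : ℤ) :
    μ (cell ℓ 1 i) ≤ μ (cell ℓ 0 (i - 1)) + μ (cell ℓ 0 i) + μ (cell ℓ 0 (i + 1)) := by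
  refine (measure_mono fun x hx => ?_).trans ((measure_union_le _ _).trans
    (add_le_add_left (measure_union_le _ _) _))
  simp only [mem_union, mem_cell_zero_iff hℓ]
  rw [mem_cell_iff hℓ] at hx
  push_cast at hx
  omega

lemma tsum_comp_sub_one (g : ℤ → ENNReal) : ∑' i, g (i - 1) = ∑' i, g i :=
  (Equiv.subRight (1 : ℤ)).tsum_eq g

lemma tsum_comp_add_one (g : ℤ → ENNReal) : ∑' i, g (i + 1) = ∑' i, g i :=
  (Equiv.addRight (1 : ℤ)).tsum_eq g

lemma tsum_measure_cell_one_le (hℓ : 0 < ℓ) : ∑' i : ℤ, μ (cell ℓ 1 i) ≤ 3 * μ univ := by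
  refine (ENNReal.tsum_le_tsum fun i => measure_cell_one_le hℓ i).trans (le_of_eq ?_)
  rw [ENNReal.tsum_add, ENNReal.tsum_add, tsum_comp_sub_one fun i => μ (cell ℓ 0 i),
    tsum_comp_add_one fun i => μ (cell ℓ 0 i), tsum_measure_cell_zero hℓ]
  ring

lemma tsum_measure_cell_zero_sq_le (hℓ : 0 < ℓ) :
    ∑' i : ℤ, μ (cell ℓ 0 i) * μ (cell ℓ 0 i) ≤ ∫⁻ x, μ (Metric.ball x ℓ) ∂μ := by
  rw [← tsum_setLIntegral_cell_zero hℓ]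
  refine ENNReal.tsum_le_tsum fun i => ?_
  rw [← setLIntegral_const]
  refine setLIntegral_mono' (measurableSet_cell ℓ 0 i) fun x hx => measure_mono fun y hy => ?_
  rw [mem_cell_zero_iff hℓ] at hx
  subst hx
  simpa using dist_lt_of_mem_cell hℓ hy

lemma tsum_measure_cell_mul_le (hℓ : 0 < ℓ) :
    ∑' i : ℤ, μ (cell ℓ 0 i) * μ (cell ℓ 1 i) ≤ 5 * ∫⁻ x, μ (Metric.ball x ℓ) ∂μ := by
  set a : ℤ → ENNReal := fun i => μ (cell ℓ 0 i)
  have mul_le_sq_add_sq (x y : ENNReal) : x * y ≤ x * x + y * y := by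
    rcases le_total x y with h | h
    · exact (mul_le_mul_left h y).trans le_add_self
    · exact (mul_le_mul_right h x).trans le_self_add
  have term_le (i : ℤ) : a i * μ (cell ℓ 1 i) ≤
      3 * (a i * a i) + a (i - 1) * a (i - 1) + a (i + 1) * a (i + 1) := by
    calc a i * μ (cell ℓ 1 i) ≤ a i * (a (i - 1) + a i + a (i + 1)) :=
          mul_le_mul_right (measure_cell_one_le hℓ i) _
      _ = a i * a (i - 1) + a i * a i + a i * a (i + 1) := by ring
      _ ≤ (a i * a i + a (i - 1) * a (i - 1)) + a i * a i +
          (a i * a i + a (i + 1) * a (i + 1)) := by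
            gcongr <;> exact mul_le_sq_add_sq _ _
      _ = _ := by ring
  calc ∑' i : ℤ, μ (cell ℓ 0 i) * μ (cell ℓ 1 i)
      ≤ ∑' i, (3 * (a i * a i) + a (i - 1) * a (i - 1) + a (i + 1) * a (i + 1)) :=
        ENNReal.tsum_le_tsum term_le
    _ = 5 * ∑' i, a i * a i := by
        rw [ENNReal.tsum_add, ENNReal.tsum_add, ENNReal.tsum_mul_left,
          tsum_comp_sub_one fun i => a i * a i, tsum_comp_add_one fun i => a i * a i]
        ring
    _ ≤ _ := by gcongr; exact tsum_measure_cell_zero_sq_le hℓ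

lemma lintegral_measure_ball_pos [NeZero μ] (hℓ : 0 < ℓ) : 0 < ∫⁻ x, μ (Metric.ball x ℓ) ∂μ := by
  refine pos_iff_ne_zero.2 fun h => NeZero.ne μ (Measure.measure_univ_eq_zero.1 ?_)
  have sum_sq_eq_zero := le_antisymm
    ((tsum_measure_cell_zero_sq_le (μ := μ) hℓ).trans h.le) zero_le
  rw [ENNReal.tsum_eq_zero] at sum_sq_eq_zero
  rw [← tsum_measure_cell_zero hℓ, ENNReal.tsum_eq_zero]
  exact fun i => mul_self_eq_zero.1 (sum_sq_eq_zero i)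

end cellSums

section lintegralBall

variable {α : Type*} [MetricSpace α] [MeasurableSpace α] [OpensMeasurableSpace α] {μ : Measure α}

lemma tendsto_measure_ball_one_div [IsFiniteMeasure μ] [NullSingletonClass μ] (x : α) :
    Tendsto (fun k : ℕ => μ (Metric.ball x (1 / ((k : ℝ) + 1)))) atTop (𝓝 0) := by
  have inter_null : μ (⋂ k : ℕ, Metric.ball x (1 / ((k : ℝ) + 1))) = 0 := by
    refine measure_mono_null (t := {x}) (fun y hy => ?_) (measure_singleton x)
    by_contra hne
    obtain ⟨k, hk⟩ := exists_nat_one_div_lt (dist_pos.2 hne)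
    exact absurd (Metric.mem_ball.1 (mem_iInter.1 hy k)) (not_lt.2 hk.le)
  rw [← inter_null]
  exact tendsto_measure_iInter_atTop (fun k => measurableSet_ball.nullMeasurableSet)
    (fun i j hij => Metric.ball_subset_ball (by gcongr)) ⟨0, measure_ne_top _ _⟩

variable [SecondCountableTopology α]

lemma exists_pos_lintegral_measure_ball_le [IsFiniteMeasure μ] [NullSingletonClass μ] {ε : ENNReal}
    (hε : 0 < ε) : ∃ s : ℝ, 0 < s ∧ ∫⁻ x, μ (Metric.ball x s) ∂μ ≤ ε := by
  have lintegral_tendsto : Tendsto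
      (fun k : ℕ => ∫⁻ x, μ (Metric.ball x (1 / ((k : ℝ) + 1))) ∂μ) atTop (𝓝 (∫⁻ _, 0 ∂μ)) := by
    refine tendsto_lintegral_of_dominated_convergence (fun _ => μ univ) (fun k => ?_) (fun k => ?_)
      ?_ (Eventually.of_forall tendsto_measure_ball_one_div)
    · have pairs_measurable : MeasurableSet {p : α × α | dist p.2 p.1 < 1 / ((k : ℝ) + 1)} :=
        measurableSet_lt (measurable_snd.dist measurable_fst) measurable_const
      exact measurable_measure_prodMk_left pairs_measurable
    · exact Eventually.of_forall fun x => measure_mono (subset_univ _)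
    · rw [lintegral_const]
      exact ENNReal.mul_ne_top (measure_ne_top _ _) (measure_ne_top _ _)
  rw [lintegral_zero] at lintegral_tendsto
  obtain ⟨k, hk⟩ := (lintegral_tendsto.eventually (gt_mem_nhds hε)).exists
  exact ⟨_, by positivity, hk.le⟩

lemma exists_pos_ge_tsum_lintegral_measure_ball_lt_top [IsFiniteMeasure μ]
    [NullSingletonClass μ] {r : ℕ → ℝ} (hsum : ∑' m, ∫⁻ x, μ (Metric.ball x (r m)) ∂μ < ⊤) :
    ∃ s : ℕ → ℝ, (∀ m, 0 < s m) ∧ (∀ m, r m ≤ s m) ∧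
      ∑' m, ∫⁻ x, μ (Metric.ball x (s m)) ∂μ < ⊤ := by
  obtain ⟨ε, hε_pos, hε_sum⟩ := ENNReal.exists_pos_sum_of_countable' one_ne_zero ℕ
  choose t ht_pos ht using fun m => exists_pos_lintegral_measure_ball_le (μ := μ) (hε_pos m)
  refine ⟨fun m => max (r m) (t m), fun m => lt_max_of_lt_right (ht_pos m),
    fun m => le_max_left _ _, ?_⟩
  have ball_le (m : ℕ) : ∫⁻ x, μ (Metric.ball x (max (r m) (t m))) ∂μ ≤
      ∫⁻ x, μ (Metric.ball x (r m)) ∂μ + ε m := by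
    rcases max_choice (r m) (t m) with h | h <;> rw [h]
    · exact le_self_add
    · exact (ht m).trans le_add_self
  refine (ENNReal.tsum_le_tsum ball_le).trans_lt ?_
  rw [ENNReal.tsum_add]
  exact ENNReal.add_lt_top.2 ⟨hsum, hε_sum.trans ENNReal.one_lt_top⟩

end lintegralBall

section lowerBound

variable {X : Set ℝ} {f F : ℝ → ℝ} {μ : Measure ℝ} {Y : Set ℝ} {C κ : ℝ}

lemma cond_le_inv_mul (hY : MeasurableSet Y) (E : Set ℝ) :
    ProbabilityTheory.cond μ Y E ≤ (μ Y)⁻¹ * μ E := by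
  rw [ProbabilityTheory.cond_apply hY]
  gcongr
  exact inter_subset_right

lemma cond_cell_inter_preimage_hull_le {B : Set ℝ} [IsFiniteMeasure μ]
    [IsProbabilityMeasure (ProbabilityTheory.cond μ Y)] (hf : MeasurePreserving f μ μ)
    (hY : MeasurableSet Y) (hF : Measurable F) (hC : 0 ≤ C)
    (hdecay : CellDecay F (ProbabilityTheory.cond μ Y) C κ) (hB : MeasurableSet B)
    (ℓ : ℝ) (i : ℤ) (m : ℕ) :
    ProbabilityTheory.cond μ Y (cell ℓ 0 i ∩ F^[m] ⁻¹' hull f Y B) ≤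
      ((μ Y)⁻¹ * μ (cell ℓ 0 i) + ENNReal.ofReal (C * Real.exp (-κ * m))) *
        (μ B * (μ Y)⁻¹) := by
  have hYpos := measureReal_pos_of_isProbabilityMeasure_cond (μ := μ) (Y := Y)
  have real_le := cond_real_cell_inter_preimage_hull_le hf hY hF hC hdecay hB ℓ i m
  rw [measureReal_def, ← ENNReal.le_ofReal_iff_toReal_le (measure_ne_top _ _) (by positivity),
    ENNReal.ofReal_mul (by positivity), ENNReal.ofReal_add measureReal_nonneg (by positivity),
    ENNReal.ofReal_div_of_pos hYpos, ofReal_measureReal, ofReal_measureReal, ofReal_measureReal,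
    div_eq_mul_inv] at real_le
  refine real_le.trans ?_
  gcongr
  exact cond_le_inv_mul hY _

/-- The set on the left contains the points of `Y` whose `m`-th excursion comes `ℓ`-close to its
starting point. -/
lemma cond_setOf_iterate_mem_hull_cell_le [IsProbabilityMeasure μ]
    [IsProbabilityMeasure (ProbabilityTheory.cond μ Y)] (hf : MeasurePreserving f μ μ)
    (hY : MeasurableSet Y) (hF : Measurable F) (hC : 0 ≤ C)
    (hdecay : CellDecay F (ProbabilityTheory.cond μ Y) C κ) {ℓ : ℝ} (hℓ : 0 < ℓ) (m : ℕ) :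
    ProbabilityTheory.cond μ Y {x | F^[m] x ∈ hull f Y (cell ℓ 1 ⌊x / ℓ⌋)} ≤
      5 * ((μ Y)⁻¹ * (μ Y)⁻¹) * ∫⁻ x, μ (Metric.ball x ℓ) ∂μ +
        ENNReal.ofReal (C * Real.exp (-κ * m)) * (3 * (μ Y)⁻¹) := by
  set ν := ProbabilityTheory.cond μ Y
  set a : ENNReal := ENNReal.ofReal (C * Real.exp (-κ * m))
  set E : ℤ → Set ℝ := fun i => cell ℓ 0 i ∩ F^[m] ⁻¹' hull f Y (cell ℓ 1 i)
  calc ν {x | F^[m] x ∈ hull f Y (cell ℓ 1 ⌊x / ℓ⌋)} ≤ ν (⋃ i, E i) :=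
        measure_mono fun x hx => mem_iUnion.2 ⟨⌊x / ℓ⌋, mem_cell_floor hℓ 0 x, hx⟩
    _ ≤ ∑' i, ν (E i) := measure_iUnion_le _
    _ ≤ ∑' i, ((μ Y)⁻¹ * μ (cell ℓ 0 i) + a) * (μ (cell ℓ 1 i) * (μ Y)⁻¹) :=
        ENNReal.tsum_le_tsum fun i => cond_cell_inter_preimage_hull_le hf hY hF hC hdecay
          (measurableSet_cell ℓ 1 i) ℓ i m
    _ = ∑' i, (((μ Y)⁻¹ * (μ Y)⁻¹) * (μ (cell ℓ 0 i) * μ (cell ℓ 1 i)) +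
          (a * (μ Y)⁻¹) * μ (cell ℓ 1 i)) := by
        congr 1; ext i; ring
    _ = ((μ Y)⁻¹ * (μ Y)⁻¹) * ∑' i, μ (cell ℓ 0 i) * μ (cell ℓ 1 i) +
          (a * (μ Y)⁻¹) * ∑' i, μ (cell ℓ 1 i) := by
        rw [ENNReal.tsum_add, ENNReal.tsum_mul_left, ENNReal.tsum_mul_left]
    _ ≤ ((μ Y)⁻¹ * (μ Y)⁻¹) * (5 * ∫⁻ x, μ (Metric.ball x ℓ) ∂μ) +
          (a * (μ Y)⁻¹) * (3 * μ univ) := by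
        gcongr
        · exact tsum_measure_cell_mul_le hℓ
        · exact tsum_measure_cell_one_le hℓ
    _ = _ := by rw [measure_univ]; ring

lemma tsum_ofReal_mul_exp_lt_top (C : ℝ) (hκ : 0 < κ) :
    ∑' m : ℕ, ENNReal.ofReal (C * Real.exp (-κ * (m + 1 : ℕ))) < ⊤ := by
  have exp_summable : Summable fun m : ℕ => Real.exp (-κ * m) := by
    simpa only [mul_comm] using Real.summable_exp_nat_mul_iff.2 (neg_lt_zero.2 hκ)
  exact (((summable_nat_add_iff 1).2 exp_summable).mul_left C).tsum_ofReal_lt_top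

lemma ae_cond_eventually_iterate_notMem_hull_cell [IsProbabilityMeasure μ]
    [IsProbabilityMeasure (ProbabilityTheory.cond μ Y)] (hf : MeasurePreserving f μ μ)
    (hY : MeasurableSet Y) (hF : Measurable F) (hC : 0 ≤ C) (hκ : 0 < κ)
    (hdecay : CellDecay F (ProbabilityTheory.cond μ Y) C κ) {s : ℕ → ℝ} (hs : ∀ m, 0 < s m)
    (hsum : ∑' m, ∫⁻ x, μ (Metric.ball x (s m)) ∂μ < ⊤) :
    ∀ᵐ x ∂(ProbabilityTheory.cond μ Y), ∀ᶠ m : ℕ in atTop,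
      F^[m + 1] x ∉ hull f Y (cell (s m) 1 ⌊x / s m⌋) := by
  have hY_inv : (μ Y)⁻¹ ≠ ⊤ := ENNReal.inv_ne_top.2 fun h => by
    simpa [measureReal_def, h] using
      measureReal_pos_of_isProbabilityMeasure_cond (μ := μ) (Y := Y)
  refine ae_eventually_notMem (s := fun m => {x | F^[m + 1] x ∈ hull f Y (cell (s m) 1 ⌊x / s m⌋)})
    (ne_top_of_le_ne_top ?_ (ENNReal.tsum_le_tsum fun m =>
      cond_setOf_iterate_mem_hull_cell_le hf hY hF hC hdecay (hs m) (m + 1)))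
  rw [ENNReal.tsum_add, ENNReal.tsum_mul_left, ENNReal.tsum_mul_right]
  exact ENNReal.add_ne_top.2 ⟨ENNReal.mul_ne_top (ENNReal.mul_ne_top (by norm_num)
    (ENNReal.mul_ne_top hY_inv hY_inv)) hsum.ne,
    ENNReal.mul_ne_top (tsum_ofReal_mul_exp_lt_top C hκ).ne
      (ENNReal.mul_ne_top (by norm_num) hY_inv)⟩

/-- The distances `dist (f^[k] x) x` with `k` small have to be shown positive: if `x` were
periodic, it would return to itself at arbitrarily late times, which `hfar` forbids. -/
lemma eventually_lt_dist_iterate {r : ℕ → ℝ} (hr : ∀ δ > 0, ∀ᶠ n in atTop, r n < δ) {x : ℝ}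
    {n₀ : ℕ} (hfar : ∀ k, n₀ ≤ k → 0 < dist (f^[k] x) x) :
    ∀ᶠ n in atTop, ∀ k ∈ Finset.Icc 1 n₀, r n < dist (f^[k] x) x := by
  refine (eventually_all_finset _).2 fun k hk => hr _ (dist_pos.2 fun h_fixed => ?_)
  have returns_late : f^[k * (n₀ + 1)] x = x := by
    rw [Function.iterate_mul]
    exact Function.iterate_fixed h_fixed _
  have := hfar (k * (n₀ + 1)) (by nlinarith [(Finset.mem_Icc.1 hk).1])
  rw [returns_late, dist_self] at this
  exact this.false

lemma eventually_lt_recMin {r s : ℕ → ℝ} (hr : AntitoneOn r (Ici 1))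
    (hr_small : ∀ δ > 0, ∀ᶠ n in atTop, r n < δ) (hs : ∀ m, 0 < s m)
    (hrs : ∀ m, r (m + 1) ≤ s m) {x : ℝ} (hx : x ∈ Y)
    (hvisits : Tendsto (fun n => visits f Y n x) atTop atTop)
    (hhull : ∀ᶠ m : ℕ in atTop,
      (returnMap f Y)^[m + 1] x ∉ hull f Y (cell (s m) 1 ⌊x / s m⌋)) :
    ∀ᶠ n : ℕ in atTop, r n < recMin f n x := by
  obtain ⟨m₀, hm₀⟩ := eventually_atTop.1 hhull
  obtain ⟨n₀, hn₀⟩ := eventually_atTop.1 (hvisits.eventually_ge_atTop (m₀ + 1))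
  have far (k : ℕ) (hk : n₀ ≤ k) : ∃ m, m + 1 ≤ k ∧ s m < dist (f^[k] x) x := by
    have many_visits := hn₀ k hk
    obtain ⟨m, hm⟩ : ∃ m, visits f Y k x = m + 1 := ⟨visits f Y k x - 1, by omega⟩
    refine ⟨m, hm ▸ visits_le k x, ?_⟩
    by_contra! hle
    refine hm₀ m (by omega) ?_
    rw [← hm]
    exact iterate_returnMap_mem_hull hx (mem_cell_of_dist_le (hs m) (by simpa using hle))
  have early_times := eventually_lt_dist_iterate hr_small fun k hk => by
    obtain ⟨m, _, hm⟩ := far k hk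
    exact (hs m).trans hm
  filter_upwards [early_times, eventually_ge_atTop 1] with n hn hn_pos
  obtain ⟨k, hk, recMin_eq⟩ := exists_recMin_eq (f := f) hn_pos x
  rw [recMin_eq]
  rcases le_total k n₀ with h | h
  · exact hn k (Finset.mem_Icc.2 ⟨hk.1, h⟩)
  · obtain ⟨m, hmk, hm⟩ := far k h
    have r_le : r n ≤ r (m + 1) := hr (by simp) (by simpa using hn_pos) (hmk.trans hk.2)
    exact (r_le.trans (hrs m)).trans_lt hm

lemma eventually_lt_of_tsum_lintegral_measure_ball_lt_top [NeZero μ] {r : ℕ → ℝ}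
    (hr : AntitoneOn r (Ici 1)) (hsum : ∑' n : ℕ, ∫⁻ x, μ (Metric.ball x (r (n + 1))) ∂μ < ⊤)
    {δ : ℝ} (hδ : 0 < δ) : ∀ᶠ n in atTop, r n < δ := by
  have terms_tendsto := ENNReal.tendsto_atTop_zero_of_tsum_ne_top hsum.ne
  obtain ⟨k, hk⟩ :=
    (terms_tendsto.eventually (gt_mem_nhds (lintegral_measure_ball_pos (μ := μ) hδ))).exists
  have r_lt : r (k + 1) < δ := by
    by_contra! h
    exact absurd hk (not_lt.2 (lintegral_mono fun x => measure_mono (Metric.ball_subset_ball h)))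
  filter_upwards [eventually_ge_atTop (k + 1)] with n hn
  exact (hr (by simp) (by simp only [mem_Ici]; omega) hn).trans_lt r_lt

lemma tendsto_visits_atTop {x : ℝ} {p : ℝ} (hp : 0 < p)
    (h : Tendsto (fun n : ℕ => (visits f Y n x : ℝ) / n) atTop (𝓝 p)) :
    Tendsto (fun n => visits f Y n x) atTop atTop := by
  refine tendsto_natCast_atTop_iff.1
    ((h.pos_mul_atTop hp (tendsto_natCast_atTop_atTop (R := ℝ))).congr' ?_)
  filter_upwards [eventually_ne_atTop 0] with n hn
  exact div_mul_cancel₀ _ (by exact_mod_cast hn)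

theorem ae_eventually_lt_recMin (hsys : IsErgodicAcip X f μ)
    (hasym : AsymptoticallyHyperbolic X f μ) {r : ℕ → ℝ} (hr : AntitoneOn r (Ici 1))
    (hsum : ∑' n : ℕ, ∫⁻ x, μ (Metric.ball x (r (n + 1))) ∂μ < ⊤) :
    ∀ᵐ x ∂μ, ∀ᶠ n : ℕ in atTop, r n < recMin f n x := by
  have := hsys.isProbabilityMeasure
  have : NullSingletonClass μ := ⟨fun x => hsys.absolutelyContinuous (measure_singleton x)⟩
  obtain ⟨s, hs_pos, hrs, hs_sum⟩ := exists_pos_ge_tsum_lintegral_measure_ball_lt_top hsum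
  refine ae_of_forall_exists_measure_compl_le fun ε hε => ?_
  obtain ⟨Y, C, κ, S, β, hY, -, hYε, hprob, estimates⟩ := hasym.exists_recurrenceEstimates hsys hε
  have eventually_far := ae_cond_eventually_iterate_notMem_hull_cell
    hsys.ergodic.toMeasurePreserving hY estimates.measurePreserving.measurable
    estimates.C_pos.le estimates.κ_pos estimates.decay hs_pos hs_sum
  refine ⟨Y, hYε, ?_⟩
  filter_upwards [ae_mem_imp_of_ae_cond hY eventually_far,
    ae_tendsto_visits_div hsys.ergodic hY] with x hx_far hx_visits hx
  exact eventually_lt_recMin hr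
    (fun δ hδ => eventually_lt_of_tsum_lintegral_measure_ball_lt_top hr hsum hδ) hs_pos hrs hx
    (tendsto_visits_atTop measureReal_pos_of_isProbabilityMeasure_cond hx_visits) (hx_far hx)

end lowerBound

section geometric

variable {a : ℝ}

lemma half_pow_le_natFloor_pow (ha : 1 < a) (k : ℕ) : a ^ k / 2 ≤ (⌊a ^ k⌋₊ : ℝ) := by
  have one_le_floor : (1 : ℝ) ≤ ⌊a ^ k⌋₊ := by
    exact_mod_cast (Nat.one_le_floor_iff _).2 (one_le_pow₀ ha.le)
  linarith [Nat.lt_floor_add_one (a ^ k)]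

lemma tendsto_natFloor_pow (ha : 1 < a) : Tendsto (fun k : ℕ => ⌊a ^ k⌋₊) atTop atTop :=
  tendsto_nat_floor_atTop.comp (tendsto_pow_atTop_atTop_of_one_lt ha)

lemma summable_natFloor_pow_rpow_neg (ha : 1 < a) {b : ℝ} (hb : 0 < b) :
    Summable fun k : ℕ => (⌊a ^ k⌋₊ : ℝ) ^ (-b) := by
  have a_pos : 0 < a := by linarith
  have summable_bound : Summable fun k : ℕ => (2 : ℝ) ^ b * (a ^ (-b)) ^ k :=
    (summable_geometric_of_lt_one (by positivity)
      (Real.rpow_lt_one_of_one_lt_of_neg ha (by linarith))).mul_left _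
  refine summable_bound.of_nonneg_of_le (fun k => by positivity) fun k => ?_
  calc (⌊a ^ k⌋₊ : ℝ) ^ (-b) ≤ (a ^ k / 2) ^ (-b) :=
        Real.rpow_le_rpow_of_nonpos (by positivity) (half_pow_le_natFloor_pow ha k) (by linarith)
    _ = (2 : ℝ) ^ b * (a ^ (-b)) ^ k := by
        rw [Real.div_rpow (by positivity) zero_le_two, Real.rpow_neg zero_le_two, div_inv_eq_mul,
          mul_comm, Real.rpow_pow_comm a_pos.le]

lemma PolynomiallySmall.summable_natFloor_pow {e : ℕ → ℝ} (he : PolynomiallySmall e)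
    (ha : 1 < a) : Summable fun k : ℕ => e ⌊a ^ k⌋₊ := by
  obtain ⟨b, hb, heb⟩ := he
  exact summable_of_isBigO_nat (summable_natFloor_pow_rpow_neg ha hb)
    (heb.comp_tendsto (tendsto_natFloor_pow ha))

lemma eventually_exists_natFloor_pow_le (ha : 1 < a) (K : ℕ) : ∀ᶠ n : ℕ in atTop,
    ∃ k, K ≤ k ∧ ⌊a ^ k⌋₊ ≤ n ∧ (n : ℝ) ≤ a ^ 2 * ⌊a ^ k⌋₊ := by
  have : 0 < a := by linarith
  obtain ⟨K', hK'⟩ := eventually_atTop.1 ((tendsto_natCast_atTop_atTop.comp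
    (tendsto_natFloor_pow ha)).eventually_ge_atTop (1 / (a - 1)))
  filter_upwards [eventually_ge_atTop 1, tendsto_natCast_atTop_atTop.eventually_ge_atTop
    (a ^ (max K K'))] with n one_le_n pow_le_n
  obtain ⟨k, pow_le, lt_pow⟩ := exists_nat_pow_near (x := (n : ℝ)) (by exact_mod_cast one_le_n) ha
  have hk : max K K' ≤ k := by
    by_contra! h
    exact absurd (pow_le_n.trans_lt lt_pow) (not_lt.2 (pow_le_pow_right₀ ha.le h))
  refine ⟨k, (le_max_left _ _).trans hk, Nat.floor_le_of_le pow_le, ?_⟩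
  have one_le_mul_floor := hK' k ((le_max_right _ _).trans hk)
  rw [Function.comp_apply, div_le_iff₀ (by linarith)] at one_le_mul_floor
  calc (n : ℝ) ≤ a * a ^ k := by rw [← pow_succ']; exact lt_pow.le
    _ ≤ a * (a * ⌊a ^ k⌋₊) := by gcongr; linarith [Nat.lt_floor_add_one (a ^ k)]
    _ = _ := by ring

lemma eventually_recMin_lt_of_eventually_recMin_natFloor_pow_lt {f : ℝ → ℝ} {x : ℝ}
    {w r : ℕ → ℝ} (ha : 1 < a)
    (hwr : ∀ᶠ n : ℕ in atTop, ∀ n' : ℕ, n ≤ n' → (n' : ℝ) ≤ a ^ 2 * n → w n ≤ r n')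
    (h : ∀ᶠ k : ℕ in atTop, recMin f ⌊a ^ k⌋₊ x < w ⌊a ^ k⌋₊) :
    ∀ᶠ n : ℕ in atTop, recMin f n x < r n := by
  obtain ⟨K, hK⟩ := eventually_atTop.1 (h.and ((tendsto_natFloor_pow ha).eventually
    (hwr.and (eventually_ge_atTop 1))))
  filter_upwards [eventually_exists_natFloor_pow_le ha K] with n ⟨k, hk, floor_le, le_floor⟩
  obtain ⟨recMin_lt, w_le, one_le⟩ := hK k hk
  obtain ⟨j, hj, recMin_eq⟩ := exists_recMin_eq (f := f) one_le x
  calc recMin f n x ≤ recMin f ⌊a ^ k⌋₊ x := recMin_eq ▸ recMin_le ⟨hj.1, hj.2.trans floor_le⟩ x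
    _ < w ⌊a ^ k⌋₊ := recMin_lt
    _ ≤ r n := w_le n floor_le le_floor

end geometric

lemma ae_eventually_notMem_of_summable {α : Type*} [MeasurableSpace α] {ν : Measure α}
    [IsFiniteMeasure ν] {E : ℕ → Set α} {b : ℕ → ℝ} (hb : Summable b)
    (h : ∀ᶠ k in atTop, ν.real (E k) ≤ b k) : ∀ᵐ x ∂ν, ∀ᶠ k in atTop, x ∉ E k := by
  have summable_measure : Summable fun k => ν.real (E k) := by
    refine Summable.of_norm_bounded_eventually_nat hb ?_
    filter_upwards [h] with k hk
    rwa [Real.norm_of_nonneg measureReal_nonneg]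
  refine ae_eventually_notMem ?_
  simpa only [measureReal_def, ENNReal.ofReal_toReal (measure_ne_top ν _)] using
    summable_measure.tsum_ofReal_ne_top

section noReturn

variable {F : ℝ → ℝ} {ν : Measure ℝ} {C κ S β ℓ : ℝ}

/-- The points of the cells with index in `s` that do not return to the `q`-neighbourhood of
their cell at the times `p ≤ t < p + N`. -/
def noReturn (F : ℝ → ℝ) (ℓ : ℝ) (q p N : ℕ) (s : Finset ℤ) : Set ℝ :=
  {x | ⌊x / ℓ⌋ ∈ s ∧ ∀ t ∈ Finset.Ico p (p + N), F^[t] x ∉ cell ℓ q ⌊x / ℓ⌋}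

lemma exists_iterate_mem_cell_of_notMem_noReturn {q p N : ℕ} {s : Finset ℤ} {x : ℝ}
    (hs : ⌊x / ℓ⌋ ∈ s) (hx : x ∉ noReturn F ℓ q p N s) :
    ∃ t ∈ Finset.Ico p (p + N), F^[t] x ∈ cell ℓ q ⌊x / ℓ⌋ := by
  by_contra! h
  exact hx ⟨hs, h⟩

lemma survivalWeight_one_eq_indicator {α : Type*} (F : α → α) (J : Set α) (N : ℕ) :
    survivalWeight F J 1 N = (⋂ t ∈ Finset.range N, F^[t] ⁻¹' Jᶜ).indicator 1 := by
  ext y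
  by_cases h : ∀ t ∈ Finset.range N, F^[t] y ∉ J
  · rw [indicator_of_mem (mem_iInter₂.2 h), Pi.one_apply]
    exact Finset.prod_eq_one fun t ht => by rw [indicator_of_notMem (h t ht)]; ring
  · rw [indicator_of_notMem fun hy => h (mem_iInter₂.1 hy)]
    push Not at h
    obtain ⟨t, ht, hmem⟩ := h
    exact Finset.prod_eq_zero ht (by simp [hmem])

lemma measureReal_noReturn_le [IsFiniteMeasure ν] (hF : Measurable F) (hℓ : 0 < ℓ) (q p N : ℕ)
    (s : Finset ℤ) : ν.real (noReturn F ℓ q p N s) ≤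
      ∑ i ∈ s, ∫ x in cell ℓ 0 i, survivalWeight F (cell ℓ q i) 1 N (F^[p] x) ∂ν := by
  set avoids : ℤ → Set ℝ := fun i => ⋂ t ∈ Finset.range N, F^[t] ⁻¹' (cell ℓ q i)ᶜ
  have noReturn_subset : noReturn F ℓ q p N s ⊆ ⋃ i ∈ s, cell ℓ 0 i ∩ F^[p] ⁻¹' avoids i := by
    rintro x ⟨hs, hx⟩
    refine mem_iUnion₂.2 ⟨_, hs, mem_cell_floor hℓ 0 x, mem_iInter₂.2 fun t ht => ?_⟩
    rw [mem_preimage, ← Function.iterate_add_apply]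
    exact hx (t + p) (by rw [Finset.mem_range] at ht; rw [Finset.mem_Ico]; omega)
  refine (measureReal_mono noReturn_subset (measure_ne_top _ _)).trans
    ((measureReal_biUnion_finset_le _ _).trans_eq (Finset.sum_congr rfl fun i _ => ?_))
  rw [survivalWeight_one_eq_indicator, setIntegral_indicator_one_comp (hF.iterate p)]
  exact Finset.measurableSet_biInter _ fun t _ => hF.iterate t (measurableSet_cell ℓ q i).compl

lemma floor_div_mem_gridRange {n : ℕ} (hℓ : 0 < ℓ) {x : ℝ} (hx : |x| ≤ n) :
    ⌊x / ℓ⌋ ∈ gridRange ℓ n := by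
  rw [abs_le] at hx
  rw [gridRange, Finset.mem_Icc, ← Int.floor_neg, ← neg_div]
  refine ⟨Int.floor_mono ?_, (Int.floor_le_ceil _).trans (Int.ceil_mono ?_)⟩
  · gcongr; exact hx.1
  · gcongr; exact hx.2

/-- The cells meeting `[-n, n]` at least half of whose `ν`-mass lies in `A`. Almost every point
of `A` eventually lies in such a cell. -/
def denseCells (ν : Measure ℝ) (A : Set ℝ) (ℓ : ℝ) (n : ℕ) : Finset ℤ :=
  open Classical in
  {i ∈ gridRange ℓ n | ν.real (cell ℓ 0 i) ≤ 2 * ν.real (A ∩ cell ℓ 0 i)}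

lemma measureReal_mul_one_sub_pow_le_setIntegral_exp [IsProbabilityMeasure ν] {B J : Set ℝ}
    {N : ℕ} {g : ℝ → ℝ} (hB : MeasurableSet B) (hg : Integrable (fun x => Real.exp (-g x)) ν)
    (hgJ : ∀ x ∈ B, g x ≤ N * ν.real J) :
    ν.real B * (1 - ν.real J) ^ N ≤ ∫ x in B, Real.exp (-g x) ∂ν := by
  have pow_le_exp : (1 - ν.real J) ^ N ≤ Real.exp (-(N * ν.real J)) := by
    rw [← mul_neg, Real.exp_nat_mul]
    exact pow_le_pow_left₀ (sub_nonneg.2 measureReal_le_one) (Real.one_sub_le_exp_neg _) N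
  calc ν.real B * (1 - ν.real J) ^ N ≤ ν.real B * Real.exp (-(N * ν.real J)) := by gcongr
    _ = ∫ _ in B, Real.exp (-(N * ν.real J)) ∂ν := by rw [setIntegral_const, smul_eq_mul]
    _ ≤ ∫ x in B, Real.exp (-g x) ∂ν :=
        setIntegral_mono_on (integrable_const _).integrableOn hg.integrableOn hB fun x hx =>
          Real.exp_le_exp.2 (neg_le_neg (hgJ x hx))

lemma sum_denseCells_mul_one_sub_pow_le [IsProbabilityMeasure ν] (hℓ : 0 < ℓ) (q n N : ℕ)
    {A : Set ℝ} (hA : MeasurableSet A) {g : ℝ → ℝ}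
    (hg : Integrable (fun x => Real.exp (-g x)) ν)
    (hgA : ∀ x ∈ A, g x ≤ N * ν.real (cell ℓ q ⌊x / ℓ⌋)) :
    ∑ i ∈ denseCells ν A ℓ n, ν.real (cell ℓ 0 i) * (1 - ν.real (cell ℓ q i)) ^ N ≤
      2 * ∫ x, Real.exp (-g x) ∂ν := by
  have piece_measurable (i : ℤ) : MeasurableSet (A ∩ cell ℓ 0 i) :=
    hA.inter (measurableSet_cell ℓ 0 i)
  calc ∑ i ∈ denseCells ν A ℓ n, ν.real (cell ℓ 0 i) * (1 - ν.real (cell ℓ q i)) ^ N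
      ≤ ∑ i ∈ denseCells ν A ℓ n, 2 * ∫ x in A ∩ cell ℓ 0 i, Real.exp (-g x) ∂ν := by
        refine Finset.sum_le_sum fun i hi => ?_
        have pow_nonneg : 0 ≤ (1 - ν.real (cell ℓ q i)) ^ N :=
          pow_nonneg (sub_nonneg.2 measureReal_le_one) N
        refine (mul_le_mul_of_nonneg_right (Finset.mem_filter.1 hi).2 pow_nonneg).trans ?_
        rw [mul_assoc]
        gcongr
        refine measureReal_mul_one_sub_pow_le_setIntegral_exp (piece_measurable i) hg ?_
        rintro x ⟨hxA, hxi⟩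
        simpa only [(mem_cell_zero_iff hℓ).1 hxi] using hgA x hxA
    _ = 2 * ∫ x in ⋃ i ∈ denseCells ν A ℓ n, A ∩ cell ℓ 0 i, Real.exp (-g x) ∂ν := by
        rw [← Finset.mul_sum, integral_biUnion_finset _ (fun i _ => piece_measurable i)
          (fun i _ j _ hij => (pairwise_disjoint_cell_zero hℓ hij).mono inter_subset_right
            inter_subset_right) fun i _ => hg.integrableOn]
    _ ≤ _ := mul_le_mul_of_nonneg_left
        (setIntegral_le_integral hg (Eventually.of_forall fun x => (Real.exp_pos _).le))
        zero_le_two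

lemma RecurrenceEstimates.exists_measureReal_noReturn_denseCells_le [IsProbabilityMeasure ν]
    (estimates : RecurrenceEstimates F ν C κ S β) {ℓ : ℕ → ℝ} (hℓ : AdmissibleMesh ℓ) (q : ℕ)
    {N : ℕ → ℕ} (hN : (fun n => (N n : ℝ)) =O[atTop] fun n : ℕ => (n : ℝ)) :
    ∃ e : ℕ → ℝ, PolynomiallySmall e ∧ ∀ᶠ n in atTop, ∀ (A : Set ℝ) (g : ℝ → ℝ),
      MeasurableSet A → Integrable (fun x => Real.exp (-g x)) ν →
      (∀ x ∈ A, g x ≤ N n * ν.real (cell (ℓ n) q ⌊x / ℓ n⌋)) →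
      ν.real (noReturn F (ℓ n) q (gap n) (N n) (denseCells ν A (ℓ n) n)) ≤
        e n + 2 * ∫ x, Real.exp (-g x) ∂ν := by
  refine ⟨_, estimates.polynomiallySmall_sum_abs_setIntegral_survivalWeight_sub
    (right_mem_Icc.2 zero_le_one) q hℓ hN, ?_⟩
  filter_upwards [hℓ.eventually_pos] with n hpos A g hA hg hgA
  refine (measureReal_noReturn_le estimates.measurePreserving.measurable hpos q _ _ _).trans ?_
  refine le_trans ?_ (add_le_add_right (sum_denseCells_mul_one_sub_pow_le hpos q n _ hA hg hgA) _)
  rw [← sub_le_iff_le_add, ← Finset.sum_sub_distrib]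
  simp only [one_mul]
  exact (Finset.sum_le_sum fun i _ => le_abs_self _).trans
    (Finset.sum_le_sum_of_subset_of_nonneg (Finset.filter_subset _ _) fun _ _ _ => abs_nonneg _)

end noReturn

lemma admissibleMesh_div {w : ℕ → ℝ} {D : ℝ} (hw : ∀ᶠ n : ℕ in atTop, ((n : ℝ) ^ 2)⁻¹ ≤ w n)
    (hwD : ∀ᶠ n : ℕ in atTop, n * w n ≤ Real.log n ^ D) {c : ℝ} (hc : 1 ≤ c) :
    AdmissibleMesh fun n => w n / c := by
  have c_pos : 0 < c := by linarith
  refine ⟨D, ?_⟩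
  filter_upwards [hw, hwD, eventually_gt_atTop 0,
    tendsto_natCast_atTop_atTop.eventually_ge_atTop c] with n hw hwD hn hcn
  have : (0 : ℝ) < n := by exact_mod_cast hn
  have w_pos : 0 < w n := lt_of_lt_of_le (by positivity) hw
  constructor
  · rw [le_div_iff₀ c_pos]
    calc ((n : ℝ) ^ 3)⁻¹ * c ≤ ((n : ℝ) ^ 3)⁻¹ * n := by gcongr
      _ = ((n : ℝ) ^ 2)⁻¹ := by field_simp
      _ ≤ w n := hw
  · refine le_trans ?_ hwD
    gcongr
    exact div_le_self w_pos.le hc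

lemma tendsto_gap_div : Tendsto (fun n : ℕ => (gap n : ℝ) / n) atTop (𝓝 0) := by
  have gap_isLittleO := gap_isBigO.trans_isLittleO (log_rpow_isLittleO_rpow 2 one_pos)
  simpa only [Real.rpow_one] using gap_isLittleO.tendsto_div_nhds_zero

lemma tendsto_natFloor_mul_div {c : ℝ} (hc : 0 ≤ c) :
    Tendsto (fun n : ℕ => (⌊c * n⌋₊ : ℝ) / n) atTop (𝓝 c) :=
  (tendsto_nat_floor_mul_div_atTop hc).comp tendsto_natCast_atTop_atTop

section hitting

variable {X Y A : Set ℝ} {f : ℝ → ℝ} {μ : Measure ℝ} {ρ : ℝ → ℝ} {C κ S β c a : ℝ}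
  {ℓ : ℕ → ℝ} {N : ℕ → ℕ}

lemma recMin_lt_of_notMem_noReturn {ℓ : ℝ} (hℓ : 0 < ℓ) {q p N n : ℕ} {s : Finset ℤ} {x : ℝ}
    (hxY : x ∈ Y) (hs : ⌊x / ℓ⌋ ∈ s) (hx : x ∉ noReturn (returnMap f Y) ℓ q p N s)
    (hp : 1 ≤ p) (hn : p + N ≤ visits f Y n x) : recMin f n x < (q + 1) * ℓ := by
  obtain ⟨t, ht, ht_mem⟩ := exists_iterate_mem_cell_of_notMem_noReturn hs hx
  rw [Finset.mem_Ico] at ht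
  obtain ⟨j, hj, iterate_eq⟩ :=
    exists_iterate_eq_iterate_returnMap (f := f) hxY (hp.trans ht.1) (ht.2.le.trans hn)
  exact (recMin_le hj x).trans_lt (iterate_eq ▸ dist_lt_of_mem_cell hℓ ht_mem)

lemma ae_tendsto_mul_cond_cell (hsys : IsErgodicAcip X f μ) (hρ : IsDensity X μ ρ)
    (hY : MeasurableSet Y) (hYX : Y ⊆ X) (hY_pos : 0 < μ.real Y) (hℓ : AdmissibleMesh ℓ) (q : ℕ)
    (hN : Tendsto (fun n : ℕ => (N n : ℝ) / n) atTop (𝓝 (c * μ.real Y))) :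
    ∀ᵐ x ∂μ, x ∈ Y → Tendsto (fun n : ℕ =>
      N n * (ProbabilityTheory.cond μ Y).real (cell (ℓ n) q ⌊x / ℓ n⌋) / (n * ℓ n)) atTop
        (𝓝 (c * (2 * q + 1) * ρ x)) := by
  have := hsys.isProbabilityMeasure
  filter_upwards [hsys.absolutelyContinuous.ae_le (hρ.ae_tendsto_cell hsys.measurableSet hY)]
    with x hx hxY
  have limit := hN.mul ((hx q ℓ hℓ.tendsto_zero).const_mul ((2 * q + 1) / μ.real Y))
  rw [indicator_of_mem (mem_inter hxY (hYX hxY)), mul_assoc, ← mul_assoc (μ.real Y),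
    mul_div_cancel₀ _ hY_pos.ne', ← mul_assoc] at limit
  refine limit.congr' ?_
  filter_upwards [eventually_gt_atTop 0, hℓ.eventually_pos] with n hn hℓ_pos
  rw [cond_real_eq_div hY]
  field_simp

lemma ae_eventually_floor_div_mem_denseCells (hsys : IsErgodicAcip X f μ)
    (hρ : IsDensity X μ ρ) (hY : MeasurableSet Y) (hYX : Y ⊆ X) (hA : MeasurableSet A)
    (hAY : A ⊆ Y) (hℓ : AdmissibleMesh ℓ) : ∀ᵐ x ∂μ, x ∈ A →
      ∀ᶠ n in atTop, ⌊x / ℓ n⌋ ∈ denseCells (ProbabilityTheory.cond μ Y) A (ℓ n) n := by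
  have := hsys.isProbabilityMeasure
  filter_upwards [hsys.absolutelyContinuous.ae_le (hρ.ae_tendsto_cell hsys.measurableSet hA),
    hsys.absolutelyContinuous.ae_le (hρ.ae_tendsto_cell hsys.measurableSet hY), hρ.ae_pos]
    with x density_A density_Y hρx hxA
  replace density_A := density_A 0 ℓ hℓ.tendsto_zero
  replace density_Y := density_Y 0 ℓ hℓ.tendsto_zero
  rw [indicator_of_mem (mem_inter hxA (hYX (hAY hxA)))] at density_A
  rw [indicator_of_mem (mem_inter (hAY hxA) (hYX (hAY hxA)))] at density_Y
  filter_upwards [density_Y.eventually_lt (density_A.const_mul 2) (by linarith),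
    hℓ.eventually_pos, tendsto_natCast_atTop_atTop.eventually_ge_atTop |x|] with n hn hℓ_pos hxn
  refine Finset.mem_filter.2 ⟨floor_div_mem_gridRange hℓ_pos hxn, ?_⟩
  rw [cond_real_eq_div hY, cond_real_eq_div hY, ← inter_assoc, inter_eq_right.2 hAY,
    ← mul_div_assoc]
  refine div_le_div_of_nonneg_right ?_ measureReal_nonneg
  have cell_length_pos : (0 : ℝ) < (2 * (0 : ℕ) + 1) * ℓ n := by positivity
  rw [div_lt_iff₀ cell_length_pos, mul_assoc, div_mul_cancel₀ _ cell_length_pos.ne'] at hn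
  exact hn.le

lemma ae_eventually_gap_add_le_visits {α : Type*} [MeasurableSpace α] {μ : Measure α} {f : α → α}
    {Y : Set α} [IsProbabilityMeasure μ] (hf : Ergodic f μ)
    (hY : MeasurableSet Y) (hY_pos : 0 < μ.real Y) (hc : c < 1)
    (hN : Tendsto (fun n : ℕ => (N n : ℝ) / n) atTop (𝓝 (c * μ.real Y))) :
    ∀ᵐ x ∂μ, ∀ᶠ n in atTop, gap n + N n ≤ visits f Y n x := by
  filter_upwards [ae_tendsto_visits_div hf hY] with x hx
  have limit := tendsto_gap_div.add hN
  filter_upwards [limit.eventually_lt hx (by nlinarith), eventually_gt_atTop 0] with n hn hn_pos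
  rw [← add_div, div_lt_div_iff_of_pos_right (by exact_mod_cast hn_pos)] at hn
  exact_mod_cast hn.le

lemma integral_cond_le {α : Type*} [MeasurableSpace α] {μ : Measure α} {Y : Set α} {g : α → ℝ}
    (hg : Integrable g μ) (hg_nonneg : ∀ x, 0 ≤ g x) :
    ∫ x, g x ∂(ProbabilityTheory.cond μ Y) ≤ (μ.real Y)⁻¹ * ∫ x, g x ∂μ := by
  rw [ProbabilityTheory.cond, integral_smul_measure, ENNReal.toReal_inv, smul_eq_mul]
  exact mul_le_mul_of_nonneg_left
    (setIntegral_le_integral hg (Eventually.of_forall hg_nonneg)) (by positivity)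

lemma integrable_cond {α : Type*} [MeasurableSpace α] {μ : Measure α} {Y : Set α} {g : α → ℝ}
    (hY : μ Y ≠ 0) (hg : Integrable g μ) : Integrable g (ProbabilityTheory.cond μ Y) :=
  hg.restrict.smul_measure (ENNReal.inv_ne_top.2 hY)

lemma ae_eventually_recMin_natFloor_pow_lt_of_mem (hsys : IsErgodicAcip X f μ)
    (hρ : IsDensity X μ ρ) (hY : MeasurableSet Y) (hYX : Y ⊆ X)
    [IsProbabilityMeasure (ProbabilityTheory.cond μ Y)]
    (estimates : RecurrenceEstimates (returnMap f Y) (ProbabilityTheory.cond μ Y) C κ S β)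
    (hℓ : AdmissibleMesh ℓ) (q : ℕ) (hc : c < 1)
    (hN : Tendsto (fun n : ℕ => (N n : ℝ) / n) atTop (𝓝 (c * μ.real Y))) (ha : 1 < a)
    (hA : MeasurableSet A) (hAY : A ⊆ Y) {g : ℕ → ℝ → ℝ}
    (hg : ∀ᶠ n in atTop, Integrable (fun x => Real.exp (-g n x)) μ)
    (hg_sum : Summable fun k : ℕ => ∫ x, Real.exp (-g ⌊a ^ k⌋₊ x) ∂μ)
    (hgA : ∀ᶠ k in atTop, ∀ x ∈ A, g ⌊a ^ k⌋₊ x ≤ N ⌊a ^ k⌋₊ *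
      (ProbabilityTheory.cond μ Y).real (cell (ℓ ⌊a ^ k⌋₊) q ⌊x / ℓ ⌊a ^ k⌋₊⌋)) :
    ∀ᵐ x ∂μ, x ∈ A → ∀ᶠ k in atTop, recMin f ⌊a ^ k⌋₊ x < (q + 1) * ℓ ⌊a ^ k⌋₊ := by
  have := hsys.isProbabilityMeasure
  have Y_pos : 0 < μ.real Y := measureReal_pos_of_isProbabilityMeasure_cond
  have N_isBigO : (fun n => (N n : ℝ)) =O[atTop] fun n : ℕ => (n : ℝ) :=
    isBigO_of_div_tendsto_nhds (by
      filter_upwards [eventually_gt_atTop 0] with n hn hn_zero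
      exact absurd (Nat.cast_eq_zero.1 hn_zero) hn.ne') _ hN
  obtain ⟨e, e_small, noReturn_le⟩ :=
    estimates.exists_measureReal_noReturn_denseCells_le hℓ q N_isBigO
  have subsequence := tendsto_natFloor_pow ha
  have eventually_notMem_noReturn := ae_eventually_notMem_of_summable
    ((e_small.summable_natFloor_pow ha).add ((hg_sum.mul_left (μ.real Y)⁻¹).mul_left 2)) (by
      filter_upwards [subsequence.eventually noReturn_le, subsequence.eventually hg, hgA]
        with k hk hg hgA
      refine (hk A _ hA (integrable_cond ((measureReal_ne_zero_iff).1 Y_pos.ne') hg) hgA).trans ?_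
      gcongr
      exact integral_cond_le hg fun x => (Real.exp_pos _).le)
  filter_upwards [ae_mem_imp_of_ae_cond hY eventually_notMem_noReturn,
    ae_eventually_floor_div_mem_denseCells hsys hρ hY hYX hA hAY hℓ,
    ae_eventually_gap_add_le_visits hsys.ergodic hY Y_pos hc hN] with x hx dense visits_ge hxA
  filter_upwards [hx (hAY hxA), subsequence.eventually (dense hxA),
    subsequence.eventually visits_ge, subsequence.eventually eventually_one_le_gap,
    subsequence.eventually hℓ.eventually_pos] with k hk dense visits_ge gap_ge hℓ_pos
  exact recMin_lt_of_notMem_noReturn hℓ_pos (hAY hxA) dense hk gap_ge visits_ge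

lemma ae_eventually_recMin_natFloor_pow_lt (hsys : IsErgodicAcip X f μ)
    (hρ : IsDensity X μ ρ) (hY : MeasurableSet Y) (hYX : Y ⊆ X)
    [IsProbabilityMeasure (ProbabilityTheory.cond μ Y)]
    (estimates : RecurrenceEstimates (returnMap f Y) (ProbabilityTheory.cond μ Y) C κ S β)
    (hℓ : AdmissibleMesh ℓ) (q : ℕ) (hc : c < 1)
    (hN : Tendsto (fun n : ℕ => (N n : ℝ) / n) atTop (𝓝 (c * μ.real Y))) (ha : 1 < a)
    {g : ℕ → ℝ → ℝ} (hg_meas : ∀ n, AEMeasurable (g n) μ)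
    (hg : ∀ᶠ n in atTop, Integrable (fun x => Real.exp (-g n x)) μ)
    (hg_sum : Summable fun k : ℕ => ∫ x, Real.exp (-g ⌊a ^ k⌋₊ x) ∂μ)
    (hg_le : ∀ᵐ x ∂μ, x ∈ Y → ∀ᶠ n in atTop,
      g n x ≤ N n * (ProbabilityTheory.cond μ Y).real (cell (ℓ n) q ⌊x / ℓ n⌋)) :
    ∀ᵐ x ∂μ, x ∈ Y → ∀ᶠ k in atTop, recMin f ⌊a ^ k⌋₊ x < (q + 1) * ℓ ⌊a ^ k⌋₊ := by
  set g' : ℕ → ℝ → ℝ := fun n => (hg_meas n).mk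
  have g_ae_eq (n : ℕ) : (fun x => Real.exp (-g n x)) =ᵐ[μ] fun x => Real.exp (-g' n x) :=
    (hg_meas n).ae_eq_mk.fun_comp fun y => Real.exp (-y)
  set bound : ℕ → ℝ → ℝ := fun n x =>
    N n * (ProbabilityTheory.cond μ Y).real (cell (ℓ n) q ⌊x / ℓ n⌋)
  have bound_measurable (n : ℕ) : Measurable (bound n) :=
    (measurable_comp_floor_div (ℓ n)
      fun i => (ProbabilityTheory.cond μ Y).real (cell (ℓ n) q i)).const_mul _
  set A : ℕ → Set ℝ := fun K => Y ∩ ⋂ k ≥ K, {x | g' ⌊a ^ k⌋₊ x ≤ bound ⌊a ^ k⌋₊ x}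
  have A_measurable (K : ℕ) : MeasurableSet (A K) :=
    hY.inter (MeasurableSet.iInter fun k => MeasurableSet.iInter fun _ =>
      measurableSet_le (hg_meas _).measurable_mk (bound_measurable _))
  have hits_on_A (K : ℕ) := ae_eventually_recMin_natFloor_pow_lt_of_mem hsys hρ hY hYX estimates
    hℓ q hc hN ha (A_measurable K) inter_subset_left (hg.mono fun n hn => hn.congr (g_ae_eq n))
    (hg_sum.congr fun k => integral_congr_ae (g_ae_eq _))
    ((eventually_ge_atTop K).mono fun k hk x hx => mem_iInter₂.1 hx.2 k hk)
  filter_upwards [hg_le, ae_all_iff.2 hits_on_A, ae_all_iff.2 fun n => (hg_meas n).ae_eq_mk]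
    with x hx hits g_eq hxY
  obtain ⟨K, hK⟩ := eventually_atTop.1 ((tendsto_natFloor_pow ha).eventually (hx hxY))
  exact hits K ⟨hxY, mem_iInter₂.2 fun k hk => (g_eq _).symm.trans_le (hK k hk)⟩

lemma integrable_exp_neg {α : Type*} [MeasurableSpace α] {μ : Measure α} [IsFiniteMeasure μ]
    {g : α → ℝ} (hg : AEMeasurable g μ) (hg_nonneg : 0 ≤ᵐ[μ] g) :
    Integrable (fun x => Real.exp (-g x)) μ :=
  Integrable.of_bound (Real.measurable_exp.comp_aemeasurable hg.neg).aestronglyMeasurable 1 <| by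
    filter_upwards [hg_nonneg] with x hx
    rw [Real.norm_of_nonneg (Real.exp_pos _).le, Real.exp_le_one_iff]
    exact neg_nonpos.2 hx

lemma IsDensity.aemeasurable_self (hρ : IsDensity X μ ρ) : AEMeasurable ρ μ :=
  hρ.aemeasurable.mono_ac (hρ.eq_withDensity ▸ withDensity_absolutelyContinuous _ _)

lemma IsDensity.integrable_exp_neg_mul [IsFiniteMeasure μ] (hρ : IsDensity X μ ρ) {b : ℝ}
    (hb : 0 ≤ b) : Integrable (fun x => Real.exp (-(b * ρ x))) μ :=
  integrable_exp_neg (hρ.aemeasurable_self.const_mul b) <| by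
    filter_upwards [hρ.ae_pos] with x hx
    exact mul_nonneg hb hx.le

theorem ae_eventually_recMin_lt (hsys : IsErgodicAcip X f μ) (hρ : IsDensity X μ ρ)
    (hasym : AsymptoticallyHyperbolic X f μ) {w r : ℕ → ℝ} {D δ a : ℝ}
    (hw : ∀ᶠ n : ℕ in atTop, ((n : ℝ) ^ 2)⁻¹ ≤ w n)
    (hwD : ∀ᶠ n : ℕ in atTop, n * w n ≤ Real.log n ^ D) (ha : 1 < a) (hδ : δ ∈ Ioo 0 1)
    (hwr : ∀ᶠ n : ℕ in atTop, ∀ n' : ℕ, n ≤ n' → (n' : ℝ) ≤ a ^ 2 * n → w n ≤ r n')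
    (hsum : Summable fun k : ℕ =>
      ∫ x, Real.exp (-((1 - δ) * 2 * ⌊a ^ k⌋₊ * w ⌊a ^ k⌋₊ * ρ x)) ∂μ) :
    ∀ᵐ x ∂μ, ∀ᶠ n : ℕ in atTop, recMin f n x < r n := by
  have := hsys.isProbabilityMeasure
  obtain ⟨hδ_pos, hδ_lt⟩ := hδ
  refine ae_of_forall_exists_measure_compl_le fun ε hε => ?_
  obtain ⟨Y, C, κ, S, β, hY, hYX, hYε, _, estimates⟩ := hasym.exists_recurrenceEstimates hsys hε
  refine ⟨Y, hYε, ?_⟩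
  have Y_pos : 0 < μ.real Y := measureReal_pos_of_isProbabilityMeasure_cond
  obtain ⟨q, hq⟩ := exists_nat_one_div_lt hδ_pos
  rw [div_lt_iff₀ (by positivity)] at hq
  have hℓ := admissibleMesh_div hw hwD (c := q + 1) (by linarith [q.cast_nonneg (α := ℝ)])
  have hN := tendsto_natFloor_mul_div (c := (1 - δ / 2) * μ.real Y)
    (mul_nonneg (by linarith) Y_pos.le)
  have hits := ae_eventually_recMin_natFloor_pow_lt hsys hρ hY hYX estimates hℓ q (by linarith) hN
    ha (g := fun n x => (1 - δ) * 2 * n * w n * ρ x)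
    (fun n => hρ.aemeasurable_self.const_mul _) (by
      filter_upwards [hw] with n hn
      have : 0 ≤ w n := le_trans (by positivity) hn
      exact hρ.integrable_exp_neg_mul (by have := sub_pos.2 hδ_lt; positivity)) hsum (by
      filter_upwards [ae_tendsto_mul_cond_cell hsys hρ hY hYX Y_pos hℓ q hN, hρ.ae_pos]
        with x hx hρx hxY
      have rate_lt : (1 - δ) * 2 * (q + 1) * ρ x < (1 - δ / 2) * (2 * q + 1) * ρ x :=
        mul_lt_mul_of_pos_right (by nlinarith) hρx
      filter_upwards [(hx hxY).eventually (lt_mem_nhds rate_lt), eventually_gt_atTop 0,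
        hℓ.eventually_pos] with n hn hn_pos hℓ_pos
      rw [lt_div_iff₀ (by positivity)] at hn
      refine le_of_eq_of_le ?_ hn.le
      field_simp)
  filter_upwards [hits] with x hx hxY
  refine eventually_recMin_lt_of_eventually_recMin_natFloor_pow_lt ha hwr ?_
  filter_upwards [hx hxY] with k hk
  rwa [mul_div_cancel₀ _ (by positivity)] at hk

end hitting

section rates

variable {X : Set ℝ} {f : ℝ → ℝ} {μ : Measure ℝ} {ρ : ℝ → ℝ} {a : ℝ}

theorem ae_eventually_recMin_lt_of_div_lt (hsys : IsErgodicAcip X f μ) (hρ : IsDensity X μ ρ)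
    (hasym : AsymptoticallyHyperbolic X f μ) {L r : ℕ → ℝ} {D : ℝ} {m : ℕ}
    (hL_top : Tendsto L atTop atTop) (hL_mono : MonotoneOn L (Ici m))
    (hL_le : ∀ᶠ n : ℕ in atTop, L n ≤ Real.log n ^ D)
    (hr : ∀ᶠ n : ℕ in atTop, L n / n < r n) (ha : 1 < a)
    (hsum : Summable fun k : ℕ => ∫ x, Real.exp (-(2 / a ^ 4 * L ⌊a ^ k⌋₊ * ρ x)) ∂μ) :
    ∀ᵐ x ∂μ, ∀ᶠ n : ℕ in atTop, recMin f n x < r n := by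
  have : 0 < a := by linarith
  have one_lt_sq : 1 < a ^ 2 := one_lt_pow₀ ha two_ne_zero
  refine ae_eventually_recMin_lt hsys hρ hasym (w := fun n => L n / (a ^ 2 * n)) (D := D)
    (δ := 1 - (a ^ 2)⁻¹) ?_ ?_ ha
    ⟨sub_pos.2 (inv_lt_one_of_one_lt₀ one_lt_sq), sub_lt_self _ (by positivity)⟩ ?_ ?_
  · filter_upwards [hL_top.eventually_ge_atTop (a ^ 2), eventually_ge_atTop 1] with n hn hn_one
    have one_le : (1 : ℝ) ≤ n := by exact_mod_cast hn_one
    rw [inv_eq_one_div, div_le_div_iff₀ (by positivity) (by positivity)]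
    nlinarith [mul_nonneg (sq_nonneg a) (Nat.cast_nonneg (α := ℝ) n)]
  · filter_upwards [hL_le, hL_top.eventually_ge_atTop 0, eventually_gt_atTop 0]
      with n hn hn_nonneg hn_pos
    have : (0 : ℝ) < n := by exact_mod_cast hn_pos
    calc n * (L n / (a ^ 2 * n)) = L n / a ^ 2 := by field_simp
      _ ≤ L n := div_le_self hn_nonneg one_lt_sq.le
      _ ≤ _ := hn
  · filter_upwards [eventually_forall_ge_atTop.2 hr, eventually_ge_atTop m,
      hL_top.eventually_ge_atTop 0, eventually_gt_atTop 0] with n hr hm hn_nonneg hn_pos n' hnn' hn'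
    have : (0 : ℝ) < n := by exact_mod_cast hn_pos
    have n'_pos : (0 : ℝ) < n' := by exact_mod_cast hn_pos.trans_le hnn'
    calc L n / (a ^ 2 * n) ≤ L n / n' := by gcongr
      _ ≤ L n' / n' := by gcongr; exact hL_mono hm (hm.trans hnn') hnn'
      _ ≤ r n' := (hr n' hnn').le
  · refine hsum.congr_atTop ?_
    filter_upwards [(tendsto_natFloor_pow ha).eventually_gt_atTop 0] with k hk
    have : (0 : ℝ) < ⌊a ^ k⌋₊ := by exact_mod_cast hk
    refine integral_congr_ae (Eventually.of_forall fun x => ?_)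
    dsimp only
    congr 3
    field_simp
    ring

lemma exists_mul_le_log_natFloor_pow (ha : 1 < a) :
    ∃ c : ℝ, 0 < c ∧ ∀ᶠ k : ℕ in atTop, c * (k + 1) ≤ Real.log ⌊a ^ k⌋₊ := by
  have log_pos := Real.log_pos ha
  refine ⟨Real.log a / 2, by positivity, ?_⟩
  filter_upwards [tendsto_natCast_atTop_atTop.eventually_ge_atTop
    (2 * Real.log 2 / Real.log a + 1)] with k hk
  rw [← le_sub_iff_add_le, div_le_iff₀ log_pos] at hk
  have log_floor := Real.log_le_log (by positivity) (half_pow_le_natFloor_pow ha k)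
  rw [Real.log_div (by positivity) (by norm_num), Real.log_pow] at log_floor
  linarith

lemma summable_log_natFloor_pow_rpow_neg (ha : 1 < a) {s : ℝ} (hs : 1 < s) :
    Summable fun k : ℕ => Real.log ⌊a ^ k⌋₊ ^ (-s) := by
  obtain ⟨c, hc, le_log⟩ := exists_mul_le_log_natFloor_pow ha
  have summable_bound : Summable fun k : ℕ => c ^ (-s) * ((k + 1 : ℕ) : ℝ) ^ (-s) :=
    ((summable_nat_add_iff 1).2 (Real.summable_nat_rpow.2 (neg_lt_neg hs))).mul_left _
  refine Summable.of_norm_bounded_eventually_nat summable_bound ?_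
  filter_upwards [le_log] with k hk
  rw [Real.norm_of_nonneg (Real.rpow_nonneg (Real.log_natCast_nonneg _) _),
    ← Real.mul_rpow hc.le (Nat.cast_nonneg _), Nat.cast_succ]
  exact Real.rpow_le_rpow_of_nonpos (by positivity) hk (by linarith)

lemma IsErgodicAcip.measure_setOf_mem_eq_one (hsys : IsErgodicAcip X f μ) {P : ℝ → Prop}
    (h : ∀ᵐ x ∂μ, P x) : μ {x ∈ X | P x} = 1 := by
  have := hsys.isProbabilityMeasure
  have ae_mem : ∀ᵐ x ∂μ, x ∈ X := hsys.measure_compl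
  rw [← measure_univ (μ := μ), measure_congr]
  filter_upwards [ae_mem, h] with x hx hPx
  exact propext (iff_of_true ⟨hx, hPx⟩ (mem_univ x))

lemma IsErgodicAcip.ae_sInf_image_le (hsys : IsErgodicAcip X f μ) (hρ : IsDensity X μ ρ) :
    ∀ᵐ x ∂μ, sInf (ρ '' X) ≤ ρ x := by
  have ae_mem : ∀ᵐ x ∂μ, x ∈ X := hsys.measure_compl
  filter_upwards [ae_mem] with x hx
  exact csInf_le ⟨0, forall_mem_image.2 hρ.nonneg⟩ (mem_image_of_mem ρ hx)

lemma IsDensity.integral_exp_neg_mul_le [IsProbabilityMeasure μ] (hρ : IsDensity X μ ρ)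
    {b I : ℝ} (hb : 0 ≤ b) (hI : ∀ᵐ x ∂μ, I ≤ ρ x) :
    ∫ x, Real.exp (-(b * ρ x)) ∂μ ≤ Real.exp (-(b * I)) := by
  calc ∫ x, Real.exp (-(b * ρ x)) ∂μ ≤ ∫ _, Real.exp (-(b * I)) ∂μ := by
        refine integral_mono_ae (hρ.integrable_exp_neg_mul hb) (integrable_const _) ?_
        filter_upwards [hI] with x hx
        exact Real.exp_le_exp.2 (neg_le_neg (mul_le_mul_of_nonneg_left hx hb))
    _ = Real.exp (-(b * I)) := by simp

lemma monotoneOn_log_log_natCast : MonotoneOn (fun n : ℕ => Real.log (Real.log n)) (Ici 2) := by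
  intro m hm n _ hmn
  have one_lt : (1 : ℝ) < m := by exact_mod_cast mem_Ici.1 hm
  exact Real.log_le_log (Real.log_pos one_lt)
    (Real.log_le_log (by linarith) (by exact_mod_cast hmn))

theorem ae_eventually_recMin_lt_of_lt_sInf (hsys : IsErgodicAcip X f μ) (hρ : IsDensity X μ ρ)
    (hasym : AsymptoticallyHyperbolic X f μ) {r : ℕ → ℝ} {c : ℝ}
    (hc : 1 < 2 * c * sInf (ρ '' X))
    (hr : ∀ᶠ n : ℕ in atTop, c * Real.log (Real.log n) / n < r n) :
    ∀ᵐ x ∂μ, ∀ᶠ n : ℕ in atTop, recMin f n x < r n := by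
  have := hsys.isProbabilityMeasure
  obtain ⟨I, hI⟩ : ∃ I, I = sInf (ρ '' X) := ⟨_, rfl⟩
  rw [← hI] at hc
  have I_nonneg : 0 ≤ I := hI ▸ Real.sInf_nonneg (forall_mem_image.2 hρ.nonneg)
  have c_pos : 0 < c := by
    by_contra! h
    linarith [mul_nonpos_of_nonpos_of_nonneg h I_nonneg]
  obtain ⟨a, pow_lt, ha⟩ : ∃ a : ℝ, a ^ 4 < 2 * c * I ∧ 1 < a :=
    (((((continuous_pow 4).tendsto' (1 : ℝ) 1 (one_pow 4)).mono_left nhdsWithin_le_nhds).eventually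
      (gt_mem_nhds hc)).and (self_mem_nhdsWithin (s := Ioi 1))).exists
  have one_lt : 1 < 2 * c * I / a ^ 4 := (one_lt_div (by positivity)).2 pow_lt
  have log_log_tendsto : Tendsto (fun n : ℕ => Real.log (Real.log n)) atTop atTop :=
    Real.tendsto_log_atTop.comp tendsto_log_natCast
  refine ae_eventually_recMin_lt_of_div_lt hsys hρ hasym (D := 2) (m := 2)
    (log_log_tendsto.const_mul_atTop c_pos)
    (fun m hm n hn hmn =>
      mul_le_mul_of_nonneg_left (monotoneOn_log_log_natCast hm hn hmn) c_pos.le)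
    ?_ hr ha ?_
  · filter_upwards [tendsto_log_natCast.eventually_ge_atTop c] with n hn
    have log_nonneg := Real.log_natCast_nonneg n
    calc c * Real.log (Real.log n) ≤ c * Real.log n :=
          mul_le_mul_of_nonneg_left (Real.log_le_self log_nonneg) c_pos.le
      _ ≤ Real.log n * Real.log n := by gcongr
      _ = Real.log n ^ (2 : ℝ) := by rw [Real.rpow_two, sq]
  · refine Summable.of_norm_bounded_eventually_nat (summable_log_natFloor_pow_rpow_neg ha one_lt) ?_
    filter_upwards [(tendsto_natFloor_pow ha).eventually
      (tendsto_log_natCast.eventually_gt_atTop 0), (tendsto_natFloor_pow ha).eventually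
      (log_log_tendsto.eventually_ge_atTop 0)] with k log_pos log_log_nonneg
    rw [Real.norm_of_nonneg (integral_nonneg fun x => (Real.exp_pos _).le)]
    refine (hρ.integral_exp_neg_mul_le (by positivity) (hI ▸ hsys.ae_sInf_image_le hρ)).trans_eq ?_
    rw [Real.rpow_def_of_pos log_pos]
    ring_nf

lemma IsDensity.pos_of_summable_integral_exp [IsProbabilityMeasure μ] (hρ : IsDensity X μ ρ)
    {γ : ℝ} (h : Summable fun k : ℕ => ∫ x, Real.exp (-(((k : ℝ) + 1) ^ γ * ρ x)) ∂μ) :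
    0 < γ := by
  by_contra! hγ
  refine absurd (ge_of_tendsto' h.tendsto_atTop_zero fun k => ?_)
    (not_le.2 (integral_exp_pos (hρ.integrable_exp_neg_mul zero_le_one)))
  refine integral_mono_ae (hρ.integrable_exp_neg_mul zero_le_one)
    (hρ.integrable_exp_neg_mul (by positivity)) ?_
  filter_upwards [hρ.ae_pos] with x hx
  have rpow_le_one : ((k : ℝ) + 1) ^ γ ≤ 1 :=
    Real.rpow_le_one_of_one_le_of_nonpos (by linarith [k.cast_nonneg (α := ℝ)]) hγ
  gcongr

theorem ae_eventually_recMin_lt_of_summable (hsys : IsErgodicAcip X f μ) (hρ : IsDensity X μ ρ)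
    (hasym : AsymptoticallyHyperbolic X f μ) {r : ℕ → ℝ} {γ γ₀ : ℝ}
    (hsum : ∀ ε : ℝ, 0 < ε → Summable (fun k : ℕ =>
      ∫ x in X, ρ x * Real.exp (-(ε * ((k : ℝ) + 1) ^ γ₀ * ρ x))))
    (hγ : γ₀ < γ) (hr : ∀ᶠ n : ℕ in atTop, Real.log n ^ γ / (2 * n) < r n) :
    ∀ᵐ x ∂μ, ∀ᶠ n : ℕ in atTop, recMin f n x < r n := by
  have := hsys.isProbabilityMeasure
  simp only [← hρ.integral_eq hsys.measurableSet] at hsum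
  have γ_pos : 0 < γ := (hρ.pos_of_summable_integral_exp
    (by simpa only [one_mul] using hsum 1 one_pos)).trans hγ
  have log_rpow_mono : Monotone fun n : ℕ => Real.log n ^ γ / 2 := fun m n hmn => by
    rcases m.eq_zero_or_pos with rfl | hm
    · simp only [Nat.cast_zero, Real.log_zero, Real.zero_rpow γ_pos.ne', zero_div]
      exact div_nonneg (Real.rpow_nonneg (Real.log_natCast_nonneg n) γ) zero_le_two
    · have := Real.log_natCast_nonneg m
      dsimp only
      gcongr
  refine ae_eventually_recMin_lt_of_div_lt hsys hρ hasym (D := γ) (m := 0) (a := 2)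
    (L := fun n => Real.log n ^ γ / 2)
    (((tendsto_rpow_atTop γ_pos).comp tendsto_log_natCast).atTop_div_const two_pos)
    (log_rpow_mono.monotoneOn _) (Eventually.of_forall fun n =>
      half_le_self (Real.rpow_nonneg (Real.log_natCast_nonneg n) γ))
    (by simpa only [div_div] using hr) one_lt_two ?_
  obtain ⟨d, hd, le_log⟩ := exists_mul_le_log_natFloor_pow one_lt_two
  refine Summable.of_norm_bounded_eventually_nat (hsum (d ^ γ / 16) (by positivity)) ?_
  filter_upwards [le_log] with k hk
  have := Real.log_natCast_nonneg ⌊(2 : ℝ) ^ k⌋₊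
  rw [Real.norm_of_nonneg (integral_nonneg fun x => (Real.exp_pos _).le)]
  have rpow_le : d ^ γ * ((k : ℝ) + 1) ^ γ₀ ≤ Real.log ⌊(2 : ℝ) ^ k⌋₊ ^ γ :=
    calc d ^ γ * ((k : ℝ) + 1) ^ γ₀ ≤ d ^ γ * ((k : ℝ) + 1) ^ γ := by gcongr; linarith
      _ = (d * (k + 1)) ^ γ := by rw [Real.mul_rpow hd.le (by positivity)]
      _ ≤ _ := by gcongr
  refine integral_mono_ae (hρ.integrable_exp_neg_mul (by positivity))
    (hρ.integrable_exp_neg_mul (by positivity)) ?_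
  filter_upwards [hρ.ae_pos] with x hx
  refine Real.exp_le_exp.2 (neg_le_neg (mul_le_mul_of_nonneg_right ?_ hx.le))
  linarith

end rates

lemma tendsto_one_sub_pow_exp {v : ℕ → ℝ} {N : ℕ → ℕ} {t : ℝ} (hv : Tendsto v atTop (𝓝 0))
    (h : Tendsto (fun n => N n * v n) atTop (𝓝 t)) :
    Tendsto (fun n => (1 - v n) ^ N n) atTop (𝓝 (Real.exp (-t))) := by
  have lower : Tendsto (fun n => Real.exp (-(N n * v n / (1 - v n)))) atTop
      (𝓝 (Real.exp (-t))) := by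
    refine (Real.continuous_exp.tendsto _).comp ?_
    simpa using (h.div (tendsto_const_nhds.sub hv) (by norm_num : (1 : ℝ) - 0 ≠ 0)).neg
  have upper : Tendsto (fun n => Real.exp (-(N n * v n))) atTop (𝓝 (Real.exp (-t))) :=
    (Real.continuous_exp.tendsto _).comp h.neg
  refine tendsto_of_tendsto_of_tendsto_of_le_of_le' lower upper ?_ ?_
  · filter_upwards [hv.eventually (gt_mem_nhds one_pos)] with n hn
    have one_sub_pos : 0 < 1 - v n := by linarith
    calc Real.exp (-(N n * v n / (1 - v n))) = Real.exp (N n * (1 - (1 - v n)⁻¹)) := by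
          congr 1; field_simp; ring
      _ ≤ Real.exp (N n * Real.log (1 - v n)) := by
          gcongr; exact Real.one_sub_inv_le_log_of_pos one_sub_pos
      _ = (1 - v n) ^ N n := by rw [Real.exp_nat_mul, Real.exp_log one_sub_pos]
  · filter_upwards [hv.eventually (gt_mem_nhds one_pos)] with n hn
    rw [← mul_neg, Real.exp_nat_mul]
    exact pow_le_pow_left₀ (by linarith) (by linarith [Real.add_one_le_exp (-v n)]) _

lemma tendsto_measureReal_of_ae_eventually_notMem {α : Type*} [MeasurableSpace α] {ν : Measure α}
    [IsFiniteMeasure ν] {B : ℕ → Set α} (hB : ∀ n, MeasurableSet (B n))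
    (h : ∀ᵐ x ∂ν, ∀ᶠ n in atTop, x ∉ B n) : Tendsto (fun n => ν.real (B n)) atTop (𝓝 0) := by
  have tendsto_measure := tendsto_measure_of_ae_tendsto_indicator_of_isFiniteMeasure (μ := ν)
    atTop MeasurableSet.empty hB <| by
      filter_upwards [h] with x hx
      filter_upwards [hx] with n hn
      exact iff_of_false hn (notMem_empty x)
  rw [measure_empty] at tendsto_measure
  exact (ENNReal.tendsto_toReal ENNReal.zero_ne_top).comp tendsto_measure

lemma abs_integral_sub_le_add_measureReal_compl {α : Type*} [MeasurableSpace α] {ν : Measure α}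
    [IsFiniteMeasure ν] {g h : α → ℝ} (hg : Integrable g ν) (hh : Integrable h ν)
    (hg_mem : ∀ x, g x ∈ Icc (0 : ℝ) 1) (hh_mem : ∀ x, h x ∈ Icc (0 : ℝ) 1) {A : Set α}
    (hA : MeasurableSet A) :
    |∫ x, g x ∂ν - ∫ x, h x ∂ν| ≤ |∫ x in A, g x ∂ν - ∫ x in A, h x ∂ν| + ν.real Aᶜ := by
  have compl_le : |∫ x in Aᶜ, (g x - h x) ∂ν| ≤ ν.real Aᶜ := by
    have := norm_setIntegral_le_of_norm_le_const (C := 1) (f := fun x => g x - h x)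
      (measure_lt_top ν Aᶜ) fun x _ => by
        simpa using abs_sub_le_of_le_of_le (hg_mem x).1 (hg_mem x).2 (hh_mem x).1 (hh_mem x).2
    simpa using this
  rw [← integral_sub hg hh, ← integral_sub hg.integrableOn hh.integrableOn,
    ← integral_add_compl (f := fun x => g x - h x) hA (hg.sub hh)]
  exact (abs_add_le _ _).trans (add_le_add_right compl_le _)

lemma measurableSet_setOf_floor_div_mem (ℓ : ℝ) (s : Finset ℤ) :
    MeasurableSet {x : ℝ | ⌊x / ℓ⌋ ∈ s} :=
  measurable_comp_floor_div ℓ id s.measurableSet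

lemma setIntegral_setOf_floor_div_mem {ν : Measure ℝ} {ℓ : ℝ} (hℓ : 0 < ℓ) (s : Finset ℤ)
    {g : ℝ → ℝ} (hg : Integrable g ν) :
    ∫ x in {x | ⌊x / ℓ⌋ ∈ s}, g x ∂ν = ∑ i ∈ s, ∫ x in cell ℓ 0 i, g x ∂ν := by
  have eq_biUnion : {x : ℝ | ⌊x / ℓ⌋ ∈ s} = ⋃ i ∈ s, cell ℓ 0 i := by
    ext x
    simp only [mem_ofPred_eq, mem_iUnion, mem_cell_zero_iff hℓ, exists_prop, exists_eq_right']
  rw [eq_biUnion, integral_biUnion_finset s (fun i _ => measurableSet_cell ℓ 0 i)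
    ((pairwise_disjoint_cell_zero hℓ).set_pairwise _) fun i _ => hg.integrableOn]

lemma tendsto_measureReal_compl_setOf_floor_div_mem_gridRange {ν : Measure ℝ} [IsFiniteMeasure ν]
    {ℓ : ℕ → ℝ} (hℓ : ∀ᶠ n in atTop, 0 < ℓ n) :
    Tendsto (fun n => ν.real {x : ℝ | ⌊x / ℓ n⌋ ∈ gridRange (ℓ n) n}ᶜ) atTop (𝓝 0) := by
  refine tendsto_measureReal_of_ae_eventually_notMem
    (fun n => (measurableSet_setOf_floor_div_mem (ℓ n) (gridRange (ℓ n) n)).compl)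
    (Eventually.of_forall fun x => ?_)
  filter_upwards [hℓ, tendsto_natCast_atTop_atTop.eventually_ge_atTop |x|] with n hpos hn
  exact not_not.2 (floor_div_mem_gridRange hpos hn)

/-- The survival weight of the orbit of `x` with respect to the `q`-neighbourhood of the grid cell
of `x` itself, over the times `p ≤ t < p + N`. It is the discretised generating function of the
number of close returns of `x`. -/
def localSurvivalWeight (F : ℝ → ℝ) (ℓ : ℝ) (q : ℕ) (u : ℝ) (p N : ℕ) (x : ℝ) : ℝ :=
  survivalWeight F (cell ℓ q ⌊x / ℓ⌋) u N (F^[p] x)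

section localSurvivalWeight

variable {F : ℝ → ℝ} {ν : Measure ℝ} {ℓ u : ℝ}

lemma localSurvivalWeight_mem_Icc (hu : u ∈ Icc (0 : ℝ) 1) (ℓ : ℝ) (q p N : ℕ) (x : ℝ) :
    localSurvivalWeight F ℓ q u p N x ∈ Icc (0 : ℝ) 1 :=
  ⟨survivalWeight_nonneg hu _ _, survivalWeight_le_one hu _ _⟩

lemma measurable_localSurvivalWeight (hF : Measurable F) (hℓ : 0 < ℓ) (q : ℕ) (u : ℝ) (p N : ℕ) :
    Measurable (localSurvivalWeight F ℓ q u p N) := by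
  have measurableSet_visit (t : ℕ) :
      MeasurableSet {x | F^[t] (F^[p] x) ∈ cell ℓ q ⌊x / ℓ⌋} := by
    have floor := measurable_comp_floor_div ℓ (id : ℤ → ℤ)
    have floor_iterate := floor.comp ((hF.iterate t).comp (hF.iterate p))
    simp only [mem_cell_iff hℓ]
    exact (measurableSet_le (floor.sub_const _) floor_iterate).inter
      (measurableSet_le floor_iterate (floor.add_const _))
  unfold localSurvivalWeight survivalWeight
  refine Finset.measurable_fun_prod _ fun t _ => measurable_const.sub (measurable_const.mul ?_)
  exact measurable_one.indicator (measurableSet_visit t)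

lemma integrable_localSurvivalWeight [IsFiniteMeasure ν] (hF : Measurable F) (hℓ : 0 < ℓ) (q : ℕ)
    (hu : u ∈ Icc (0 : ℝ) 1) (p N : ℕ) : Integrable (localSurvivalWeight F ℓ q u p N) ν :=
  integrable_of_mem_Icc (measurable_localSurvivalWeight hF hℓ q u p N).aestronglyMeasurable
    (localSurvivalWeight_mem_Icc hu ℓ q p N)

lemma one_sub_mul_measureReal_pow_mem_Icc [IsProbabilityMeasure ν] (hu : u ∈ Icc (0 : ℝ) 1)
    (J : Set ℝ) (N : ℕ) : (1 - u * ν.real J) ^ N ∈ Icc (0 : ℝ) 1 := by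
  have mul_le_one : u * ν.real J ≤ 1 := mul_le_one₀ hu.2 measureReal_nonneg measureReal_le_one
  have mul_nonneg : 0 ≤ u * ν.real J := mul_nonneg hu.1 measureReal_nonneg
  exact ⟨pow_nonneg (by linarith) N, pow_le_one₀ (by linarith) (by linarith)⟩

lemma abs_integral_localSurvivalWeight_sub_le [IsProbabilityMeasure ν] (hF : Measurable F)
    (hℓ : 0 < ℓ) (q : ℕ) (hu : u ∈ Icc (0 : ℝ) 1) (p N : ℕ) (s : Finset ℤ) :
    |∫ x, localSurvivalWeight F ℓ q u p N x ∂ν -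
        ∫ x, (1 - u * ν.real (cell ℓ q ⌊x / ℓ⌋)) ^ N ∂ν| ≤
      ∑ i ∈ s, |∫ x in cell ℓ 0 i, survivalWeight F (cell ℓ q i) u N (F^[p] x) ∂ν -
          ν.real (cell ℓ 0 i) * (1 - u * ν.real (cell ℓ q i)) ^ N| +
        ν.real {x : ℝ | ⌊x / ℓ⌋ ∈ s}ᶜ := by
  have weight_integrable := integrable_localSurvivalWeight (ν := ν) hF hℓ q hu p N
  have pow_mem (x : ℝ) := one_sub_mul_measureReal_pow_mem_Icc (ν := ν) hu (cell ℓ q ⌊x / ℓ⌋) N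
  have pow_integrable : Integrable (fun x => (1 - u * ν.real (cell ℓ q ⌊x / ℓ⌋)) ^ N) ν :=
    integrable_of_mem_Icc (measurable_comp_floor_div ℓ
      fun i => (1 - u * ν.real (cell ℓ q i)) ^ N).aestronglyMeasurable pow_mem
  refine (abs_integral_sub_le_add_measureReal_compl weight_integrable pow_integrable
    (localSurvivalWeight_mem_Icc hu ℓ q p N) pow_mem
    (measurableSet_setOf_floor_div_mem ℓ s)).trans ?_
  rw [setIntegral_setOf_floor_div_mem hℓ s weight_integrable,
    setIntegral_setOf_floor_div_mem hℓ s pow_integrable, ← Finset.sum_sub_distrib]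
  refine add_le_add_left ((Finset.abs_sum_le_sum_abs _ _).trans_eq
    (Finset.sum_congr rfl fun i _ => ?_)) _
  have floor_eq (x : ℝ) (hx : x ∈ cell ℓ 0 i) : ⌊x / ℓ⌋ = i := (mem_cell_zero_iff hℓ).1 hx
  congr 2
  · exact setIntegral_congr_fun (measurableSet_cell ℓ 0 i) fun x hx => by
      simp only [localSurvivalWeight, floor_eq x hx]
  · rw [setIntegral_congr_fun (g := fun _ => (1 - u * ν.real (cell ℓ q i)) ^ N)
      (measurableSet_cell ℓ 0 i) fun x hx => by simp only [floor_eq x hx], setIntegral_const,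
      smul_eq_mul]

end localSurvivalWeight

section limit

variable {X : Set ℝ} {f : ℝ → ℝ} {μ : Measure ℝ} {ρ : ℝ → ℝ} {Y : Set ℝ} {F : ℝ → ℝ}
  {ν : Measure ℝ} {C κ S β u c L : ℝ} {ℓ : ℕ → ℝ} {N : ℕ → ℕ}

lemma RecurrenceEstimates.tendsto_integral_localSurvivalWeight_sub [IsProbabilityMeasure ν]
    (h : RecurrenceEstimates F ν C κ S β) (hu : u ∈ Icc (0 : ℝ) 1) (q : ℕ)
    (hℓ : AdmissibleMesh ℓ) (hN : (fun n => (N n : ℝ)) =O[atTop] fun n : ℕ => (n : ℝ)) :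
    Tendsto (fun n => ∫ x, localSurvivalWeight F (ℓ n) q u (gap n) (N n) x ∂ν -
      ∫ x, (1 - u * ν.real (cell (ℓ n) q ⌊x / ℓ n⌋)) ^ N n ∂ν) atTop (𝓝 0) := by
  have bound_tendsto := (h.polynomiallySmall_sum_abs_setIntegral_survivalWeight_sub hu q hℓ
    hN).tendsto_zero.add
      (tendsto_measureReal_compl_setOf_floor_div_mem_gridRange (ν := ν) hℓ.eventually_pos)
  rw [add_zero] at bound_tendsto
  refine squeeze_zero_norm' ?_ bound_tendsto
  filter_upwards [hℓ.eventually_pos] with n hpos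
  exact abs_integral_localSurvivalWeight_sub_le h.measurePreserving.measurable hpos q hu _ _ _

lemma ae_tendsto_one_sub_mul_cond_cell_pow (hsys : IsErgodicAcip X f μ) (hρ : IsDensity X μ ρ)
    (hY : MeasurableSet Y) (hYX : Y ⊆ X) (hY_pos : 0 < μ.real Y) (u : ℝ) (q : ℕ)
    (hℓ : AdmissibleMesh ℓ)
    (hN : Tendsto (fun n : ℕ => (N n : ℝ) / n) atTop (𝓝 (c * μ.real Y)))
    (hL : Tendsto (fun n : ℕ => n * ℓ n) atTop (𝓝 L)) :
    ∀ᵐ x ∂μ, x ∈ Y → Tendsto (fun n =>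
      (1 - u * (ProbabilityTheory.cond μ Y).real (cell (ℓ n) q ⌊x / ℓ n⌋)) ^ N n) atTop
        (𝓝 (Real.exp (-(u * (c * (2 * q + 1) * L * ρ x))))) := by
  have := hsys.isProbabilityMeasure
  filter_upwards [ae_tendsto_mul_cond_cell hsys hρ hY hYX hY_pos hℓ q hN,
    ae_tendsto_mul_cond_cell hsys hρ hY hYX hY_pos hℓ q (N := fun n => n) (c := (μ.real Y)⁻¹) <| by
      rw [inv_mul_cancel₀ hY_pos.ne']
      refine tendsto_const_nhds.congr' ?_
      filter_upwards [eventually_gt_atTop 0] with n hn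
      rw [div_self (by positivity)]] with x hx hx_id hxY
  refine tendsto_one_sub_pow_exp ?_ ?_
  · have ℓ_tendsto : Tendsto ℓ atTop (𝓝 0) := (tendsto_nhdsWithin_iff.1 hℓ.tendsto_zero).1
    have := ((hx_id hxY).mul ℓ_tendsto).const_mul u
    rw [mul_zero, mul_zero] at this
    refine this.congr' ?_
    filter_upwards [eventually_gt_atTop 0, hℓ.eventually_pos] with n hn hpos
    field_simp
  · have := ((hx hxY).mul hL).const_mul u
    rw [show u * (c * (2 * q + 1) * ρ x * L) = u * (c * (2 * q + 1) * L * ρ x) by ring] at this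
    refine this.congr' ?_
    filter_upwards [eventually_gt_atTop 0, hℓ.eventually_pos] with n hn hpos
    field_simp

theorem tendsto_integral_localSurvivalWeight (hsys : IsErgodicAcip X f μ) (hρ : IsDensity X μ ρ)
    (hY : MeasurableSet Y) (hYX : Y ⊆ X) [IsProbabilityMeasure (ProbabilityTheory.cond μ Y)]
    (h : RecurrenceEstimates (returnMap f Y) (ProbabilityTheory.cond μ Y) C κ S β)
    (hu : u ∈ Icc (0 : ℝ) 1) (q : ℕ) (hℓ : AdmissibleMesh ℓ)
    (hN : Tendsto (fun n : ℕ => (N n : ℝ) / n) atTop (𝓝 (c * μ.real Y)))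
    (hL : Tendsto (fun n : ℕ => n * ℓ n) atTop (𝓝 L)) :
    Tendsto (fun n => ∫ x, localSurvivalWeight (returnMap f Y) (ℓ n) q u (gap n) (N n) x
        ∂(ProbabilityTheory.cond μ Y)) atTop
      (𝓝 (∫ x, Real.exp (-(u * (c * (2 * q + 1) * L * ρ x))) ∂(ProbabilityTheory.cond μ Y))) := by
  have := hsys.isProbabilityMeasure
  set ν := ProbabilityTheory.cond μ Y
  have N_isBigO : (fun n => (N n : ℝ)) =O[atTop] fun n : ℕ => (n : ℝ) :=
    isBigO_of_div_tendsto_nhds (by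
      filter_upwards [eventually_gt_atTop 0] with n hn hn_zero
      exact absurd hn_zero (by positivity)) _ hN
  have pow_tendsto : Tendsto (fun n => ∫ x, (1 - u * ν.real (cell (ℓ n) q ⌊x / ℓ n⌋)) ^ N n ∂ν)
      atTop (𝓝 (∫ x, Real.exp (-(u * (c * (2 * q + 1) * L * ρ x))) ∂ν)) := by
    refine tendsto_integral_of_dominated_convergence (fun _ => 1) (fun n =>
      (measurable_comp_floor_div (ℓ n)
        fun i => (1 - u * ν.real (cell (ℓ n) q i)) ^ N n).aestronglyMeasurable)
      (integrable_const _) (fun n => Eventually.of_forall fun x => ?_) ?_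
    · have pow_mem := one_sub_mul_measureReal_pow_mem_Icc (ν := ν) hu (cell (ℓ n) q ⌊x / ℓ n⌋) (N n)
      exact (Real.norm_of_nonneg pow_mem.1).trans_le pow_mem.2
    · filter_upwards [ProbabilityTheory.ae_cond_mem hY,
        ProbabilityTheory.cond_absolutelyContinuous.ae_le (ae_tendsto_one_sub_mul_cond_cell_pow hsys
          hρ hY hYX measureReal_pos_of_isProbabilityMeasure_cond u q hℓ hN hL)] with x hxY hx
      exact hx hxY
  simpa only [sub_add_cancel, zero_add] using
    (h.tendsto_integral_localSurvivalWeight_sub hu q hℓ N_isBigO).add pow_tendsto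

end limit

section outsideReturn

variable {X : Set ℝ} {f : ℝ → ℝ} {μ : Measure ℝ} {ρ : ℝ → ℝ} {Y : Set ℝ} {C κ S β θ L : ℝ}
  {ℓ : ℕ → ℝ}

/-- The points of `Y` that come `r`-close to themselves outside `Y` by time `n`. These close
returns are not seen by the induced system. -/
def outsideReturn (f : ℝ → ℝ) (Y : Set ℝ) (n : ℕ) (r : ℝ) : Set ℝ :=
  {x ∈ Y | ∃ j, 1 ≤ j ∧ j ≤ n ∧ dist (f^[j] x) x ≤ r ∧ f^[j] x ∉ Y}

lemma sum_cond_real_cell_inter_preimage_hull_le [IsProbabilityMeasure μ]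
    (hf : MeasurePreserving f μ μ) [IsProbabilityMeasure (ProbabilityTheory.cond μ Y)]
    (hY : MeasurableSet Y)
    (h : RecurrenceEstimates (returnMap f Y) (ProbabilityTheory.cond μ Y) C κ S β) {ℓ : ℝ}
    (hℓ : 0 < ℓ) (hθ : 0 ≤ θ) (q : ℕ) {s : Finset ℤ}
    (hs : ∀ i ∈ s, μ.real (Yᶜ ∩ cell ℓ q i) ≤ θ * μ.real (Y ∩ cell ℓ q i)) (t : ℕ) :
    ∑ i ∈ s, (ProbabilityTheory.cond μ Y).real
        (cell ℓ 0 i ∩ (returnMap f Y)^[t] ⁻¹' hull f Y (Yᶜ ∩ cell ℓ q i)) ≤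
      θ * ((2 * q + 1) * (S * ℓ + C * Real.exp (-κ * t))) := by
  set ν := ProbabilityTheory.cond μ Y
  set a : ℝ := C * Real.exp (-κ * t)
  have a_nonneg : 0 ≤ a := mul_nonneg h.C_pos.le (Real.exp_nonneg _)
  have S_pos := h.S_pos
  have outside_le (i : ℤ) (hi : i ∈ s) :
      μ.real (Yᶜ ∩ cell ℓ q i) / μ.real Y ≤ θ * ν.real (cell ℓ q i) := by
    rw [cond_real_eq_div hY, ← mul_div_assoc]
    exact div_le_div_of_nonneg_right (hs i hi) measureReal_nonneg
  have sum_cell_le : ∑ i ∈ s, ν.real (cell ℓ q i) ≤ 2 * q + 1 := by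
    simpa using sum_measureReal_le_of_subset_cell (ν := ν) hℓ s (measurableSet_cell ℓ q)
      MeasurableSet.univ (fun _ => subset_univ _) fun _ => Subset.rfl
  calc ∑ i ∈ s, ν.real (cell ℓ 0 i ∩ (returnMap f Y)^[t] ⁻¹' hull f Y (Yᶜ ∩ cell ℓ q i))
      ≤ ∑ i ∈ s, (ν.real (cell ℓ 0 i) + a) * (θ * ν.real (cell ℓ q i)) :=
        Finset.sum_le_sum fun i hi => (cond_real_cell_inter_preimage_hull_le hf hY
          h.measurePreserving.measurable h.C_pos.le h.decay
          (hY.compl.inter (measurableSet_cell ℓ q i)) ℓ i t).trans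
            (mul_le_mul_of_nonneg_left (outside_le i hi) (by positivity))
    _ = θ * (∑ i ∈ s, ν.real (cell ℓ 0 i) * ν.real (cell ℓ q i) +
          a * ∑ i ∈ s, ν.real (cell ℓ q i)) := by
        rw [Finset.mul_sum, ← Finset.sum_add_distrib, Finset.mul_sum]
        exact Finset.sum_congr rfl fun i _ => by ring
    _ ≤ θ * ((∑ i ∈ s, ν.real (cell ℓ 0 i)) * (S * ((2 * q + 1) * ℓ)) + a * (2 * q + 1)) := by
        rw [Finset.sum_mul]
        gcongr with i
        exact h.measureReal_cell_le ℓ hℓ q i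
    _ ≤ θ * (1 * (S * ((2 * q + 1) * ℓ)) + a * (2 * q + 1)) := by
        gcongr
        exact sum_measureReal_cell_zero_le hℓ s
    _ = θ * ((2 * q + 1) * (S * ℓ + a)) := by ring

-- By Lebesgue differentiation almost every point of `Y` is a density point of `Y`.
lemma tendsto_cond_real_setOf_mul_lt_measureReal_cell (hsys : IsErgodicAcip X f μ)
    (hρ : IsDensity X μ ρ) (hY : MeasurableSet Y) (hYX : Y ⊆ X) (hℓ : AdmissibleMesh ℓ) (q : ℕ)
    (hθ : 0 < θ) :
    Tendsto (fun n => (ProbabilityTheory.cond μ Y).real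
      {x | θ * μ.real (Y ∩ cell (ℓ n) q ⌊x / ℓ n⌋) < μ.real (Yᶜ ∩ cell (ℓ n) q ⌊x / ℓ n⌋)})
      atTop (𝓝 0) := by
  have := hsys.isProbabilityMeasure
  have cond_le := ProbabilityTheory.cond_absolutelyContinuous (μ := μ) (s := Y).ae_le
  have cond_le_volume := cond_le.trans hsys.absolutelyContinuous.ae_le
  refine tendsto_measureReal_of_ae_eventually_notMem (fun n => ?_) ?_
  · exact measurableSet_lt
      ((measurable_comp_floor_div (ℓ n) fun i => μ.real (Y ∩ cell (ℓ n) q i)).const_mul θ)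
      (measurable_comp_floor_div (ℓ n) fun i => μ.real (Yᶜ ∩ cell (ℓ n) q i))
  · filter_upwards [ProbabilityTheory.ae_cond_mem hY, cond_le hρ.ae_pos,
      cond_le_volume (hρ.ae_tendsto_cell hsys.measurableSet hY),
      cond_le_volume (hρ.ae_tendsto_cell hsys.measurableSet hY.compl)]
      with x hxY hxρ tendsto_inside tendsto_outside
    have inside := (tendsto_inside q ℓ hℓ.tendsto_zero).const_mul θ
    have outside := tendsto_outside q ℓ hℓ.tendsto_zero
    rw [indicator_of_mem (mem_inter hxY (hYX hxY))] at inside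
    rw [indicator_of_notMem fun hx => hx.1 hxY] at outside
    filter_upwards [outside.eventually_lt inside (mul_pos hθ hxρ), hℓ.eventually_pos]
      with n hlt hpos
    have width_pos : 0 < (2 * (q : ℝ) + 1) * ℓ n := by positivity
    rw [← mul_div_assoc, div_lt_div_iff_of_pos_right width_pos] at hlt
    exact not_lt.2 hlt.le

lemma exists_iterate_returnMap_mem_hull_of_mem_outsideReturn {n : ℕ} {r x : ℝ} (hr : 0 < r)
    (hx : x ∈ outsideReturn f Y n r) :
    ∃ t ∈ Finset.range (n + 1), (returnMap f Y)^[t] x ∈ hull f Y (Yᶜ ∩ cell r 1 ⌊x / r⌋) := by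
  obtain ⟨hxY, j, -, hjn, hdist, hjY⟩ := hx
  refine ⟨visits f Y j x, Finset.mem_range.2 (Nat.lt_succ_of_le ((visits_le j x).trans hjn)), ?_⟩
  exact iterate_returnMap_mem_hull hxY ⟨hjY, mem_cell_of_dist_le hr (by simpa using hdist)⟩

lemma cond_real_outsideReturn_le [IsProbabilityMeasure μ] (hf : MeasurePreserving f μ μ)
    (hY : MeasurableSet Y) [IsProbabilityMeasure (ProbabilityTheory.cond μ Y)]
    (h : RecurrenceEstimates (returnMap f Y) (ProbabilityTheory.cond μ Y) C κ S β) {r : ℝ}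
    (hr : 0 < r) (hθ : 0 ≤ θ) (n : ℕ) (s : Finset ℤ) :
    (ProbabilityTheory.cond μ Y).real (outsideReturn f Y n r) ≤
      (ProbabilityTheory.cond μ Y).real {x : ℝ | ⌊x / r⌋ ∈ s}ᶜ +
        (ProbabilityTheory.cond μ Y).real
          {x | θ * μ.real (Y ∩ cell r 1 ⌊x / r⌋) < μ.real (Yᶜ ∩ cell r 1 ⌊x / r⌋)} +
        ∑ t ∈ Finset.range (n + 1), θ * (3 * (S * r + C * Real.exp (-κ * t))) := by
  classical
  set ν := ProbabilityTheory.cond μ Y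
  set bad : Set ℝ := {x | θ * μ.real (Y ∩ cell r 1 ⌊x / r⌋) < μ.real (Yᶜ ∩ cell r 1 ⌊x / r⌋)}
  set good := s.filter fun i => μ.real (Yᶜ ∩ cell r 1 i) ≤ θ * μ.real (Y ∩ cell r 1 i)
  have subset_union : outsideReturn f Y n r ⊆ ({x : ℝ | ⌊x / r⌋ ∈ s}ᶜ ∪ bad) ∪
      ⋃ t ∈ Finset.range (n + 1), ⋃ i ∈ good,
        cell r 0 i ∩ (returnMap f Y)^[t] ⁻¹' hull f Y (Yᶜ ∩ cell r 1 i) := by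
    intro x hx
    by_cases hxs : ⌊x / r⌋ ∈ s
    · rcases lt_or_ge (θ * μ.real (Y ∩ cell r 1 ⌊x / r⌋)) (μ.real (Yᶜ ∩ cell r 1 ⌊x / r⌋))
        with hbad | hgood
      · exact Or.inl (Or.inr hbad)
      · obtain ⟨t, ht, hmem⟩ := exists_iterate_returnMap_mem_hull_of_mem_outsideReturn hr hx
        exact Or.inr (mem_iUnion₂.2 ⟨t, ht, mem_iUnion₂.2 ⟨⌊x / r⌋,
          Finset.mem_filter.2 ⟨hxs, hgood⟩, mem_cell_floor hr 0 x, hmem⟩⟩)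
    · exact Or.inl (Or.inl hxs)
  refine (measureReal_mono subset_union (measure_ne_top _ _)).trans
    ((measureReal_union_le _ _).trans (add_le_add (measureReal_union_le _ _) ?_))
  refine (measureReal_biUnion_finset_le _ _).trans (Finset.sum_le_sum fun t _ => ?_)
  refine (measureReal_biUnion_finset_le _ _).trans ?_
  have sum_le := sum_cond_real_cell_inter_preimage_hull_le hf hY h hr hθ 1 (s := good)
    (fun i hi => (Finset.mem_filter.1 hi).2) t
  rwa [show 2 * ((1 : ℕ) : ℝ) + 1 = 3 by norm_num] at sum_le

lemma tendsto_outsideReturn (hsys : IsErgodicAcip X f μ) (hρ : IsDensity X μ ρ)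
    (hY : MeasurableSet Y) (hYX : Y ⊆ X) [IsProbabilityMeasure (ProbabilityTheory.cond μ Y)]
    (h : RecurrenceEstimates (returnMap f Y) (ProbabilityTheory.cond μ Y) C κ S β)
    (hℓ : AdmissibleMesh ℓ) (hL : Tendsto (fun n : ℕ => n * ℓ n) atTop (𝓝 L)) :
    Tendsto (fun n => (ProbabilityTheory.cond μ Y).real (outsideReturn f Y n (ℓ n))) atTop
      (𝓝 0) := by
  have := hsys.isProbabilityMeasure
  have summable_exp : Summable fun t : ℕ => C * Real.exp (-κ * t) := by
    simpa only [mul_comm] using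
      (Real.summable_exp_nat_mul_iff.2 (neg_lt_zero.2 h.κ_pos)).mul_right C
  have sum_tendsto : Tendsto (fun n : ℕ => 3 * (S * ((n + 1) * ℓ n) +
      ∑ t ∈ Finset.range (n + 1), C * Real.exp (-κ * t))) atTop
      (𝓝 (3 * (S * L + ∑' t : ℕ, C * Real.exp (-κ * t)))) := by
    have ℓ_tendsto : Tendsto ℓ atTop (𝓝 0) := (tendsto_nhdsWithin_iff.1 hℓ.tendsto_zero).1
    refine ((((hL.add ℓ_tendsto).congr fun n => by ring).const_mul S).add
      (summable_exp.tendsto_sum_tsum_nat.comp (tendsto_add_atTop_nat 1))).const_mul 3 |>.trans ?_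
    rw [add_zero]
  refine tendsto_order.2 ⟨fun a ha => Eventually.of_forall fun n =>
    ha.trans_le measureReal_nonneg, fun η hη => ?_⟩
  obtain ⟨θ, hθ, hθη⟩ := exists_pos_mul_lt hη (3 * (S * L + ∑' t : ℕ, C * Real.exp (-κ * t)))
  have bound_tendsto :=
    ((tendsto_measureReal_compl_setOf_floor_div_mem_gridRange (ν := ProbabilityTheory.cond μ Y)
      hℓ.eventually_pos).add (tendsto_cond_real_setOf_mul_lt_measureReal_cell hsys hρ hY hYX hℓ 1
        hθ)).add (sum_tendsto.mul_const θ)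
  rw [add_zero, zero_add] at bound_tendsto
  filter_upwards [bound_tendsto.eventually_lt_const hθη, hℓ.eventually_pos] with n hn hpos
  refine (cond_real_outsideReturn_le hsys.ergodic.toMeasurePreserving hY h hpos hθ.le n
    (gridRange (ℓ n) n)).trans_lt (hn.trans_eq' ?_)
  have sum_eq : ∑ t ∈ Finset.range (n + 1), θ * (3 * (S * ℓ n + C * Real.exp (-κ * t))) =
      3 * (S * ((n + 1) * ℓ n) + ∑ t ∈ Finset.range (n + 1), C * Real.exp (-κ * t)) * θ := by
    simp only [← Finset.mul_sum, Finset.sum_add_distrib, Finset.sum_const, Finset.card_range,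
      nsmul_eq_mul, Nat.cast_add, Nat.cast_one]
    ring
  rw [sum_eq]

end outsideReturn

/-- The points that come `r`-close to themselves at one of the times `1 ≤ t < p`, where the mixing
across a gap of length `p` gives no information. -/
def earlyReturn (F : ℝ → ℝ) (p : ℕ) (r : ℝ) : Set ℝ :=
  {x | ∃ t, 1 ≤ t ∧ t < p ∧ dist (F^[t] x) x ≤ r}

lemma RecurrenceEstimates.tendsto_earlyReturn {F : ℝ → ℝ} {ν : Measure ℝ} {C κ S β : ℝ}
    [IsProbabilityMeasure ν] (h : RecurrenceEstimates F ν C κ S β) {ℓ : ℕ → ℝ}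
    (hℓ : AdmissibleMesh ℓ) :
    Tendsto (fun n => ν.real (earlyReturn F (gap n) (ℓ n))) atTop (𝓝 0) := by
  have sum_tendsto := (PolynomiallySmall.of_isBigO_log_rpow_mul h.β_pos
    (h.sum_shortReturns_isBigO hℓ one_pos)).tendsto_zero
  refine squeeze_zero (fun n => measureReal_nonneg) (fun n => ?_) sum_tendsto
  refine (measureReal_mono ?_ (measure_ne_top _ _)).trans (measureReal_biUnion_finset_le _ _)
  rintro x ⟨t, ht_pos, ht_lt, hdist⟩
  refine mem_iUnion₂.2 ⟨t, Finset.mem_Ico.2 ⟨ht_pos, ht_lt⟩, ?_⟩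
  rwa [mem_ofPred_eq, one_mul, dist_comm]

section sandwich

variable {F : ℝ → ℝ} {u r x : ℝ} {q p N n : ℕ}

lemma survivalWeight_eq_pow (F : ℝ → ℝ) (J : Set ℝ) [DecidablePred (· ∈ J)] (u : ℝ) (N : ℕ)
    (y : ℝ) :
    survivalWeight F J u N y =
      (1 - u) ^ ((Finset.range N).filter fun t => F^[t] y ∈ J).card := by
  rw [survivalWeight, ← Finset.prod_const, Finset.prod_filter]
  refine Finset.prod_congr rfl fun t _ => ?_
  by_cases h : F^[t] y ∈ J <;> simp [h]

lemma pow_recCount_le_localSurvivalWeight (hu : u ∈ Icc (0 : ℝ) 1) (hr : 0 < r) (hp : 1 ≤ p)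
    (hN : p + N ≤ n) :
    (1 - u) ^ recCount F n r x ≤ localSurvivalWeight F (r / (q + 1)) q u p N x := by
  classical
  have hℓ : 0 < r / ((q : ℝ) + 1) := by positivity
  rw [localSurvivalWeight, survivalWeight_eq_pow]
  refine pow_le_pow_of_le_one (by linarith [hu.2]) (by linarith [hu.1])
    (Finset.card_le_card_of_injOn (fun t => t + p) (fun t ht => ?_)
      (add_left_injective p).injOn)
  simp only [Finset.coe_filter, Finset.mem_range, mem_ofPred_eq, Finset.mem_Icc] at ht ⊢
  refine ⟨by omega, ?_⟩
  rw [Function.iterate_add_apply]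
  exact (dist_lt_of_mem_cell hℓ ht.2).le.trans_eq (mul_div_cancel₀ r (by positivity))

lemma localSurvivalWeight_le_pow_recCount (hu : u ∈ Icc (0 : ℝ) 1) (hr : 0 < r) (hq : 1 ≤ q)
    (hN : n < p + N) (hx : x ∉ earlyReturn F p r) :
    localSurvivalWeight F (r / q) q u p N x ≤ (1 - u) ^ recCount F n r x := by
  classical
  have hq_pos : (0 : ℝ) < q := by exact_mod_cast hq
  rw [localSurvivalWeight, survivalWeight_eq_pow]
  have le_of_close (t : ℕ) (ht : 1 ≤ t) (hdist : dist (F^[t] x) x ≤ r) : p ≤ t := by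
    by_contra! hlt
    exact hx ⟨t, ht, hlt, hdist⟩
  refine pow_le_pow_of_le_one (by linarith [hu.2]) (by linarith [hu.1])
    (Finset.card_le_card_of_injOn (fun t => t - p) (fun t ht => ?_) fun a ha b hb hab => ?_)
  · simp only [Finset.coe_filter, Finset.mem_range, mem_ofPred_eq, Finset.mem_Icc] at ht ⊢
    have hpt := le_of_close t ht.1.1 ht.2
    refine ⟨by omega, ?_⟩
    rw [← Function.iterate_add_apply, Nat.sub_add_cancel hpt]
    exact mem_cell_of_dist_le (div_pos hr hq_pos)
      (ht.2.trans_eq (mul_div_cancel₀ r hq_pos.ne').symm)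
  · simp only [Finset.coe_filter, mem_ofPred_eq, Finset.mem_Icc] at ha hb
    exact tsub_inj_left (le_of_close a ha.1.1 ha.2) (le_of_close b hb.1.1 hb.2) hab

end sandwich

section generatingFunctions

lemma summable_mul_pow {a : ℕ → ℝ} (ha : ∀ k, a k ∈ Icc (0 : ℝ) 1) {z : ℝ}
    (hz : z ∈ Ioo (0 : ℝ) 1) : Summable fun k => a k * z ^ k :=
  Summable.of_nonneg_of_le (fun k => mul_nonneg (ha k).1 (pow_nonneg hz.1.le k))
    (fun k => mul_le_of_le_one_left (pow_nonneg hz.1.le k) (ha k).2)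
    (summable_geometric_of_lt_one hz.1.le hz.2)

lemma tsum_mul_pow_eq {a : ℕ → ℝ} (ha : ∀ k, a k ∈ Icc (0 : ℝ) 1) {z : ℝ}
    (hz : z ∈ Ioo (0 : ℝ) 1) :
    ∑' k, a k * z ^ k = a 0 + z * ∑' k, a (k + 1) * z ^ k := by
  rw [(summable_mul_pow ha hz).tsum_eq_zero_add, pow_zero, mul_one, ← tsum_mul_left]
  congr 1
  exact tsum_congr fun k => by rw [pow_succ]; ring

lemma tsum_mul_pow_sub_coeff_zero_mem_Icc {a : ℕ → ℝ} (ha : ∀ k, a k ∈ Icc (0 : ℝ) 1) {z : ℝ}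
    (hz : z ∈ Ioo (0 : ℝ) 1) : ∑' k, a k * z ^ k - a 0 ∈ Icc 0 (z * (1 - z)⁻¹) := by
  have tail_nonneg : 0 ≤ ∑' k, a (k + 1) * z ^ k :=
    tsum_nonneg fun k => mul_nonneg (ha (k + 1)).1 (pow_nonneg hz.1.le k)
  have tail_le : ∑' k, a (k + 1) * z ^ k ≤ (1 - z)⁻¹ := by
    rw [← tsum_geometric_of_lt_one hz.1.le hz.2]
    exact (summable_mul_pow (fun k => ha (k + 1)) hz).tsum_le_tsum
      (fun k => mul_le_of_le_one_left (pow_nonneg hz.1.le k) (ha (k + 1)).2)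
      (summable_geometric_of_lt_one hz.1.le hz.2)
  rw [tsum_mul_pow_eq ha hz, add_sub_cancel_left]
  exact ⟨mul_nonneg hz.1.le tail_nonneg, mul_le_mul_of_nonneg_left tail_le hz.1.le⟩

lemma tendsto_coeff_zero_of_tendsto_tsum {a : ℕ → ℕ → ℝ} {b : ℕ → ℝ}
    (ha : ∀ n k, a n k ∈ Icc (0 : ℝ) 1) (hb : ∀ k, b k ∈ Icc (0 : ℝ) 1)
    (h : ∀ z ∈ Ioo (0 : ℝ) 1,
      Tendsto (fun n => ∑' k, a n k * z ^ k) atTop (𝓝 (∑' k, b k * z ^ k))) :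
    Tendsto (fun n => a n 0) atTop (𝓝 (b 0)) := by
  rw [Metric.tendsto_atTop']
  intro ε hε
  obtain ⟨z, hz, tail_lt⟩ : ∃ z ∈ Ioo (0 : ℝ) 1, z * (1 - z)⁻¹ < ε / 2 := by
    refine ⟨ε / (4 + ε), ⟨by positivity, by rw [div_lt_one (by positivity)]; linarith⟩, ?_⟩
    rw [show 1 - ε / (4 + ε) = 4 / (4 + ε) by field_simp; ring, inv_div,
      div_mul_div_cancel₀ (by positivity)]
    linarith
  obtain ⟨M, hM⟩ := Metric.tendsto_atTop'.1 (h z hz) (ε / 2) (half_pos hε)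
  refine ⟨M, fun n hn => ?_⟩
  obtain ⟨sum_lower, sum_upper⟩ := abs_lt.1 (hM n hn)
  obtain ⟨a_lower, a_upper⟩ := tsum_mul_pow_sub_coeff_zero_mem_Icc (ha n) hz
  obtain ⟨b_lower, b_upper⟩ := tsum_mul_pow_sub_coeff_zero_mem_Icc hb hz
  rw [Real.dist_eq, abs_lt]
  constructor <;> linarith

lemma tendsto_coeff_of_tendsto_tsum {a : ℕ → ℕ → ℝ} {b : ℕ → ℝ}
    (ha : ∀ n k, a n k ∈ Icc (0 : ℝ) 1) (hb : ∀ k, b k ∈ Icc (0 : ℝ) 1)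
    (h : ∀ z ∈ Ioo (0 : ℝ) 1,
      Tendsto (fun n => ∑' k, a n k * z ^ k) atTop (𝓝 (∑' k, b k * z ^ k))) (k : ℕ) :
    Tendsto (fun n => a n k) atTop (𝓝 (b k)) := by
  induction k generalizing a b with
  | zero => exact tendsto_coeff_zero_of_tendsto_tsum ha hb h
  | succ _ ih =>
    refine ih (a := fun n k => a n (k + 1)) (b := fun k => b (k + 1)) (fun n k => ha n (k + 1))
      (fun k => hb (k + 1)) fun z hz => ?_
    have tsum_succ_eq {c : ℕ → ℝ} (hc : ∀ k, c k ∈ Icc (0 : ℝ) 1) :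
        ∑' k, c (k + 1) * z ^ k = (∑' k, c k * z ^ k - c 0) / z := by
      rw [tsum_mul_pow_eq hc hz, add_sub_cancel_left, mul_div_cancel_left₀ _ hz.1.ne']
    rw [tsum_succ_eq hb]
    simp only [tsum_succ_eq (ha _)]
    exact ((h z hz).sub (tendsto_coeff_zero_of_tendsto_tsum ha hb h)).div_const z

variable {α : Type*} [MeasurableSpace α] {μ : Measure α} [IsProbabilityMeasure μ]

lemma integral_pow_eq_tsum {R : α → ℕ} (hR : Measurable R) {z : ℝ} (hz : z ∈ Icc (0 : ℝ) 1) :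
    ∫ x, z ^ R x ∂μ = ∑' k, μ.real {x | R x = k} * z ^ k := by
  have := Measure.isProbabilityMeasure_map (μ := μ) hR.aemeasurable
  have pow_aestronglyMeasurable : AEStronglyMeasurable (fun k : ℕ => z ^ k) (μ.map R) :=
    (measurable_of_countable _).aestronglyMeasurable
  rw [← integral_map hR.aemeasurable (f := fun k : ℕ => z ^ k) pow_aestronglyMeasurable,
    integral_countable (integrable_of_mem_Icc pow_aestronglyMeasurable
      fun k => ⟨pow_nonneg hz.1 k, pow_le_one₀ hz.1 hz.2⟩)]
  refine tsum_congr fun k => ?_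
  rw [map_measureReal_apply hR (measurableSet_singleton k), smul_eq_mul]
  rfl

lemma poisson_mem_Icc {t : ℝ} (ht : 0 ≤ t) (k : ℕ) :
    t ^ k / (k.factorial : ℝ) * Real.exp (-t) ∈ Icc (0 : ℝ) 1 := by
  refine ⟨by positivity, ?_⟩
  rw [Real.exp_neg, ← div_eq_mul_inv, div_le_one (Real.exp_pos t)]
  exact Real.pow_div_factorial_le_exp t ht k

lemma tsum_poisson_mul_pow (t z : ℝ) :
    ∑' k : ℕ, t ^ k / (k.factorial : ℝ) * Real.exp (-t) * z ^ k = Real.exp (-((1 - z) * t)) := by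
  have hasSum_exp : HasSum (fun k : ℕ => (z * t) ^ k / (k.factorial : ℝ)) (Real.exp (z * t)) := by
    rw [Real.exp_eq_exp_ℝ]
    exact NormedSpace.expSeries_div_hasSum_exp (z * t)
  rw [show -((1 - z) * t) = z * t + -t by ring, Real.exp_add,
    ← (hasSum_exp.mul_right (Real.exp (-t))).tsum_eq]
  exact tsum_congr fun k => by rw [mul_pow]; ring

lemma integral_mixedPoisson_mem_Icc {h : α → ℝ} (h_nonneg : 0 ≤ᵐ[μ] h) (k : ℕ) :
    ∫ x, h x ^ k / (k.factorial : ℝ) * Real.exp (-h x) ∂μ ∈ Icc (0 : ℝ) 1 := by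
  have poisson_mem : ∀ᵐ x ∂μ, h x ^ k / (k.factorial : ℝ) * Real.exp (-h x) ∈ Icc (0 : ℝ) 1 := by
    filter_upwards [h_nonneg] with x hx using poisson_mem_Icc hx k
  refine ⟨integral_nonneg_of_ae (poisson_mem.mono fun x hx => hx.1), ?_⟩
  have integral_le := integral_mono_of_nonneg (g := fun _ => (1 : ℝ))
    (poisson_mem.mono fun x hx => hx.1) (integrable_const _) (poisson_mem.mono fun x hx => hx.2)
  simpa using integral_le

lemma integral_exp_eq_tsum_mixedPoisson {h : α → ℝ} (hm : AEMeasurable h μ)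
    (h_nonneg : 0 ≤ᵐ[μ] h) {z : ℝ} (hz : z ∈ Ioo (0 : ℝ) 1) :
    ∫ x, Real.exp (-((1 - z) * h x)) ∂μ =
      ∑' k : ℕ, (∫ x, h x ^ k / (k.factorial : ℝ) * Real.exp (-h x) ∂μ) * z ^ k := by
  have integrable_poisson (k : ℕ) :
      Integrable (fun x => h x ^ k / (k.factorial : ℝ) * Real.exp (-h x)) μ := by
    refine Integrable.of_bound (((hm.pow_const k).div_const _).mul
      (Real.measurable_exp.comp_aemeasurable hm.neg)).aestronglyMeasurable 1 ?_
    filter_upwards [h_nonneg] with x hx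
    exact (Real.norm_of_nonneg (poisson_mem_Icc hx k).1).trans_le (poisson_mem_Icc hx k).2
  have summable_norm : Summable fun k : ℕ =>
      ∫ x, ‖h x ^ k / (k.factorial : ℝ) * Real.exp (-h x) * z ^ k‖ ∂μ := by
    refine (summable_mul_pow (integral_mixedPoisson_mem_Icc h_nonneg) hz).congr fun k => ?_
    rw [← integral_mul_const]
    refine integral_congr_ae ?_
    filter_upwards [h_nonneg] with x hx
    exact (Real.norm_of_nonneg (mul_nonneg (poisson_mem_Icc hx k).1 (pow_nonneg hz.1.le k))).symm
  simp only [← integral_mul_const, ← tsum_poisson_mul_pow]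
  exact (hasSum_integral_of_summable_integral_norm
    (fun k => (integrable_poisson k).mul_const (z ^ k)) summable_norm).tsum_eq.symm

end generatingFunctions

section limitLaw

variable {X : Set ℝ} {f : ℝ → ℝ} {μ : Measure ℝ} {ρ : ℝ → ℝ} {Y : Set ℝ} {C κ S β u τ c η : ℝ}

lemma measurable_recCount (hf : Measurable f) (n : ℕ) (r : ℝ) : Measurable (recCount f n r) := by
  induction n with
  | zero => exact measurable_const
  | succ n ih =>
    rw [funext (recCount_succ f n r)]
    exact ih.add (Measurable.ite (measurableSet_le ((hf.iterate _).dist measurable_id)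
      measurable_const) measurable_const measurable_const)

lemma measurable_pow_recCount (hf : Measurable f) (u : ℝ) (n : ℕ) (r : ℝ) :
    Measurable fun x => (1 - u) ^ recCount f n r x :=
  (measurable_of_countable fun k : ℕ => (1 - u) ^ k).comp (measurable_recCount hf n r)

lemma one_sub_pow_mem_Icc (hu : u ∈ Icc (0 : ℝ) 1) (k : ℕ) : (1 - u) ^ k ∈ Icc (0 : ℝ) 1 :=
  ⟨pow_nonneg (sub_nonneg.2 hu.2) k, pow_le_one₀ (sub_nonneg.2 hu.2) (sub_le_self 1 hu.1)⟩

lemma recCount_eq_recCount_returnMap_of_notMem {n : ℕ} {r x : ℝ} (hxY : x ∈ Y)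
    (hx : x ∉ outsideReturn f Y n r) :
    recCount f n r x = recCount (returnMap f Y) (visits f Y n x) r x :=
  recCount_eq_recCount_returnMap hxY fun j hj_pos hj hdist =>
    by_contra fun hjY => hx ⟨hxY, j, hj_pos, hj, hdist, hjY⟩

lemma integral_le_integral_add_of_notMem {α : Type*} [MeasurableSpace α] {ν : Measure α}
    [IsFiniteMeasure ν] {g h : α → ℝ} (hg : Integrable g ν) (hh : Integrable h ν)
    (hg_le : ∀ x, g x ≤ 1) (hh_nonneg : ∀ x, 0 ≤ h x) {B : Set α}
    (hle : ∀ᵐ x ∂ν, x ∉ B → g x ≤ h x) :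
    ∫ x, g x ∂ν ≤ ∫ x, h x ∂ν + ν.real B := by
  have measurable_hull := measurableSet_toMeasurable ν B
  have indicator_integrable : Integrable ((toMeasurable ν B).indicator (1 : α → ℝ)) ν :=
    (integrable_const (1 : ℝ)).indicator measurable_hull
  have real_eq : ν.real B = ∫ x, (toMeasurable ν B).indicator 1 x ∂ν := by
    rw [integral_indicator_one measurable_hull, measureReal_def, measureReal_def,
      measure_toMeasurable]
  rw [real_eq, ← integral_add hh indicator_integrable]
  refine integral_mono_ae hg (hh.add indicator_integrable) ?_
  filter_upwards [hle] with x hx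
  by_cases hxB : x ∈ toMeasurable ν B
  · simp only [indicator_of_mem hxB, Pi.one_apply]
    linarith [hg_le x, hh_nonneg x]
  · simp only [indicator_of_notMem hxB, add_zero]
    exact hx fun h => hxB (subset_toMeasurable ν B h)

lemma setIntegral_mem_Icc {α : Type*} [MeasurableSpace α] {μ : Measure α} [IsFiniteMeasure μ]
    {g : α → ℝ} (hg : Integrable g μ) (hg_mem : ∀ᵐ x ∂μ, g x ∈ Icc (0 : ℝ) 1) (s : Set α) :
    ∫ x in s, g x ∂μ ∈ Icc 0 (μ.real s) := by
  have mem_restrict := ae_restrict_of_ae (s := s) hg_mem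
  refine ⟨integral_nonneg_of_ae (mem_restrict.mono fun x hx => hx.1), ?_⟩
  simpa using integral_mono_ae hg.integrableOn (integrable_const (1 : ℝ))
    (mem_restrict.mono fun x hx => hx.2)

lemma abs_integral_sub_integral_cond_le {α : Type*} [MeasurableSpace α] {μ : Measure α}
    [IsProbabilityMeasure μ] {Y : Set α} (hY : MeasurableSet Y) (hY_pos : 0 < μ.real Y)
    {g : α → ℝ} (hg : Integrable g μ) (hg_mem : ∀ᵐ x ∂μ, g x ∈ Icc (0 : ℝ) 1) :
    |∫ x, g x ∂μ - ∫ x, g x ∂(ProbabilityTheory.cond μ Y)| ≤ μ.real Yᶜ := by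
  have cond_eq : ∫ x in Y, g x ∂μ = μ.real Y * ∫ x, g x ∂(ProbabilityTheory.cond μ Y) := by
    rw [ProbabilityTheory.cond, integral_smul_measure, ENNReal.toReal_inv, smul_eq_mul,
      ← measureReal_def, mul_inv_cancel_left₀ hY_pos.ne']
  have inside := setIntegral_mem_Icc hg hg_mem Y
  have outside := setIntegral_mem_Icc hg hg_mem Yᶜ
  rw [cond_eq] at inside
  have cond_nonneg := nonneg_of_mul_nonneg_right inside.1 hY_pos
  have cond_le_one : ∫ x, g x ∂(ProbabilityTheory.cond μ Y) ≤ 1 :=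
    le_of_mul_le_mul_left (inside.2.trans_eq (mul_one _).symm) hY_pos
  have compl_eq : μ.real Yᶜ = 1 - μ.real Y := probReal_compl_eq_one_sub hY
  rw [← integral_add_compl hY hg, cond_eq, abs_le]
  constructor <;> nlinarith [outside.1, outside.2, measureReal_nonneg (μ := μ) (s := Yᶜ)]

lemma admissibleMesh_const_div (hτ : 0 < τ) (hc : 1 ≤ c) :
    AdmissibleMesh fun n : ℕ => τ / (2 * n) / c := by
  refine admissibleMesh_div (D := 1) ?_ ?_ hc
  · filter_upwards [eventually_gt_atTop 0,
      tendsto_natCast_atTop_atTop.eventually_ge_atTop (2 / τ)] with n hn hnτ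
    have : (0 : ℝ) < n := by exact_mod_cast hn
    rw [div_le_iff₀ hτ] at hnτ
    rw [inv_eq_one_div, div_le_div_iff₀ (by positivity) (by positivity)]
    nlinarith
  · filter_upwards [eventually_gt_atTop 0, tendsto_log_natCast.eventually_ge_atTop τ]
      with n hn hlog
    have : (0 : ℝ) < n := by exact_mod_cast hn
    have mul_eq : n * (τ / (2 * n)) = τ / 2 := by field_simp
    rw [Real.rpow_one]
    linarith

lemma tendsto_mul_const_div (τ c : ℝ) :
    Tendsto (fun n : ℕ => n * (τ / (2 * n) / c)) atTop (𝓝 (τ / (2 * c))) := by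
  refine tendsto_const_nhds.congr' ?_
  filter_upwards [eventually_gt_atTop 0] with n hn
  have : (n : ℝ) ≠ 0 := by exact_mod_cast hn.ne'
  field_simp

lemma tendsto_cond_real_visits_lt [IsProbabilityMeasure μ] (hf : Ergodic f μ)
    (hY : MeasurableSet Y) (hY_pos : 0 < μ.real Y) (hc : c < 1) {N : ℕ → ℕ}
    (hN : Tendsto (fun n : ℕ => (N n : ℝ) / n) atTop (𝓝 (c * μ.real Y))) :
    Tendsto (fun n => (ProbabilityTheory.cond μ Y).real {x | visits f Y n x < gap n + N n}) atTop
      (𝓝 0) := by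
  refine tendsto_measureReal_of_ae_eventually_notMem (fun n =>
    measurableSet_lt (measurable_visits hf.measurable hY n) measurable_const) ?_
  filter_upwards [ProbabilityTheory.cond_absolutelyContinuous.ae_le
    (ae_eventually_gap_add_le_visits hf hY hY_pos hc hN)] with x hx
  exact hx.mono fun n => not_lt.2

lemma ae_eventually_visits_lt_gap_add [IsProbabilityMeasure μ] (hf : Ergodic f μ)
    (hY : MeasurableSet Y) (hY_pos : 0 < μ.real Y) (hc : 1 < c) {N : ℕ → ℕ}
    (hN : Tendsto (fun n : ℕ => (N n : ℝ) / n) atTop (𝓝 (c * μ.real Y))) :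
    ∀ᵐ x ∂μ, ∀ᶠ n in atTop, visits f Y n x < gap n + N n := by
  filter_upwards [ae_tendsto_visits_div hf hY] with x hx
  have limit := tendsto_gap_div.add hN
  filter_upwards [hx.eventually_lt limit (by nlinarith), eventually_gt_atTop 0] with n hn hn_pos
  rw [← add_div, div_lt_div_iff_of_pos_right (by exact_mod_cast hn_pos)] at hn
  exact_mod_cast hn

lemma tendsto_cond_real_le_visits [IsProbabilityMeasure μ] (hf : Ergodic f μ)
    (hY : MeasurableSet Y) (hY_pos : 0 < μ.real Y) (hc : 1 < c) {N : ℕ → ℕ}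
    (hN : Tendsto (fun n : ℕ => (N n : ℝ) / n) atTop (𝓝 (c * μ.real Y))) :
    Tendsto (fun n => (ProbabilityTheory.cond μ Y).real {x | gap n + N n ≤ visits f Y n x}) atTop
      (𝓝 0) := by
  refine tendsto_measureReal_of_ae_eventually_notMem (fun n =>
    measurableSet_le measurable_const (measurable_visits hf.measurable hY n)) ?_
  filter_upwards [ProbabilityTheory.cond_absolutelyContinuous.ae_le
    (ae_eventually_visits_lt_gap_add hf hY hY_pos hc hN)] with x hx
  exact hx.mono fun n => not_le.2

lemma integral_pow_recCount_le_integral_localSurvivalWeight_add {ν : Measure ℝ}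
    [IsFiniteMeasure ν] (hf : Measurable f) (hF : Measurable (returnMap f Y))
    (hνY : ∀ᵐ x ∂ν, x ∈ Y) (hu : u ∈ Icc (0 : ℝ) 1) {r : ℝ} (hr : 0 < r) (q N : ℕ) {p n : ℕ}
    (hp : 1 ≤ p) :
    ∫ x, (1 - u) ^ recCount f n r x ∂ν ≤
      ∫ x, localSurvivalWeight (returnMap f Y) (r / (q + 1)) q u p N x ∂ν +
        (ν.real (outsideReturn f Y n r) + ν.real {x | visits f Y n x < p + N}) := by
  refine (integral_le_integral_add_of_notMem
    (B := outsideReturn f Y n r ∪ {x | visits f Y n x < p + N})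
    (integrable_of_mem_Icc (measurable_pow_recCount hf u n r).aestronglyMeasurable
      fun _ => one_sub_pow_mem_Icc hu _)
    (integrable_localSurvivalWeight hF (by positivity) q hu p N)
    (fun x => (one_sub_pow_mem_Icc hu _).2)
    (fun x => (localSurvivalWeight_mem_Icc hu _ q p N x).1) ?_).trans
    (add_le_add_right (measureReal_union_le _ _) _)
  filter_upwards [hνY] with x hxY hx
  rw [mem_union, not_or] at hx
  rw [recCount_eq_recCount_returnMap_of_notMem hxY hx.1]
  exact pow_recCount_le_localSurvivalWeight hu hr hp (not_lt.1 hx.2)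

lemma integral_localSurvivalWeight_le_integral_pow_recCount_add {ν : Measure ℝ}
    [IsFiniteMeasure ν] (hf : Measurable f) (hF : Measurable (returnMap f Y))
    (hνY : ∀ᵐ x ∂ν, x ∈ Y) (hu : u ∈ Icc (0 : ℝ) 1) {r : ℝ} (hr : 0 < r) {q : ℕ} (hq : 1 ≤ q)
    (p N n : ℕ) :
    ∫ x, localSurvivalWeight (returnMap f Y) (r / q) q u p N x ∂ν ≤
      ∫ x, (1 - u) ^ recCount f n r x ∂ν + (ν.real (outsideReturn f Y n r) +
        (ν.real (earlyReturn (returnMap f Y) p r) + ν.real {x | p + N ≤ visits f Y n x})) := by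
  have q_pos : (0 : ℝ) < q := by exact_mod_cast hq
  refine (integral_le_integral_add_of_notMem
    (B := outsideReturn f Y n r ∪ (earlyReturn (returnMap f Y) p r ∪ {x | p + N ≤ visits f Y n x}))
    (integrable_localSurvivalWeight hF (div_pos hr q_pos) q hu p N)
    (integrable_of_mem_Icc (measurable_pow_recCount hf u n r).aestronglyMeasurable
      fun _ => one_sub_pow_mem_Icc hu _)
    (fun x => (localSurvivalWeight_mem_Icc hu _ q p N x).2)
    (fun x => (one_sub_pow_mem_Icc hu _).1) ?_).trans
    (add_le_add_right ((measureReal_union_le _ _).trans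
      (add_le_add_right (measureReal_union_le _ _) _)) _)
  filter_upwards [hνY] with x hxY hx
  rw [mem_union, mem_union, not_or, not_or] at hx
  rw [recCount_eq_recCount_returnMap_of_notMem hxY hx.1]
  exact localSurvivalWeight_le_pow_recCount hu hr hq (not_le.1 hx.2.2) hx.2.1

lemma tendsto_outsideReturn_const_div (hsys : IsErgodicAcip X f μ) (hρ : IsDensity X μ ρ)
    (hY : MeasurableSet Y) (hYX : Y ⊆ X) [IsProbabilityMeasure (ProbabilityTheory.cond μ Y)]
    (h : RecurrenceEstimates (returnMap f Y) (ProbabilityTheory.cond μ Y) C κ S β)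
    (hτ : 0 < τ) :
    Tendsto (fun n : ℕ => (ProbabilityTheory.cond μ Y).real (outsideReturn f Y n (τ / (2 * n))))
      atTop (𝓝 0) := by
  simpa only [div_one] using tendsto_outsideReturn hsys hρ hY hYX h
    (admissibleMesh_const_div hτ le_rfl) (tendsto_mul_const_div τ 1)

lemma eventually_integral_cond_pow_recCount_lt (hsys : IsErgodicAcip X f μ) (hρ : IsDensity X μ ρ)
    (hY : MeasurableSet Y) (hYX : Y ⊆ X) [IsProbabilityMeasure (ProbabilityTheory.cond μ Y)]
    (h : RecurrenceEstimates (returnMap f Y) (ProbabilityTheory.cond μ Y) C κ S β)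
    (hu : u ∈ Icc (0 : ℝ) 1) (hτ : 0 < τ) (q : ℕ) (hc : c ∈ Ico (0 : ℝ) 1) (hη : 0 < η) :
    ∀ᶠ n : ℕ in atTop,
      ∫ x, (1 - u) ^ recCount f n (τ / (2 * n)) x ∂(ProbabilityTheory.cond μ Y) <
        ∫ x, Real.exp (-(u * (c * (2 * q + 1) * (τ / (2 * (q + 1))) * ρ x)))
          ∂(ProbabilityTheory.cond μ Y) + η := by
  have := hsys.isProbabilityMeasure
  have Y_pos := measureReal_pos_of_isProbabilityMeasure_cond (μ := μ) (Y := Y)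
  have steps_tendsto := tendsto_natFloor_mul_div (mul_nonneg hc.1 Y_pos.le)
  have weight_tendsto := tendsto_integral_localSurvivalWeight hsys hρ hY hYX h hu q
    (admissibleMesh_const_div hτ (c := q + 1) (by linarith [q.cast_nonneg (α := ℝ)]))
    steps_tendsto (tendsto_mul_const_div τ (q + 1))
  have bound_tendsto := weight_tendsto.add
    ((tendsto_outsideReturn_const_div hsys hρ hY hYX h hτ).add
      (tendsto_cond_real_visits_lt hsys.ergodic hY Y_pos hc.2 steps_tendsto))
  rw [add_zero, add_zero] at bound_tendsto
  filter_upwards [bound_tendsto.eventually_lt_const (lt_add_of_pos_right _ hη),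
    eventually_one_le_gap, eventually_gt_atTop 0] with n hn hgap hn_pos
  exact (integral_pow_recCount_le_integral_localSurvivalWeight_add hsys.ergodic.measurable
    h.measurePreserving.measurable (ProbabilityTheory.ae_cond_mem hY) hu (by positivity) q _
    hgap).trans_lt hn

lemma eventually_lt_integral_cond_pow_recCount (hsys : IsErgodicAcip X f μ) (hρ : IsDensity X μ ρ)
    (hY : MeasurableSet Y) (hYX : Y ⊆ X) [IsProbabilityMeasure (ProbabilityTheory.cond μ Y)]
    (h : RecurrenceEstimates (returnMap f Y) (ProbabilityTheory.cond μ Y) C κ S β)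
    (hu : u ∈ Icc (0 : ℝ) 1) (hτ : 0 < τ) {q : ℕ} (hq : 1 ≤ q) (hc : 1 < c) (hη : 0 < η) :
    ∀ᶠ n : ℕ in atTop,
      ∫ x, Real.exp (-(u * (c * (2 * q + 1) * (τ / (2 * q)) * ρ x)))
          ∂(ProbabilityTheory.cond μ Y) <
        ∫ x, (1 - u) ^ recCount f n (τ / (2 * n)) x ∂(ProbabilityTheory.cond μ Y) + η := by
  have := hsys.isProbabilityMeasure
  have Y_pos := measureReal_pos_of_isProbabilityMeasure_cond (μ := μ) (Y := Y)
  have steps_tendsto := tendsto_natFloor_mul_div (mul_nonneg (one_pos.trans hc).le Y_pos.le)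
  have weight_tendsto := tendsto_integral_localSurvivalWeight hsys hρ hY hYX h hu q
    (admissibleMesh_const_div hτ (c := q) (by exact_mod_cast hq)) steps_tendsto
    (tendsto_mul_const_div τ q)
  have early_tendsto := h.tendsto_earlyReturn (admissibleMesh_const_div hτ le_rfl)
  simp only [div_one] at early_tendsto
  have bound_tendsto := weight_tendsto.sub
    ((tendsto_outsideReturn_const_div hsys hρ hY hYX h hτ).add (early_tendsto.add
      (tendsto_cond_real_le_visits hsys.ergodic hY Y_pos hc steps_tendsto)))
  rw [add_zero, add_zero, sub_zero] at bound_tendsto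
  filter_upwards [bound_tendsto.eventually_const_lt (sub_lt_self _ hη), eventually_gt_atTop 0]
    with n hn hn_pos
  have weight_le := integral_localSurvivalWeight_le_integral_pow_recCount_add
    (ν := ProbabilityTheory.cond μ Y) hsys.ergodic.measurable h.measurePreserving.measurable
    (ProbabilityTheory.ae_cond_mem hY) hu (r := τ / (2 * n)) (by positivity) hq (gap n)
    ⌊c * μ.real Y * n⌋₊ n
  linarith

lemma abs_integral_exp_sub_integral_cond_le [IsProbabilityMeasure μ] (hρ : IsDensity X μ ρ)
    (hY : MeasurableSet Y) (hY_pos : 0 < μ.real Y) {b : ℝ} (hb : 0 ≤ b) :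
    |∫ x, Real.exp (-(b * ρ x)) ∂μ -
      ∫ x, Real.exp (-(b * ρ x)) ∂(ProbabilityTheory.cond μ Y)| ≤ μ.real Yᶜ := by
  refine abs_integral_sub_integral_cond_le hY hY_pos (hρ.integrable_exp_neg_mul hb) ?_
  filter_upwards [hρ.ae_pos] with x hx
  exact ⟨(Real.exp_pos _).le,
    Real.exp_le_one_iff.2 (neg_nonpos.2 (mul_nonneg hb hx.le))⟩

lemma abs_integral_pow_recCount_sub_integral_cond_le [IsProbabilityMeasure μ] (hf : Measurable f)
    (hY : MeasurableSet Y) (hY_pos : 0 < μ.real Y) (hu : u ∈ Icc (0 : ℝ) 1) (n : ℕ) (r : ℝ) :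
    |∫ x, (1 - u) ^ recCount f n r x ∂μ -
      ∫ x, (1 - u) ^ recCount f n r x ∂(ProbabilityTheory.cond μ Y)| ≤ μ.real Yᶜ :=
  abs_integral_sub_integral_cond_le hY hY_pos
    (integrable_of_mem_Icc (measurable_pow_recCount hf u n r).aestronglyMeasurable
      fun _ => one_sub_pow_mem_Icc hu _)
    (Eventually.of_forall fun _ => one_sub_pow_mem_Icc hu _)

lemma eventually_integral_pow_recCount_lt (hsys : IsErgodicAcip X f μ) (hρ : IsDensity X μ ρ)
    (hasym : AsymptoticallyHyperbolic X f μ) (hu : u ∈ Icc (0 : ℝ) 1) (hτ : 0 < τ) (q : ℕ)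
    (hc : c ∈ Ico (0 : ℝ) 1) (hη : 0 < η) :
    ∀ᶠ n : ℕ in atTop, ∫ x, (1 - u) ^ recCount f n (τ / (2 * n)) x ∂μ <
      ∫ x, Real.exp (-(u * (c * (2 * q + 1) * (τ / (2 * (q + 1)))) * ρ x)) ∂μ + η := by
  have := hsys.isProbabilityMeasure
  obtain ⟨Y, C, κ, S, β, hY, hYX, compl_le, _, h⟩ :=
    hasym.exists_recurrenceEstimates hsys (show 0 < η / 3 by positivity)
  have compl_real_le : μ.real Yᶜ ≤ η / 3 := ENNReal.toReal_le_of_le_ofReal (by positivity) compl_le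
  have Y_pos := measureReal_pos_of_isProbabilityMeasure_cond (μ := μ) (Y := Y)
  have rate_nonneg : 0 ≤ u * (c * (2 * q + 1) * (τ / (2 * (q + 1)))) := by
    have := hu.1; have := hc.1; positivity
  have exp_close := abs_le.1 (abs_integral_exp_sub_integral_cond_le hρ hY Y_pos rate_nonneg)
  filter_upwards [eventually_integral_cond_pow_recCount_lt hsys hρ hY hYX h hu hτ q hc
    (show 0 < η / 3 by positivity)] with n hn
  have pow_close := abs_le.1 (abs_integral_pow_recCount_sub_integral_cond_le
    hsys.ergodic.measurable hY Y_pos hu n (τ / (2 * n)))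
  simp only [← mul_assoc] at hn exp_close ⊢
  linarith [exp_close.1, pow_close.2]

lemma eventually_lt_integral_pow_recCount (hsys : IsErgodicAcip X f μ) (hρ : IsDensity X μ ρ)
    (hasym : AsymptoticallyHyperbolic X f μ) (hu : u ∈ Icc (0 : ℝ) 1) (hτ : 0 < τ) {q : ℕ}
    (hq : 1 ≤ q) (hc : 1 < c) (hη : 0 < η) :
    ∀ᶠ n : ℕ in atTop,
      ∫ x, Real.exp (-(u * (c * (2 * q + 1) * (τ / (2 * q))) * ρ x)) ∂μ <
        ∫ x, (1 - u) ^ recCount f n (τ / (2 * n)) x ∂μ + η := by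
  have := hsys.isProbabilityMeasure
  obtain ⟨Y, C, κ, S, β, hY, hYX, compl_le, _, h⟩ :=
    hasym.exists_recurrenceEstimates hsys (show 0 < η / 3 by positivity)
  have compl_real_le : μ.real Yᶜ ≤ η / 3 := ENNReal.toReal_le_of_le_ofReal (by positivity) compl_le
  have Y_pos := measureReal_pos_of_isProbabilityMeasure_cond (μ := μ) (Y := Y)
  have rate_nonneg : 0 ≤ u * (c * (2 * q + 1) * (τ / (2 * q))) := by
    have := hu.1; positivity
  have exp_close := abs_le.1 (abs_integral_exp_sub_integral_cond_le hρ hY Y_pos rate_nonneg)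
  filter_upwards [eventually_lt_integral_cond_pow_recCount hsys hρ hY hYX h hu hτ hq hc
    (show 0 < η / 3 by positivity)] with n hn
  have pow_close := abs_le.1 (abs_integral_pow_recCount_sub_integral_cond_le
    hsys.ergodic.measurable hY Y_pos hu n (τ / (2 * n)))
  simp only [← mul_assoc] at hn exp_close ⊢
  linarith [exp_close.2, pow_close.1]

lemma tendsto_integral_exp_neg_mul {α : Type*} [MeasurableSpace α] {μ : Measure α}
    [IsFiniteMeasure μ] {h : α → ℝ} (hm : AEMeasurable h μ) (h_nonneg : 0 ≤ᵐ[μ] h)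
    {v : ℕ → ℝ} (hv : ∀ k, 0 ≤ v k) {w : ℝ} (hvw : Tendsto v atTop (𝓝 w)) :
    Tendsto (fun k => ∫ x, Real.exp (-(v k * h x)) ∂μ) atTop
      (𝓝 (∫ x, Real.exp (-(w * h x)) ∂μ)) := by
  refine tendsto_integral_of_dominated_convergence (fun _ => 1) (fun k =>
    (Real.measurable_exp.comp_aemeasurable (hm.const_mul _).neg).aestronglyMeasurable)
    (integrable_const _) (fun k => ?_) (Eventually.of_forall fun x => ?_)
  · filter_upwards [h_nonneg] with x hx
    rw [Real.norm_of_nonneg (Real.exp_pos _).le, Real.exp_le_one_iff]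
    exact neg_nonpos.2 (mul_nonneg (hv k) hx)
  · exact (Real.continuous_exp.tendsto _).comp (hvw.mul_const _).neg

lemma tendsto_upper_rate (u τ : ℝ) :
    Tendsto (fun k : ℕ => u * ((1 + 1 / ((k : ℝ) + 1)) * (2 * (k + 1 : ℕ) + 1) *
      (τ / (2 * (k + 1 : ℕ))))) atTop (𝓝 (u * τ)) := by
  have inv_tendsto : Tendsto (fun k : ℕ => 1 / ((k : ℝ) + 1)) atTop (𝓝 0) :=
    tendsto_one_div_add_atTop_nhds_zero_nat
  have limit := ((inv_tendsto.const_add 1).mul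
    ((inv_tendsto.div_const 2).const_add 1)).const_mul (u * τ)
  simp only [add_zero, zero_div, mul_one] at limit
  refine limit.congr fun k => ?_
  push_cast
  field_simp

lemma tendsto_lower_rate (u τ : ℝ) :
    Tendsto (fun k : ℕ => u * ((1 - 1 / ((k : ℝ) + 1)) * (2 * (k : ℝ) + 1) *
      (τ / (2 * (k + 1))))) atTop (𝓝 (u * τ)) := by
  have inv_tendsto : Tendsto (fun k : ℕ => 1 / ((k : ℝ) + 1)) atTop (𝓝 0) :=
    tendsto_one_div_add_atTop_nhds_zero_nat
  have limit := ((inv_tendsto.const_sub 1).mul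
    ((inv_tendsto.div_const 2).const_sub 1)).const_mul (u * τ)
  simp only [sub_zero, zero_div, mul_one] at limit
  refine limit.congr fun k => ?_
  field_simp
  ring

lemma tendsto_integral_pow_recCount (hsys : IsErgodicAcip X f μ) (hρ : IsDensity X μ ρ)
    (hasym : AsymptoticallyHyperbolic X f μ) (hu : u ∈ Icc (0 : ℝ) 1) (hτ : 0 < τ) :
    Tendsto (fun n : ℕ => ∫ x, (1 - u) ^ recCount f n (τ / (2 * n)) x ∂μ) atTop
      (𝓝 (∫ x, Real.exp (-(u * τ * ρ x)) ∂μ)) := by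
  have := hsys.isProbabilityMeasure
  have ρ_nonneg : 0 ≤ᵐ[μ] ρ := hρ.ae_pos.mono fun x hx => hx.le
  have u_nonneg := hu.1
  have inv_pos (k : ℕ) : 0 < 1 / ((k : ℝ) + 1) := by positivity
  have one_sub_inv_nonneg (k : ℕ) : 0 ≤ 1 - 1 / ((k : ℝ) + 1) :=
    sub_nonneg.2 ((div_le_one (by positivity)).2 (by linarith [k.cast_nonneg (α := ℝ)]))
  refine tendsto_order.2 ⟨fun a ha => ?_, fun b hb => ?_⟩
  · obtain ⟨k, hk⟩ := ((tendsto_integral_exp_neg_mul hρ.aemeasurable_self ρ_nonneg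
      (fun k => by positivity) (tendsto_upper_rate u τ)).eventually_const_lt ha).exists
    filter_upwards [eventually_lt_integral_pow_recCount hsys hρ hasym hu hτ (Nat.le_add_left 1 k)
      (lt_add_of_pos_right 1 (inv_pos k)) (sub_pos.2 hk)] with n hn
    linarith
  · obtain ⟨k, hk⟩ := ((tendsto_integral_exp_neg_mul hρ.aemeasurable_self ρ_nonneg
      (fun k => by have := one_sub_inv_nonneg k; positivity)
      (tendsto_lower_rate u τ)).eventually_lt_const hb).exists
    filter_upwards [eventually_integral_pow_recCount_lt hsys hρ hasym hu hτ k
      ⟨one_sub_inv_nonneg k, sub_lt_self 1 (inv_pos k)⟩ (sub_pos.2 hk)] with n hn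
    linarith

theorem tendsto_measureReal_recCount_eq (hsys : IsErgodicAcip X f μ) (hρ : IsDensity X μ ρ)
    (hasym : AsymptoticallyHyperbolic X f μ) (hτ : 0 < τ) (k : ℕ) :
    Tendsto (fun n : ℕ => μ.real {x ∈ X | recCount f n (τ / (2 * n)) x = k}) atTop
      (𝓝 (∫ x in X, τ ^ k * ρ x ^ (k + 1) / (k.factorial : ℝ) * Real.exp (-(ρ x * τ)))) := by
  have := hsys.isProbabilityMeasure
  have rate_nonneg : 0 ≤ᵐ[μ] fun x => τ * ρ x :=
    hρ.ae_pos.mono fun x hx => mul_nonneg hτ.le hx.le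
  have count_tendsto := tendsto_coeff_of_tendsto_tsum
    (a := fun n k => μ.real {x | recCount f n (τ / (2 * n)) x = k})
    (b := fun k => ∫ x, (τ * ρ x) ^ k / (k.factorial : ℝ) * Real.exp (-(τ * ρ x)) ∂μ)
    (fun n k => ⟨measureReal_nonneg, measureReal_le_one⟩)
    (integral_mixedPoisson_mem_Icc rate_nonneg) (fun z hz => by
      rw [← integral_exp_eq_tsum_mixedPoisson (hρ.aemeasurable_self.const_mul τ) rate_nonneg hz]
      simp only [← integral_pow_eq_tsum (measurable_recCount hsys.ergodic.measurable _ _)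
        (Ioo_subset_Icc_self hz)]
      simpa only [sub_sub_cancel, mul_assoc] using tendsto_integral_pow_recCount hsys hρ hasym
        (u := 1 - z) ⟨sub_nonneg.2 hz.2.le, sub_le_self 1 hz.1.le⟩ hτ) k
  have limit_eq : ∫ x, (τ * ρ x) ^ k / (k.factorial : ℝ) * Real.exp (-(τ * ρ x)) ∂μ =
      ∫ x in X, τ ^ k * ρ x ^ (k + 1) / (k.factorial : ℝ) * Real.exp (-(ρ x * τ)) := by
    rw [hρ.integral_eq hsys.measurableSet]
    refine integral_congr_ae (Eventually.of_forall fun x => ?_)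
    dsimp only
    rw [mul_comm (ρ x) τ]
    ring
  rw [← limit_eq]
  refine count_tendsto.congr fun n => measureReal_congr ?_
  filter_upwards [show ∀ᵐ x ∂μ, x ∈ X from hsys.measure_compl] with x hx
  exact propext ⟨fun h => ⟨hx, h⟩, fun h => h.2⟩

end limitLaw

end Recurrence

end

theorem mainTheorem3_general (X : Set ℝ) (f : ℝ → ℝ) (μ : Measure ℝ) (ρ : ℝ → ℝ)
    (hsys : Recurrence.IsErgodicAcip X f μ)
    (hρ : Recurrence.IsDensity X μ ρ)
    (hasym : Recurrence.AsymptoticallyHyperbolic X f μ) :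
    (∀ τ : ℝ, 0 < τ → ∀ k : ℕ,
      Tendsto (fun n : ℕ => μ.real {x ∈ X | Recurrence.recCount f n (τ / (2 * n)) x = k}) atTop
        (𝓝 (∫ x in X, τ ^ k * ρ x ^ (k + 1) / (k.factorial : ℝ) * Real.exp (-(ρ x * τ))))) ∧
    (∀ (r : ℕ → ℝ) (c : ℝ), 1 < 2 * c * sInf (ρ '' X) →
      (∀ᶠ n : ℕ in atTop, c * Real.log (Real.log n) / n < r n) →
      μ {x ∈ X | ∀ᶠ n : ℕ in atTop, Recurrence.recMin f n x < r n} = 1) ∧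
    (∀ (r : ℕ → ℝ) (γ γ₀ : ℝ), (∀ ε : ℝ, 0 < ε → Summable (fun k : ℕ =>
        ∫ x in X, ρ x * Real.exp (-(ε * ((k : ℝ) + 1) ^ γ₀ * ρ x)))) →
      γ₀ < γ →
      (∀ᶠ n : ℕ in atTop, Real.log n ^ γ / (2 * n) < r n) →
      μ {x ∈ X | ∀ᶠ n : ℕ in atTop, Recurrence.recMin f n x < r n} = 1) ∧
    (∀ r : ℕ → ℝ, AntitoneOn r (Ici 1) →
      ∑' n : ℕ, ∫⁻ x, μ (Metric.ball x (r (n + 1))) ∂μ < ⊤ →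
      μ {x ∈ X | ∀ᶠ n : ℕ in atTop, r n < Recurrence.recMin f n x} = 1) :=
  ⟨fun _ hτ k => Recurrence.tendsto_measureReal_recCount_eq hsys hρ hasym hτ k,
    fun _ _ hc hr => hsys.measure_setOf_mem_eq_one
      (Recurrence.ae_eventually_recMin_lt_of_lt_sInf hsys hρ hasym hc hr),
    fun _ _ _ hsum hγ hr => hsys.measure_setOf_mem_eq_one
      (Recurrence.ae_eventually_recMin_lt_of_summable hsys hρ hasym hsum hγ hr),
    fun _ hr hsum => hsys.measure_setOf_mem_eq_one
      (Recurrence.ae_eventually_lt_recMin hsys hasym hr hsum)⟩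

theorem mainTheorem3 (X : Set ℝ) (f : ℝ → ℝ) (μ : Measure ℝ) (ρ : ℝ → ℝ)
    (hsys : Recurrence.IsErgodicAcip X f μ)
    (hρ : Recurrence.IsDensity X μ ρ)
    (hasym : Recurrence.AsymptoticallyHyperbolic X f μ) :
    -- the distributional limit law
    (∀ τ : ℝ, 0 < τ → ∀ k : ℕ, 1 ≤ k →
      Tendsto (fun n : ℕ => μ.real {x ∈ X | Recurrence.recCount f n (τ / (2 * n)) x = k}) atTop
        (𝓝 (∫ x in X, τ ^ k * ρ x ^ (k + 1) / (k.factorial : ℝ) * Real.exp (-(ρ x * τ))))) ∧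
    -- almost sure upper bound, density bounded below
    (∀ (r : ℕ → ℝ) (c : ℝ), (∀ x ∈ X, 0 < ρ x) → 1 < 2 * c * sInf (ρ '' X) →
      (∀ᶠ n : ℕ in atTop, c * Real.log (Real.log n) / n < r n) →
      μ {x ∈ X | ∀ᶠ n : ℕ in atTop, Recurrence.recMin f n x < r n} = 1) ∧
    -- almost sure upper bound, Hölder density
    (∀ (r : ℕ → ℝ) (γ γ₀ : ℝ), Recurrence.UniformlyHolderOn X ρ →
      (∀ ε : ℝ, 0 < ε → Summable (fun k : ℕ =>
        ∫ x in X, ρ x * Real.exp (-(ε * ((k : ℝ) + 1) ^ γ₀ * ρ x)))) →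
      γ₀ < γ →
      (∀ᶠ n : ℕ in atTop, Real.log n ^ γ / (2 * n) < r n) →
      μ {x ∈ X | ∀ᶠ n : ℕ in atTop, Recurrence.recMin f n x < r n} = 1) ∧
    -- almost sure lower bound
    (∀ r : ℕ → ℝ, AntitoneOn r (Ici 1) →
      ∑' n : ℕ, ∫⁻ x, μ (Metric.ball x (r (n + 1))) ∂μ < ⊤ →
      μ {x ∈ X | ∀ᶠ n : ℕ in atTop, r n < Recurrence.recMin f n x} = 1) := by
  obtain ⟨limit_law, upper_lt_sInf, upper_summable, lower⟩ :=
    mainTheorem3_general X f μ ρ hsys hρ hasym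
  exact ⟨fun τ hτ k _ => limit_law τ hτ k, fun r c _ => upper_lt_sInf r c,
    fun r γ γ₀ _ => upper_summable r γ γ₀, lower⟩
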